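/- Let $n\ge 1$ and let $\mathcal{Z}_n=\mathbb{R}[\Lambda]/(\Lambda^n)$, with basis $e_q=\Lambda^{q}$ ($0\le q\le n-1$). For $a=\sum_q a_q\Lambda^q$ put $\omega_k(a)=a_k+a_{n-1}$ for $0\le k<n-1$ and $\omega_{n-1}(a)=a_{n-1}$. Consider the coupled KP hierarchy of Casati–Ortenzi in its Lax form, that is, the $\mathcal{Z}_n$-KP hierarchy $$\frac{\partial L}{\partial t_r}=[B_r,L],\qquad B_r=(L^r)_+,\qquad r=1,2,\dots,$$ for a $\mathcal{Z}_n$-valued pseudo-differential operator $L=\partial+U_1\partial^{-1}+U_2\partial^{-2}+\cdots$ (the reduced case), and also its extension to $L=\partial+U_0+U_1\partial^{-1}+\cdots$ (the full case). Let $m\ge1$ and take as coordinates the components $v_{[i]q}$ of the coefficients $V_i=\sum_q v_{[i]q}e_q$ ($i\le N$) of $\mathcal{L}=L^m=\partial^m+\sum_{i\le N}V_i\partial^i$, where $N=m-1$ in the full case and $N=m-2$ (so $V_{m-1}=0$) in the reduced case. There is exactly one $L$ of the stated form, with coefficients that are $\mathcal{Z}_n$-valued differential polynomials in the $v_{[i]q}$,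 such that $L^m=\mathcal{L}$. Functionals are classes $\int f\,dx$ of real differential polynomials $f$ in the $v_{[i]q}$ modulo total $x$-derivatives. For a non-degenerate linear form $\omega$ on $\mathcal Z_n$, extended coefficientwise to $\mathcal{Z}_n$-valued differential polynomials and then written $\mathrm{tr}$, let $\delta f/\delta V_i$ be the $\mathcal{Z}_n$-valued differential polynomial with $\mathrm{tr}(\frac{\delta f}{\delta V_i}\,e_q)=\frac{\delta f}{\delta v_{[i]q}}$ for all $q$. Put $X_i=\delta f/\delta V_i$ for $i\le N$ and $$\frac{\delta f}{\delta\mathcal{L}}=\sum_{i\le m-1}\partial^{-i-1}X_i ,$$ where in the reduced case, with $V_m=1$ and $V_{m-1}=0$, $$X_{m-1}=\frac1m\sum_{i\le m-2}\ \sum_{j=i+1}^{m}\binom{-i-1}{j-i}(X_iV_j)^{(j-i-1)} .$$ Define $$H^{m(0)}(X)=(\mathcal{L}X)_+\mathcal{L}-\mathcal{L}(X\mathcal{L})_+,\qquad H^{m(\infty)}(X)=[\mathcal{L}_-,X_+]_- -[\mathcal{L}_+,X_-]_+ .$$ Then $\omega_0,\dots,\omega_{n-1}$ are $n$ different linear forms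 on $\mathcal{Z}_n$, and each is a Frobenius trace form, i.e. $\langle a,b\rangle_k=\omega_k(ab)$ is non-degenerate. For every $m\ge1$, in the full case and in the reduced case, and for every $k$, the trace $\mathrm{tr}=\omega_k$ induces a local bi-Hamiltonian structure of the hierarchy, as follows. 1. If $X=\delta f/\delta\mathcal{L}$, then $H^{m(0)}(X)$ and $H^{m(\infty)}(X)$ have order at most $N$, and $$\Big\{\int f,\int g\Big\}_k^{m(\ast)}=\mathrm{tr}\int\mathrm{res}\Big(H^{m(\ast)}\Big(\frac{\delta f}{\delta\mathcal{L}}\Big)\frac{\delta g}{\delta\mathcal{L}}\Big)dx,\qquad \ast=0,\infty,$$ are well-defined bilinear brackets on functionals. 2. All real linear combinations of these two brackets are skew-symmetric and satisfy the Jacobi identity, so they are compatible Poisson brackets. 3. Both brackets are local: they are of the form $\int\sum_{\alpha,\beta}\frac{\delta g}{\delta v_\alpha}J_{\alpha\beta}\frac{\delta f}{\delta v_\beta}\,dx$, where each $J_{\alpha\beta}$ is a differential operator of finite order with differential polynomials as coefficients. 4. Both brackets preserve the space of functionals $\int\mathrm{tr}\,F(V)\,dx$, with $F$ a polynomial over $\mathcal{Z}_n$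 in the $V_i$ and their $x$-derivatives. 5. For every $r\ge1$, with $h_r=\frac mr\,\mathrm{tr}\,\mathrm{res}\,L^r$ and $g_r=-\frac{m}{r+m}\,\mathrm{tr}\,\mathrm{res}\,L^{m+r}$, $$[B_r,\mathcal{L}]=H^{m(0)}\Big(\frac{\delta h_r}{\delta\mathcal{L}}\Big)=H^{m(\infty)}\Big(\frac{\delta g_r}{\delta\mathcal{L}}\Big).$$ The vector field $\partial_{t_r}$ determined by $\partial_{t_r}\mathcal{L}=[B_r,\mathcal{L}]$ satisfies $\partial_{t_r}L=[B_r,L]$, and for all $f$ $$\Big\{\int h_r,\int f\Big\}_k^{m(0)}=\int\partial_{t_r}f\,dx=\Big\{\int g_r,\int f\Big\}_k^{m(\infty)} .$$ The $n$ structures are pairwise different: for fixed $m$ and fixed case, $\{\,,\}_k^{m(0)}\ne\{\,,\}_{k'}^{m(0)}$ and $\{\,,\}_k^{m(\infty)}\ne\{\,,\}_{k'}^{m(\infty)}$ whenever $k\ne k'$. -/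

import Mathlib

/-! ### Frobenius algebras and the algebra `Z_n` -/

namespace FrobeniusKP

/-- A linear form `ω` on a commutative algebra is a trace form (Frobenius form) if the symmetric
bilinear form `⟨a, b⟩ = ω (a b)` is non-degenerate. -/
def IsTraceForm {A : Type} [CommRing A] [Algebra ℝ A] (ω : A →ₗ[ℝ] ℝ) : Prop :=
  ∀ a : A, (∀ b : A, ω (a * b) = 0) → a = 0

/-- The algebra `Z_n = ℝ[Λ]/(Λ^n)`. -/
abbrev Zn (n : ℕ) : Type := AdjoinRoot ((Polynomial.X : Polynomial ℝ) ^ n)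

/-- The basis `1, Λ, …, Λ^(n-1)` of `Z_n`, indexed from `0`. -/
noncomputable def znBasis (n : ℕ) : Module.Basis (Fin n) ℝ (Zn n) :=
  (AdjoinRoot.powerBasisAux' (Polynomial.monic_X_pow (R := ℝ) n)).reindex
    (finCongr (Polynomial.natDegree_X_pow n))

/-- The element of the basis with index `q` is `Λ^q`. -/
theorem znBasis_apply (n : ℕ) (q : Fin n) :
    znBasis n q = AdjoinRoot.root ((Polynomial.X : Polynomial ℝ) ^ n) ^ (q : ℕ) := by
  have h := (AdjoinRoot.powerBasis' (Polynomial.monic_X_pow (R := ℝ) n)).basis_eq_pow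
  have h2 := h ((finCongr (Polynomial.natDegree_X_pow (R := ℝ) n)).symm q)
  rw [znBasis, Module.Basis.reindex_apply]
  exact h2

/-- The "basic" trace-type forms `ω_0, …, ω_{n-1}` on `Z_n`. If `a = ∑_q a_q Λ^q` with
`0 ≤ q ≤ n-1`, then `ω_k (a) = a_k + a_{n-1}` for `k < n-1`, and `ω_{n-1} (a) = a_{n-1}`. -/
noncomputable def basicForm (n : ℕ) (k : Fin n) : Zn n →ₗ[ℝ] ℝ :=
  (znBasis n).coord k +
    if (k : ℕ) + 1 = n then 0
    else (znBasis n).coord ⟨n - 1, Nat.sub_lt (Nat.lt_of_le_of_lt (Nat.zero_le _) k.2) one_pos⟩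

/-! ### Formal pseudo-differential operators

An operator `∑_k P_k ∂^k` with coefficients in a commutative ring `S` with a derivation
`d` is given by its coefficients `k ↦ P_k`. All operators used below have coefficients
that vanish for all large `k`, so that the sums which define the product are finite. -/

/-- Formal pseudo-differential operators over `S`, through their coefficients. -/
abbrev PsiDO (S : Type) : Type := ℤ → S

namespace PsiDO

/-- The product determined by `∂^i ∘ f = ∑_{l ≥ 0} (i choose l) f^{(l)} ∂^{i-l}`: the
coefficient of `∂^k` in `P ∘ Q` is the sum of all `(i choose l) P_i (Q_j)^{(l)}` with
`i + j - l = k`. -/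
noncomputable def comp {S : Type} [CommRing S] (d : S → S) (P Q : PsiDO S) : PsiDO S :=
  fun k => ∑ᶠ p : ℤ × ℕ, Ring.choose p.1 p.2 • (P p.1 * d^[p.2] (Q (k - p.1 + p.2)))

/-- The operator `∂^s`. -/
def dpow {S : Type} [CommRing S] (s : ℤ) : PsiDO S := fun k => if k = s then 1 else 0

/-- The operator of multiplication by a function. -/
def fn {S : Type} [CommRing S] (a : S) : PsiDO S := fun k => if k = 0 then a else 0

/-- The powers `P^r = P ∘ ⋯ ∘ P`. -/
noncomputable def pow {S : Type} [CommRing S] (d : S → S) (P : PsiDO S) : ℕ → PsiDO S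
  | 0 => dpow 0
  | r + 1 => comp d P (pow d P r)

/-- The pure differential part `P_+`. -/
def pos {S : Type} [CommRing S] (P : PsiDO S) : PsiDO S := fun k => if 0 ≤ k then P k else 0

/-- The integral part `P_- = P - P_+`. -/
def neg {S : Type} [CommRing S] (P : PsiDO S) : PsiDO S := P - pos P

/-- The residue, i.e. the coefficient of `∂^{-1}`. -/
def res {S : Type} (P : PsiDO S) : S := P (-1)

/-- The commutator `[P, Q] = P ∘ Q - Q ∘ P`. -/
noncomputable def comm {S : Type} [CommRing S] (d : S → S) (P Q : PsiDO S) : PsiDO S :=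
  comp d P Q - comp d Q P

end PsiDO

/-! ### Differential polynomials and functionals

The fields are `V_i`, for the integers `i ≤ N`, with values in an algebra with a basis of `n`
elements; their scalar components are `v_{[i]q}`, with `q : Fin n`. -/

/-- The indices `(i, q)` of the scalar fields `v_{[i]q}`. -/
abbrev Comp (N : ℤ) (n : ℕ) : Type := Set.Iic N × Fin n

/-- Polynomials with coefficients in `R` in the symbols `v_{[i]q}^{(j)}`. For `R = ℝ` these are the
scalar differential polynomials; for an algebra `R = A` they are the `A`-valued ones. -/
abbrev DiffPoly (N : ℤ) (n : ℕ) (R : Type) [CommRing R] : Type := MvPolynomial (Comp N n × ℕ) R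

/-- The derivation `∂ = d/dx`, with `∂ v_{[i]q}^{(j)} = v_{[i]q}^{(j+1)}`. -/
noncomputable def dx (N : ℤ) (n : ℕ) (R : Type) [CommRing R] :
    Derivation R (DiffPoly N n R) (DiffPoly N n R) :=
  MvPolynomial.mkDerivation R fun v => MvPolynomial.X (v.1, v.2 + 1)

/-- The evolutionary vector field `∂_c = ∑ c_{[i]q}^{(j)} ∂/∂v_{[i]q}^{(j)}`, where `c_{[i]q}` are
scalar differential polynomials. It acts on `R`-valued differential polynomials. -/
noncomputable def evol (N : ℤ) (n : ℕ) (R : Type) [CommRing R] [Algebra ℝ R]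
    (c : Comp N n → DiffPoly N n ℝ) : Derivation R (DiffPoly N n R) (DiffPoly N n R) :=
  MvPolynomial.mkDerivation R fun v =>
    MvPolynomial.map (algebraMap ℝ R) ((dx N n ℝ)^[v.2] (c v.1))

/-- The space of functionals `∫ f dx`: scalar differential polynomials modulo total derivatives. -/
abbrev Functional (N : ℤ) (n : ℕ) : Type :=
  DiffPoly N n ℝ ⧸ LinearMap.range (dx N n ℝ).toLinearMap

/-- The functional `∫ f dx`. -/
noncomputable def integral {N : ℤ} {n : ℕ} (f : DiffPoly N n ℝ) : Functional N n := Submodule.Quotient.mk f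

/-- The scalar variational derivative `δf/δv_α = ∑_j (-∂)^j ∂f/∂v_α^{(j)}`. -/
noncomputable def varDeriv {N : ℤ} {n : ℕ} (f : DiffPoly N n ℝ) (α : Comp N n) : DiffPoly N n ℝ :=
  ∑ᶠ j : ℕ, (-1) ^ j * (dx N n ℝ)^[j] (MvPolynomial.pderiv (α, j) f)

/-- A linear form `φ : A → ℝ` applied to the coefficients of an `A`-valued differential
polynomial. -/
noncomputable def applyCoeff {N : ℤ} {n : ℕ} {A : Type} [CommRing A] [Algebra ℝ A]
    (φ : A →ₗ[ℝ] ℝ) (F : DiffPoly N n A) : DiffPoly N n ℝ :=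
  ∑ s ∈ F.support, MvPolynomial.monomial s (φ (F.coeff s))

/-! ### Poisson brackets on functionals -/

/-- Bilinear operations on the space of functionals. -/
abbrev Bracket (N : ℤ) (n : ℕ) : Type :=
  Functional N n →ₗ[ℝ] Functional N n →ₗ[ℝ] Functional N n

/-- Skew-symmetry and the Jacobi identity. -/
structure IsPoisson {N : ℤ} {n : ℕ} (B : Bracket N n) : Prop where
  skew : ∀ F G, B F G = -B G F
  jacobi : ∀ F G H, B (B F G) H + B (B G H) F + B (B H F) G = 0

/-- A bracket is local if it is given by a matrix of differential operators
`J_{αβ} = ∑_s J_{αβ,s} ∂^s` of finite order, with differential polynomials as coefficients: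
`{∫f, ∫g} = ∫ ∑_{α,β} (δg/δv_α) J_{αβ} (δf/δv_β) dx`. -/
def IsLocal {N : ℤ} {n : ℕ} (B : Bracket N n) : Prop :=
  ∃ J : Comp N n → Comp N n → (ℕ →₀ DiffPoly N n ℝ), ∀ f g : DiffPoly N n ℝ,
    B (integral f) (integral g) =
      integral (∑ᶠ α : Comp N n, ∑ᶠ β : Comp N n,
        varDeriv g α * (J α β).sum fun s a => a * (dx N n ℝ)^[s] (varDeriv f β))

/-- The evolutionary vector field `∂_c` is Hamiltonian for the bracket `B`, with
Hamiltonian `H`. -/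
def IsHamiltonianField {N : ℤ} {n : ℕ} (B : Bracket N n) (H : Functional N n)
    (c : Comp N n → DiffPoly N n ℝ) : Prop :=
  ∀ f : DiffPoly N n ℝ, B H (integral f) = integral (evol N n ℝ c f)

/-! ### The Adler–Gelfand–Dickey construction for the `A`-valued KP hierarchy

Throughout, `A` is a commutative algebra with a basis `b` and a linear form `ω`. -/

section AGD

open PsiDO

/-- The `A`-valued field `V_i = ∑_q v_{[i]q} e_q`, and its derivatives `V_i^{(j)}`. -/
noncomputable def field {n : ℕ} {A : Type} [CommRing A] [Algebra ℝ A]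
    (b : Module.Basis (Fin n) ℝ A) {N : ℤ} (i : Set.Iic N) (j : ℕ) : DiffPoly N n A :=
  ∑ q : Fin n, MvPolynomial.C (b q) * MvPolynomial.X ((i, q), j)

/-- The `A`-valued differential polynomials in the fields `V_i`, with coefficients in `A`. -/
noncomputable def valuedPoly {n : ℕ} {A : Type} [CommRing A] [Algebra ℝ A]
    (b : Module.Basis (Fin n) ℝ A) (N : ℤ) : Subalgebra A (DiffPoly N n A) :=
  Algebra.adjoin A (Set.range fun p : Set.Iic N × ℕ => field b p.1 p.2)

/-- The highest index of a field: the fields are `V_{m-1}, V_{m-2}, …`, or, under the constraint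
`V_{m-1} = 0` (that is when `reduced` is true), `V_{m-2}, V_{m-3}, …`. -/
def top (m : ℕ) (reduced : Bool) : ℤ := (m : ℤ) - if reduced = true then 2 else 1

/-- The operator `𝓛 = ∂^m + ∑_{i ≤ N} V_i ∂^i` (used with `N < m`). -/
noncomputable def laxPower {n : ℕ} {A : Type} [CommRing A] [Algebra ℝ A]
    (b : Module.Basis (Fin n) ℝ A) (m : ℕ) (N : ℤ) : PsiDO (DiffPoly N n A) :=
  fun k => if h : k ≤ N then field b ⟨k, h⟩ 0 else if k = m then 1 else 0

/-- `L` is the Lax operator of the hierarchy in the coordinates `V_i`: it satisfies `L^m = 𝓛`, and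
`L = ∂ + U_0 + U_1 ∂^{-1} + ⋯` in the full case, `L = ∂ + U_1 ∂^{-1} + ⋯` in the reduced case. -/
def IsLax {n : ℕ} {A : Type} [CommRing A] [Algebra ℝ A]
    (b : Module.Basis (Fin n) ℝ A) (m : ℕ) (reduced : Bool)
    (L : PsiDO (DiffPoly (top m reduced) n A)) : Prop :=
  L 1 = 1 ∧ (∀ k : ℤ, 1 < k → L k = 0) ∧ (reduced = true → L 0 = 0) ∧
    pow (dx (top m reduced) n A) L m = laxPower b m (top m reduced)

/-- The basis dual to `b`, obtained from the inverse of the Gram matrix: if `ω` is a trace form,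
then `ω (dualVec b ω q * b p)` is `1` for `p = q` and `0` otherwise. -/
noncomputable def dualVec {n : ℕ} {A : Type} [CommRing A] [Algebra ℝ A]
    (b : Module.Basis (Fin n) ℝ A) (ω : A →ₗ[ℝ] ℝ) (q : Fin n) : A :=
  ∑ p : Fin n, (Matrix.of fun p p' : Fin n => ω (b p * b p'))⁻¹ q p • b p

/-- The variational derivative `δf/δV_i` with respect to an `A`-valued field. For a trace form `ω`
it is characterised by `tr (δf/δV_i ∘ a) = ∑_q (δf/δv_{[i]q}) a_q` for all `a = ∑_q a_q e_q`. -/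
noncomputable def valuedVarDeriv {n : ℕ} {A : Type} [CommRing A] [Algebra ℝ A]
    (b : Module.Basis (Fin n) ℝ A) (ω : A →ₗ[ℝ] ℝ) {N : ℤ} (f : DiffPoly N n ℝ) (i : Set.Iic N) :
    DiffPoly N n A :=
  ∑ q : Fin n, MvPolynomial.C (dualVec b ω q) *
    MvPolynomial.map (algebraMap ℝ A) (varDeriv f (i, q))

/-- `∑_{i ≤ N} ∂^{-i-1} δf/δV_i`. -/
noncomputable def gradient {n : ℕ} {A : Type} [CommRing A] [Algebra ℝ A]
    (b : Module.Basis (Fin n) ℝ A) (ω : A →ₗ[ℝ] ℝ) {N : ℤ} (f : DiffPoly N n ℝ) :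
    PsiDO (DiffPoly N n A) :=
  fun k => ∑ᶠ i : Set.Iic N,
    comp (dx N n A) (dpow (-(i : ℤ) - 1)) (fn (valuedVarDeriv b ω f i)) k

/-- The component `X_{m-1}` that the constraint `V_{m-1} = 0` imposes: with
`X_i = δf/δV_i` and `V_m = 1` it is
`(1/m) ∑_{i ≤ m-2} ∑_{i < j ≤ m} (-i-1 choose j-i) (X_i ∘ V_j)^{(j-i-1)}`,
and it solves `res [𝓛, X] = 0`. -/
noncomputable def constrained {n : ℕ} {A : Type} [CommRing A] [Algebra ℝ A]
    (b : Module.Basis (Fin n) ℝ A) (ω : A →ₗ[ℝ] ℝ) (m : ℕ) {N : ℤ} (f : DiffPoly N n ℝ) :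
    DiffPoly N n A :=
  (1 / (m : ℝ)) • ∑ᶠ i : Set.Iic N, ∑ j ∈ Finset.Icc ((i : ℤ) + 1) m,
    Ring.choose (-(i : ℤ) - 1) (j - (i : ℤ)).toNat •
      (dx N n A)^[(j - (i : ℤ) - 1).toNat] (valuedVarDeriv b ω f i * laxPower b m N j)

/-- The operator `δf/δ𝓛 = ∑_{i ≤ m-1} ∂^{-i-1} X_i`, with `X_i = δf/δV_i` for the free fields and,
in the reduced case, with `X_{m-1}` given by the constraint. -/
noncomputable def covector {n : ℕ} {A : Type} [CommRing A] [Algebra ℝ A]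
    (b : Module.Basis (Fin n) ℝ A) (ω : A →ₗ[ℝ] ℝ) (m : ℕ) (reduced : Bool)
    (f : DiffPoly (top m reduced) n ℝ) : PsiDO (DiffPoly (top m reduced) n A) :=
  gradient b ω f +
    if reduced = true then
      comp (dx (top m reduced) n A) (dpow (-(m : ℤ))) (fn (constrained b ω m f))
    else 0

/-- `H^{(0)}(X) = (𝓛 ∘ X)_+ ∘ 𝓛 - 𝓛 ∘ (X ∘ 𝓛)_+`. -/
noncomputable def adlerZero {S : Type} [CommRing S] (d : S → S) (L X : PsiDO S) : PsiDO S :=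
  comp d (pos (comp d L X)) L - comp d L (pos (comp d X L))

/-- `H^{(∞)}(X) = [𝓛_-, X_+]_- - [𝓛_+, X_-]_+`. -/
noncomputable def adlerInfty {S : Type} [CommRing S] (d : S → S) (L X : PsiDO S) : PsiDO S :=
  neg (comm d (neg L) (pos X)) - pos (comm d (pos L) (neg X))

/-- The density `tr res (P ∘ Q)` of the pairing of a vector field with a covector. -/
noncomputable def pairing {n : ℕ} {A : Type} [CommRing A] [Algebra ℝ A] (ω : A →ₗ[ℝ] ℝ) {N : ℤ}
    (P Q : PsiDO (DiffPoly N n A)) : DiffPoly N n ℝ :=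
  applyCoeff ω (res (comp (dx N n A) P Q))

/-- The right-hand side `[B_r, 𝓛]`, `B_r = (L^r)_+`, of the `r`-th equation of the hierarchy
`∂L/∂t_r = [B_r, L]`, written for `𝓛 = L^m`. -/
noncomputable def flow {n : ℕ} {A : Type} [CommRing A] [Algebra ℝ A]
    (b : Module.Basis (Fin n) ℝ A) (m : ℕ) {N : ℤ} (L : PsiDO (DiffPoly N n A)) (r : ℕ) :
    PsiDO (DiffPoly N n A) :=
  comm (dx N n A) (pos (pow (dx N n A) L r)) (laxPower b m N)

/-- The scalar components of the vector of coefficients of `∂^i`, `i ≤ N`, of an operator. -/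
noncomputable def components {n : ℕ} {A : Type} [CommRing A] [Algebra ℝ A]
    (b : Module.Basis (Fin n) ℝ A) {N : ℤ} (P : PsiDO (DiffPoly N n A)) :
    Comp N n → DiffPoly N n ℝ :=
  fun α => applyCoeff (b.coord α.2) (P α.1)

/-- The Hamiltonian density `h_r = (m/r) tr res L^r`. -/
noncomputable def hamZero {n : ℕ} {A : Type} [CommRing A] [Algebra ℝ A] (ω : A →ₗ[ℝ] ℝ)
    (m : ℕ) {N : ℤ} (L : PsiDO (DiffPoly N n A)) (r : ℕ) : DiffPoly N n ℝ :=
  ((m : ℝ) / r) • applyCoeff ω (res (pow (dx N n A) L r))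

/-- The Hamiltonian density `g_r = -(m/(r+m)) tr res L^{m+r}`. -/
noncomputable def hamInfty {n : ℕ} {A : Type} [CommRing A] [Algebra ℝ A] (ω : A →ₗ[ℝ] ℝ)
    (m : ℕ) {N : ℤ} (L : PsiDO (DiffPoly N n A)) (r : ℕ) : DiffPoly N n ℝ :=
  (-((m : ℝ) / (r + m))) • applyCoeff ω (res (pow (dx N n A) L (m + r)))

/-- `(B₀, B∞)` is the local bi-Hamiltonian structure of the `A`-KP hierarchy with Lax operator `L`
that the trace form `ω` induces through `𝓛 = L^m`. -/
structure IsBiHamiltonian {n : ℕ} {A : Type} [CommRing A] [Algebra ℝ A]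
    (b : Module.Basis (Fin n) ℝ A) (ω : A →ₗ[ℝ] ℝ) (m : ℕ) (reduced : Bool)
    (L : PsiDO (DiffPoly (top m reduced) n A)) (B₀ B₁ : Bracket (top m reduced) n) : Prop where
  /-- Both operators map covectors to vector fields on the phase space. -/
  tangent : ∀ (f : DiffPoly (top m reduced) n ℝ) (k : ℤ), top m reduced < k →
    adlerZero (dx _ n A) (laxPower b m _) (covector b ω m reduced f) k = 0 ∧
    adlerInfty (dx _ n A) (laxPower b m _) (covector b ω m reduced f) k = 0
  /-- `{∫f, ∫g}^{(0)} = tr ∫ res (H^{(0)}(δf/δ𝓛) ∘ δg/δ𝓛) dx`. -/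
  bracket_zero : ∀ f g : DiffPoly (top m reduced) n ℝ,
    B₀ (integral f) (integral g) = integral (pairing ω
      (adlerZero (dx _ n A) (laxPower b m _) (covector b ω m reduced f))
      (covector b ω m reduced g))
  /-- `{∫f, ∫g}^{(∞)} = tr ∫ res (H^{(∞)}(δf/δ𝓛) ∘ δg/δ𝓛) dx`. -/
  bracket_infty : ∀ f g : DiffPoly (top m reduced) n ℝ,
    B₁ (integral f) (integral g) = integral (pairing ω
      (adlerInfty (dx _ n A) (laxPower b m _) (covector b ω m reduced f))
      (covector b ω m reduced g))
  /-- The two brackets are compatible Poisson brackets. -/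
  poisson : ∀ s t : ℝ, IsPoisson (s • B₀ + t • B₁)
  local_zero : IsLocal B₀
  local_infty : IsLocal B₁
  /-- The functionals `∫ tr F(V) dx`, with `F` an `A`-valued differential polynomial in the fields
  `V_i`, are closed under both brackets. -/
  closed : ∀ F ∈ valuedPoly b (top m reduced), ∀ G ∈ valuedPoly b (top m reduced),
    (∃ K ∈ valuedPoly b (top m reduced),
      B₀ (integral (applyCoeff ω F)) (integral (applyCoeff ω G)) = integral (applyCoeff ω K)) ∧
    (∃ K ∈ valuedPoly b (top m reduced),
      B₁ (integral (applyCoeff ω F)) (integral (applyCoeff ω G)) = integral (applyCoeff ω K))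
  /-- `∂𝓛/∂t_r = H^{(0)}(δh_r/δ𝓛)` is the hierarchy. -/
  flow_zero : ∀ r : ℕ, 1 ≤ r →
    adlerZero (dx _ n A) (laxPower b m _) (covector b ω m reduced (hamZero ω m L r)) = flow b m L r
  /-- `∂𝓛/∂t_r = H^{(∞)}(δg_r/δ𝓛)` is the hierarchy. -/
  flow_infty : ∀ r : ℕ, 1 ≤ r →
    adlerInfty (dx _ n A) (laxPower b m _) (covector b ω m reduced (hamInfty ω m L r)) =
      flow b m L r
  /-- The vector field with these components is the flow `∂L/∂t_r = [B_r, L]`. -/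
  lax : ∀ r : ℕ, 1 ≤ r → ∀ k : ℤ,
    evol (top m reduced) n A (components b (flow b m L r)) (L k) =
      comm (dx _ n A) (pos (pow (dx _ n A) L r)) L k
  /-- The flows of the hierarchy are Hamiltonian for both brackets. -/
  ham_zero : ∀ r : ℕ, 1 ≤ r →
    IsHamiltonianField B₀ (integral (hamZero ω m L r)) (components b (flow b m L r))
  ham_infty : ∀ r : ℕ, 1 ≤ r →
    IsHamiltonianField B₁ (integral (hamInfty ω m L r)) (components b (flow b m L r))

end AGD

end FrobeniusKP

/-! Pseudo-differential operators of finite order form an associative ring `PDO`. On it `trRes`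
(residue, then trace form, then integral) is cyclic, and it vanishes on products of two or three
differential operators and on products of two or three integral operators. These properties,
isolated in `IsSplitTrace`, already give the skew-symmetry of the quadratic Adler map and the
algebraic half of its Jacobi identity (`adler_skew`, `adler_jacobi`). The other half consists of
second variations, which cancel by `hessian_symm`; the two halves meet in `isPoisson_of_adler`.

The argument works for `𝓛 + a` with any real constant `a`. By `adler_add_constOp` the Adler map of
`𝓛 + a` is `H^{(0)} - a H^{(∞)}`, so the second structure and the compatibility come from the first
one: the shifts `0, 1, -1` suffice, because the Jacobi identity is quadratic in the pencil
parameters (`isPoisson_pencil`). Tangency holds because the top coefficient of the Adler map is a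
residue of a commutator (`ordLE_adler`), which the choice of `X_{m-1}` makes zero in the reduced
case. Locality and the closure of the functionals `∫ tr F(V) dx` follow since products and
truncations only involve finitely many derivatives and ring operations.

The Lax operator is the `m`-th root of `𝓛`, found by a contraction in the order filtration.
Cyclicity shows that `L^{r-m}` and `-L^r` represent the differentials of `h_r` and `g_r`
(`integral_evol_hamZero`). A representative is unique only up to operators of low order, but the
Adler map does not see this ambiguity (`adler_eq_zero`), and on an operator commuting with `𝓛` it
becomes a commutator with a differential part.

To separate the trace forms, write `ω = ω' (v ·)`. The change of form multiplies covectors by `v`,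
and the Adler maps commute with constants. If two brackets coincide, `v - 1` times the first flow
acts trivially on functionals. That flow restricts to translation in `x` on the fields of negative
index, which forces `v` to be real (`coord_mul_of_integral`). The forms are then proportional, and
they are equal because every `ω_k` is `1` on `Λ^(n-1)`. -/

namespace FrobeniusKP

open PsiDO

variable {R S : Type} [CommRing R] [CommRing S] [Algebra R S]

/-! ### The ring of pseudo-differential operators of finite order -/

/-- The operator `P` has order at most `a`. -/
def OrdLE (P : PsiDO S) (a : ℤ) : Prop := ∀ k, a < k → P k = 0

theorem OrdLE.mono {P : PsiDO S} {a b : ℤ} (h : OrdLE P a) (hab : a ≤ b) : OrdLE P b :=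
  fun k hk => h k (hab.trans_lt hk)

theorem OrdLE.add {P Q : PsiDO S} {a : ℤ} (hP : OrdLE P a) (hQ : OrdLE Q a) : OrdLE (P + Q) a :=
  fun k hk => by rw [Pi.add_apply, hP k hk, hQ k hk, add_zero]

theorem OrdLE.neg {P : PsiDO S} {a : ℤ} (hP : OrdLE P a) : OrdLE (-P) a :=
  fun k hk => by rw [Pi.neg_apply, hP k hk, neg_zero]

theorem OrdLE.sub {P Q : PsiDO S} {a : ℤ} (hP : OrdLE P a) (hQ : OrdLE Q a) : OrdLE (P - Q) a :=
  fun k hk => by rw [Pi.sub_apply, hP k hk, hQ k hk, sub_zero]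

theorem ordLE_zero (a : ℤ) : OrdLE (0 : PsiDO S) a := fun _ _ => rfl

theorem iterate_derivation_zero (d : Derivation R S S) (l : ℕ) : d^[l] 0 = 0 :=
  iterate_map_zero d l

theorem iterate_derivation_add (d : Derivation R S S) (l : ℕ) (x y : S) :
    d^[l] (x + y) = d^[l] x + d^[l] y := iterate_map_add d l x y

theorem iterate_derivation_zsmul (d : Derivation R S S) (l : ℕ) (n : ℤ) (x : S) :
    d^[l] (n • x) = n • d^[l] x := by
  induction l with
  | zero => rfl
  | succ l ih => rw [Function.iterate_succ_apply', ih, map_zsmul, Function.iterate_succ_apply']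

theorem iterate_derivation_mul (d : Derivation R S S) (t : ℕ) (x y : S) :
    d^[t] (x * y) = ∑ i ∈ Finset.HasAntidiagonal.antidiagonal t, t.choose i.1 • (d^[i.1] x * d^[i.2] y) := by
  induction t with
  | zero => simp
  | succ t ih =>
    rw [Function.iterate_succ_apply', ih, map_sum,
      Finset.sum_antidiagonal_choose_succ_nsmul (fun i j => d^[i] x * d^[j] y),
      ← Finset.sum_add_distrib]
    refine Finset.sum_congr rfl fun i hi => ?_
    rw [map_nsmul, d.leibniz, smul_eq_mul, smul_eq_mul, ← Function.iterate_succ_apply' d,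
      ← Function.iterate_succ_apply' d, nsmul_add,
      ← Nat.choose_symm_of_eq_add (Finset.HasAntidiagonal.mem_antidiagonal.mp hi).symm]
    congr 2
    ring

section Comp

variable (d : Derivation R S S)

/-- The first factor bounds `p.1` by `a`, the second bounds `k - p.1 + p.2` by `b`. Together they
confine both indices to a finite box, so the `finsum` of the product never takes its default value.
-/
theorem comp_support_subset {P Q : PsiDO S} {a b : ℤ} (hP : OrdLE P a) (hQ : OrdLE Q b) (k : ℤ) :
    (Function.support fun p : ℤ × ℕ =>
      Ring.choose p.1 p.2 • (P p.1 * d^[p.2] (Q (k - p.1 + p.2)))) ⊆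
    ↑(Finset.Icc (k - b) a ×ˢ Finset.range ((a + b - k).toNat + 1)) := by
  intro p hp
  have h1 : p.1 ≤ a := by
    by_contra h
    exact hp (by simp [hP p.1 (by omega)])
  have h2 : k - p.1 + p.2 ≤ b := by
    by_contra h
    exact hp (by simp [hQ _ (not_le.mp h)])
  simp only [Finset.coe_product, Set.mem_prod, Finset.mem_coe, Finset.mem_Icc, Finset.mem_range]
  omega

theorem comp_apply_eq_sum {P Q : PsiDO S} {a b : ℤ} (hP : OrdLE P a) (hQ : OrdLE Q b) (k : ℤ) :
    comp d P Q k = ∑ p ∈ Finset.Icc (k - b) a ×ˢ Finset.range ((a + b - k).toNat + 1),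
      Ring.choose p.1 p.2 • (P p.1 * d^[p.2] (Q (k - p.1 + p.2))) :=
  finsum_eq_sum_of_support_subset _ (comp_support_subset d hP hQ k)

theorem OrdLE.comp {P Q : PsiDO S} {a b : ℤ} (hP : OrdLE P a) (hQ : OrdLE Q b) :
    OrdLE (comp d P Q) (a + b) := by
  intro k hk
  rw [comp_apply_eq_sum d hP hQ, Finset.Icc_eq_empty (by omega)]
  simp

theorem comp_lead {P Q : PsiDO S} {a b : ℤ} (hP : OrdLE P a) (hQ : OrdLE Q b) :
    PsiDO.comp d P Q (a + b) = P a * Q b := by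
  rw [comp_apply_eq_sum d hP hQ]
  simp

theorem comp_sublead {P Q : PsiDO S} {a b : ℤ} (hP : OrdLE P a) (hQ : OrdLE Q b) :
    PsiDO.comp d P Q (a + b - 1) = P a * Q (b - 1) + P (a - 1) * Q b + a • (P a * d (Q b)) := by
  have h1 : Finset.Icc (a + b - 1 - b) a = {a - 1, a} := by
    ext; simp only [Finset.mem_Icc, Finset.mem_insert, Finset.mem_singleton]; omega
  have h2 : (a + b - (a + b - 1)).toNat = 1 := by omega
  rw [comp_apply_eq_sum d hP hQ, h1, h2, Finset.sum_product,
    Finset.sum_pair (by omega), Finset.sum_range_succ, Finset.sum_range_succ, Finset.sum_range_succ,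
    Finset.sum_range_succ]
  have e1 : a + b - 1 - (a - 1) = b := by ring
  have e2 : a + b - 1 - a = b - 1 := by ring
  simp only [e1, e2, Finset.range_zero, Finset.sum_empty,
    Function.iterate_zero, Function.iterate_one, id,
    Ring.choose_zero_right, Ring.choose_one_right, one_smul, Nat.cast_zero, add_zero, zero_add,
    Nat.cast_one, sub_add_cancel, hQ (b + 1) (by omega)]
  simp only [zsmul_eq_mul, map_zero, mul_zero]
  ring

theorem comp_add {P Q Q' : PsiDO S} {a b : ℤ} (hP : OrdLE P a) (hQ : OrdLE Q b) (hQ' : OrdLE Q' b) :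
    comp d P (Q + Q') = comp d P Q + comp d P Q' := by
  ext k
  simp only [Pi.add_apply]
  rw [comp_apply_eq_sum d hP hQ, comp_apply_eq_sum d hP hQ',
    comp_apply_eq_sum d hP (hQ.add hQ'), ← Finset.sum_add_distrib]
  refine Finset.sum_congr rfl fun p _ => ?_
  rw [Pi.add_apply, iterate_derivation_add, mul_add, smul_add]

theorem add_comp {P P' Q : PsiDO S} {a b : ℤ} (hP : OrdLE P a) (hP' : OrdLE P' a) (hQ : OrdLE Q b) :
    comp d (P + P') Q = comp d P Q + comp d P' Q := by
  ext k
  simp only [Pi.add_apply]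
  rw [comp_apply_eq_sum d hP hQ, comp_apply_eq_sum d hP' hQ,
    comp_apply_eq_sum d (hP.add hP') hQ, ← Finset.sum_add_distrib]
  refine Finset.sum_congr rfl fun p _ => ?_
  rw [Pi.add_apply, add_mul, smul_add]

/-- The cutoff `n` is free above a bound, so that coefficients of different products can be written
over a common range before they are compared. -/
theorem single_comp_apply (p : ℤ) (x : S) {Q : PsiDO S} {b : ℤ} (hQ : OrdLE Q b) (k : ℤ) {n : ℕ}
    (hn : p + b - k < n) :
    comp d (Pi.single p x) Q k =
      ∑ l ∈ Finset.range n, Ring.choose p l • (x * d^[l] (Q (k - p + l))) := by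
  have h : (Function.support fun q : ℤ × ℕ => Ring.choose q.1 q.2 •
      ((Pi.single p x : PsiDO S) q.1 * d^[q.2] (Q (k - q.1 + q.2)))) ⊆
      ↑({p} ×ˢ Finset.range n : Finset (ℤ × ℕ)) := by
    intro q hq
    have h1 : q.1 = p := by
      by_contra h
      exact hq (by simp [Pi.single_eq_of_ne h])
    have h2 : k - q.1 + q.2 ≤ b := by
      by_contra h
      exact hq (by simp [hQ _ (not_le.mp h)])
    simp only [Finset.coe_product, Set.mem_prod, Finset.mem_coe, Finset.mem_singleton,
      Finset.mem_range]
    omega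
  rw [PsiDO.comp, finsum_eq_sum_of_support_subset _ h, Finset.sum_product]
  simp

/-- When the second factor is concentrated in order `q`, the number `l` of derivatives determines
the index of the first factor, and the double sum collapses. -/
theorem comp_single_apply {P : PsiDO S} {a : ℤ} (hP : OrdLE P a) (q : ℤ) (y : S) (k : ℤ) {n : ℕ}
    (hn : a + q - k < n) :
    comp d P (Pi.single q y) k =
      ∑ l ∈ Finset.range n, Ring.choose (k - q + l) l • (P (k - q + l) * d^[l] y) := by
  let e : ℕ ↪ ℤ × ℕ := ⟨fun l => (k - q + l, l), fun _ _ h => congrArg Prod.snd h⟩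
  have he : ∀ l, e l = (k - q + l, l) := fun _ => rfl
  have h : (Function.support fun p : ℤ × ℕ => Ring.choose p.1 p.2 •
      (P p.1 * d^[p.2] ((Pi.single q y : PsiDO S) (k - p.1 + p.2)))) ⊆
      ↑((Finset.range n).map
        e) := by
    intro p hp
    have h1 : p.1 ≤ a := by
      by_contra h
      exact hp (by simp [hP p.1 (by omega)])
    have h2 : k - p.1 + p.2 = q := by
      by_contra h
      exact hp (by simp [Pi.single_eq_of_ne h])
    simp only [Finset.coe_map, Set.mem_image, Finset.mem_coe, Finset.mem_range, he]
    exact ⟨p.2, by omega, Prod.ext (by simp only; omega) rfl⟩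
  rw [PsiDO.comp, finsum_eq_sum_of_support_subset _ h, Finset.sum_map]
  refine Finset.sum_congr rfl fun l _ => ?_
  have : k - (k - q + (l : ℤ)) + l = q := by ring
  rw [he, this, Pi.single_eq_same]

end Comp

/-- The ring of pseudo-differential operators of finite order over the differential ring
`(S, d)`. -/
structure PDO (d : Derivation R S S) where
  /-- The coefficients. -/
  val : PsiDO S
  /-- The order is finite. -/
  exists_ordLE : ∃ a, OrdLE val a

namespace PDO

variable {d : Derivation R S S}

theorem val_injective : Function.Injective (val : PDO d → PsiDO S) := by
  rintro ⟨P, _⟩ ⟨Q, _⟩ rfl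
  rfl

@[ext] theorem ext {P Q : PDO d} (h : ∀ k, P.val k = Q.val k) : P = Q := val_injective (funext h)

instance : Zero (PDO d) := ⟨⟨0, 0, ordLE_zero 0⟩⟩

instance : Add (PDO d) := ⟨fun P Q => ⟨P.val + Q.val, by
  obtain ⟨a, hP⟩ := P.2
  obtain ⟨b, hQ⟩ := Q.2
  exact ⟨max a b, (hP.mono (le_max_left _ _)).add (hQ.mono (le_max_right _ _))⟩⟩⟩

instance : Sub (PDO d) := ⟨fun P Q => ⟨P.val - Q.val, by
  obtain ⟨a, hP⟩ := P.2
  obtain ⟨b, hQ⟩ := Q.2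
  exact ⟨max a b, (hP.mono (le_max_left _ _)).sub (hQ.mono (le_max_right _ _))⟩⟩⟩

instance : Neg (PDO d) := ⟨fun P => ⟨-P.val, P.2.imp fun _ h => h.neg⟩⟩

@[simp] theorem zero_val : (0 : PDO d).val = 0 := rfl
@[simp] theorem add_val (P Q : PDO d) : (P + Q).val = P.val + Q.val := rfl
@[simp] theorem neg_val (P : PDO d) : (-P).val = -P.val := rfl
@[simp] theorem sub_val (P Q : PDO d) : (P - Q).val = P.val - Q.val := rfl

instance : AddCommGroup (PDO d) where
  add_assoc _ _ _ := val_injective (add_assoc _ _ _)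
  zero_add _ := val_injective (zero_add _)
  add_zero _ := val_injective (add_zero _)
  add_comm _ _ := val_injective (add_comm _ _)
  sub_eq_add_neg _ _ := val_injective (sub_eq_add_neg _ _)
  neg_add_cancel _ := val_injective (neg_add_cancel _)
  nsmul := nsmulRec
  zsmul := zsmulRec

/-- The coefficient of `∂^k`. -/
def coeff (k : ℤ) : PDO d →+ S where
  toFun P := P.val k
  map_zero' := rfl
  map_add' _ _ := rfl

theorem sum_val {ι : Type*} (s : Finset ι) (f : ι → PDO d) (k : ℤ) :
    (∑ i ∈ s, f i).val k = ∑ i ∈ s, (f i).val k := map_sum (coeff k) f s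

noncomputable instance : Mul (PDO d) where
  mul P Q := ⟨comp d P.val Q.val, by
    obtain ⟨a, ha⟩ := P.2
    obtain ⟨b, hb⟩ := Q.2
    exact ⟨a + b, ha.comp d hb⟩⟩

theorem mul_val (P Q : PDO d) : (P * Q).val = comp d P.val Q.val := rfl

theorem ordLE_mul {P Q : PDO d} {a b : ℤ} (hP : OrdLE P.val a) (hQ : OrdLE Q.val b) :
    OrdLE (P * Q).val (a + b) := hP.comp d hQ

theorem mul_add' (P Q Q' : PDO d) : P * (Q + Q') = P * Q + P * Q' := by
  obtain ⟨a, ha⟩ := P.2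
  obtain ⟨b, hb⟩ := Q.2
  obtain ⟨c, hc⟩ := Q'.2
  exact val_injective
    (comp_add d ha (hb.mono (le_max_left b c)) (hc.mono (le_max_right b c)))

theorem add_mul' (P P' Q : PDO d) : (P + P') * Q = P * Q + P' * Q := by
  obtain ⟨a, ha⟩ := P.2
  obtain ⟨b, hb⟩ := Q.2
  obtain ⟨c, hc⟩ := P'.2
  exact val_injective
    (add_comp d (ha.mono (le_max_left a c)) (hc.mono (le_max_right a c)) hb)

/-- Left multiplication. -/
noncomputable def mulL (P : PDO d) : PDO d →+ PDO d := AddMonoidHom.mk' (P * ·) (mul_add' P)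

/-- Right multiplication. -/
noncomputable def mulR (Q : PDO d) : PDO d →+ PDO d :=
  AddMonoidHom.mk' (· * Q) fun P P' => add_mul' P P' Q

theorem ordLE_single (p : ℤ) (x : S) : OrdLE (Pi.single p x : PsiDO S) p :=
  fun _ hk => Pi.single_eq_of_ne (ne_of_gt hk) _

variable (d) in
/-- The operator `x ∂^p`. -/
def monom (p : ℤ) : S →+ PDO d where
  toFun x := ⟨Pi.single p x, p, ordLE_single p x⟩
  map_zero' := val_injective (Pi.single_zero (M := fun _ : ℤ => S) p)
  map_add' x y := val_injective (Pi.single_add (f := fun _ : ℤ => S) p x y)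

theorem monom_val (p : ℤ) (x : S) : (monom d p x).val = Pi.single p x := rfl

theorem ordLE_monom (p : ℤ) (x : S) : OrdLE (monom d p x).val p := ordLE_single p x

/-- The truncation of an operator differs from it by an operator of low order. -/
theorem ordLE_sub_sum_monom (P : PDO d) {a : ℤ} (ha : OrdLE P.val a) (K : ℤ) :
    OrdLE (P - ∑ p ∈ Finset.Ioc K a, monom d p (P.val p)).val K := by
  intro k hk
  rw [sub_val, Pi.sub_apply, sum_val]
  simp only [monom_val]
  by_cases hka : k ≤ a
  · rw [Finset.sum_eq_single k]
    · simp
    · intro p _ hp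
      exact Pi.single_eq_of_ne hp.symm _
    · intro h
      exact absurd (Finset.mem_Ioc.mpr ⟨hk, hka⟩) h
  · rw [ha k (by omega), Finset.sum_eq_zero, sub_zero]
    intro p hp
    exact Pi.single_eq_of_ne (by rw [Finset.mem_Ioc] at hp; omega) _

/-- An additive map which kills the operators of low order is determined by its values on
monomials. -/
theorem hom_eq_zero {G : Type*} [AddCommGroup G] (φ : PDO d →+ G) {K : ℤ}
    (hK : ∀ P : PDO d, OrdLE P.val K → φ P = 0) (hm : ∀ p x, φ (monom d p x) = 0) (P : PDO d) :
    φ P = 0 := by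
  obtain ⟨a, ha⟩ := P.2
  have h := hK _ (ordLE_sub_sum_monom P ha K)
  rw [map_sub, map_sum, Finset.sum_eq_zero fun p _ => hm p _, sub_zero] at h
  exact h

theorem monom_mul_monom_of_lt {p q k : ℤ} (x y : S) (h : p + q < k) :
    (monom d p x * monom d q y).val k = 0 :=
  (ordLE_monom p x).comp d (ordLE_monom q y) k h

theorem monom_mul_monom (p q : ℤ) (x y : S) (l : ℕ) :
    (monom d p x * monom d q y).val (p + q - l) = Ring.choose p l • (x * d^[l] y) := by
  rw [mul_val, monom_val, single_comp_apply d p x (ordLE_monom q y) _ (n := l + 1) (by omega),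
    Finset.sum_eq_single l]
  · have : p + q - l - p + l = q := by ring
    simp [monom_val, this]
  · intro i _ hi
    have : (monom d q y).val (p + q - l - p + i) = 0 :=
      by
      rw [monom_val]
      exact Pi.single_eq_of_ne (by omega) _
    rw [this, iterate_derivation_zero, mul_zero, smul_zero]
  · intro h
    exact absurd (Finset.mem_range.mpr (Nat.lt_succ_self l)) h

theorem sum_antidiagonal_assoc {M : Type*} [AddCommMonoid M] (n : ℕ) (f : ℕ → ℕ → ℕ → M) :
    ∑ i ∈ Finset.HasAntidiagonal.antidiagonal n,
        ∑ j ∈ Finset.HasAntidiagonal.antidiagonal i.1, f j.1 j.2 i.2 =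
      ∑ i ∈ Finset.HasAntidiagonal.antidiagonal n,
        ∑ j ∈ Finset.HasAntidiagonal.antidiagonal i.2, f i.1 j.1 j.2 := by
  rw [Finset.sum_sigma', Finset.sum_sigma']
  refine Finset.sum_nbij' (fun x => ⟨(x.2.1, x.2.2 + x.1.2), (x.2.2, x.1.2)⟩)
    (fun x => ⟨(x.1.1 + x.2.1, x.2.2), (x.1.1, x.2.1)⟩) ?_ ?_ ?_ ?_ ?_
  · rintro ⟨⟨a, b⟩, ⟨e, f⟩⟩ h
    simp only [Finset.mem_sigma, Finset.HasAntidiagonal.mem_antidiagonal] at h ⊢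
    refine ⟨?_, ?_⟩ <;> first | rfl | trivial | omega
  · rintro ⟨⟨a, b⟩, ⟨e, f⟩⟩ h
    simp only [Finset.mem_sigma, Finset.HasAntidiagonal.mem_antidiagonal] at h ⊢
    refine ⟨?_, ?_⟩ <;> first | rfl | trivial | omega
  · rintro ⟨⟨a, b⟩, ⟨e, f⟩⟩ h
    simp only [Finset.mem_sigma, Finset.HasAntidiagonal.mem_antidiagonal] at h ⊢
    rw [h.2]
  · rintro ⟨⟨a, b⟩, ⟨e, f⟩⟩ h
    simp only [Finset.mem_sigma, Finset.HasAntidiagonal.mem_antidiagonal] at h ⊢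
    rw [h.2]
  · rintro ⟨⟨a, b⟩, ⟨e, f⟩⟩ _
    rfl

theorem choose_mul_choose_add (p : ℤ) (s v : ℕ) :
    ((s + v).choose s : ℤ) * Ring.choose p (s + v) = Ring.choose p s * Ring.choose (p - s) v := by
  have h := Ring.choose_smul_choose p (Nat.le_add_right s v)
  rw [Nat.add_sub_cancel_left] at h
  rw [← h, nsmul_eq_mul]

/-- Trinomial revision followed by the Chu–Vandermonde identity; this is the binomial identity
behind associativity. -/
theorem choose_assoc (p q : ℤ) (s l : ℕ) :
    ∑ i ∈ Finset.HasAntidiagonal.antidiagonal l,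
      ((s + i.1).choose s : ℤ) * (Ring.choose p (s + i.1) * Ring.choose q i.2) =
    Ring.choose p s * Ring.choose (p + q - s) l := by
  have : p + q - s = (p - s) + q := by ring
  rw [this, Ring.add_choose_eq l (Commute.all _ _), Finset.mul_sum]
  refine Finset.sum_congr rfl fun i _ => ?_
  rw [← mul_assoc, choose_mul_choose_add, mul_assoc]

/-- Both sides distribute `M` derivatives over `y` and `z`. On the right the Leibniz rule splits
those falling on the product of `y` with a derivative of `z`; regrouping by the number that falls on
`y` leaves the sum evaluated in `choose_assoc`. -/
theorem monom_assoc (p q r : ℤ) (x y z : S) :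
    monom d p x * monom d q y * monom d r z = monom d p x * (monom d q y * monom d r z) := by
  ext k
  by_cases hk : p + q + r < k
  · refine (ordLE_mul (ordLE_mul (ordLE_monom p x) (ordLE_monom q y))
      (ordLE_monom r z) k hk).trans
      (ordLE_mul (ordLE_monom p x) (ordLE_mul (ordLE_monom q y) (ordLE_monom r z)) k ?_).symm
    omega
  obtain ⟨M, hM⟩ := Int.le.dest (not_lt.mp hk)
  have hM' : k = p + q + r - M := by omega
  subst hM'
  have hl : (monom d p x * monom d q y * monom d r z).val (p + q + r - M) =
      ∑ i ∈ Finset.HasAntidiagonal.antidiagonal M, Ring.choose (p + q - i.1) i.2 •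
        ((Ring.choose p i.1 • (x * d^[i.1] y)) * d^[i.2] z) := by
    rw [mul_val, monom_val r, comp_single_apply d (ordLE_mul (ordLE_monom p x) (ordLE_monom q y)) r z
      _ (n := M + 1) (by omega), ← Finset.Nat.sum_antidiagonal_swap,
      Finset.Nat.sum_antidiagonal_eq_sum_range_succ_mk]
    refine Finset.sum_congr rfl fun l hl => ?_
    have hl' : l ≤ M := Nat.lt_succ_iff.mp (Finset.mem_range.mp hl)
    have e : p + q + r - M - r + l = p + q - (M - l : ℕ) := by
      rw [Nat.cast_sub hl']; ring
    rw [e, monom_mul_monom]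
    rfl
  have hr : (monom d p x * (monom d q y * monom d r z)).val (p + q + r - M) =
      ∑ i ∈ Finset.HasAntidiagonal.antidiagonal M, Ring.choose p i.1 •
        (x * d^[i.1] (Ring.choose q i.2 • (y * d^[i.2] z))) := by
    rw [mul_val, monom_val p, single_comp_apply d p x (ordLE_mul (ordLE_monom q y) (ordLE_monom r z))
      _ (n := M + 1) (by omega),
      Finset.Nat.sum_antidiagonal_eq_sum_range_succ_mk]
    refine Finset.sum_congr rfl fun l hl => ?_
    have hl' : l ≤ M := Nat.lt_succ_iff.mp (Finset.mem_range.mp hl)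
    have e : p + q + r - M - p + l = q + r - (M - l : ℕ) := by
      rw [Nat.cast_sub hl']; ring
    rw [e, monom_mul_monom]
  rw [hl, hr]
  have hr2 : ∀ i : ℕ × ℕ, Ring.choose p i.1 •
        (x * d^[i.1] (Ring.choose q i.2 • (y * d^[i.2] z))) =
      ∑ j ∈ Finset.HasAntidiagonal.antidiagonal i.1, (fun s v u : ℕ => (((s + v).choose s : ℤ) *
        (Ring.choose p (s + v) * Ring.choose q u)) • (x * (d^[s] y * d^[v + u] z))) j.1 j.2 i.2 := by
    intro i
    rw [iterate_derivation_zsmul, iterate_derivation_mul, Finset.smul_sum, Finset.mul_sum,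
      Finset.smul_sum]
    refine Finset.sum_congr rfl fun j hj => ?_
    rw [← Finset.HasAntidiagonal.mem_antidiagonal.mp hj]
    simp only [← Function.iterate_add_apply d, zsmul_eq_mul, nsmul_eq_mul, Int.cast_mul, Int.cast_natCast]
    ring
  rw [Finset.sum_congr rfl fun i _ => hr2 i, sum_antidiagonal_assoc M fun s v u : ℕ =>
    (((s + v).choose s : ℤ) * (Ring.choose p (s + v) * Ring.choose q u)) •
      (x * (d^[s] y * d^[v + u] z))]
  refine Finset.sum_congr rfl fun i _ => ?_
  have : ∀ j ∈ Finset.HasAntidiagonal.antidiagonal i.2, (((i.1 + j.1).choose i.1 : ℤ) *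
        (Ring.choose p (i.1 + j.1) * Ring.choose q j.2)) • (x * (d^[i.1] y * d^[j.1 + j.2] z)) =
      (((i.1 + j.1).choose i.1 : ℤ) * (Ring.choose p (i.1 + j.1) * Ring.choose q j.2)) •
        (x * (d^[i.1] y * d^[i.2] z)) := by
    intro j hj
    rw [Finset.HasAntidiagonal.mem_antidiagonal.mp hj]
  rw [Finset.sum_congr rfl this, ← Finset.sum_smul, choose_assoc]
  simp only [zsmul_eq_mul, Int.cast_mul]
  ring

/-- A fixed coefficient of either side is additive in each factor and ignores terms of sufficiently
low order, so `hom_eq_zero` reduces the factors to monomials one after another. -/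
theorem mul_assoc' (P Q T : PDO d) : P * Q * T = P * (Q * T) := by
  rw [← sub_eq_zero]
  ext k
  obtain ⟨a, ha⟩ := P.2
  obtain ⟨b, hb⟩ := Q.2
  obtain ⟨c, hc⟩ := T.2
  refine hom_eq_zero ((coeff k).comp ((mulR T).comp (mulR Q) - mulR (Q * T)))
    (K := k - b - c - 1) (fun P' hP' => ?_) (fun p x => ?_) P
  · exact ((ordLE_mul (ordLE_mul hP' hb) hc).sub
      ((ordLE_mul hP' (ordLE_mul hb hc)).mono (by omega))) k (by omega)
  refine hom_eq_zero ((coeff k).comp ((mulR T).comp (mulL (monom d p x)) -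
    (mulL (monom d p x)).comp (mulR T))) (K := k - p - c - 1) (fun Q' hQ' => ?_) (fun q y => ?_) Q
  · exact ((ordLE_mul (ordLE_mul (ordLE_monom p x) hQ') hc).sub
      ((ordLE_mul (ordLE_monom p x) (ordLE_mul hQ' hc)).mono (by omega))) k (by omega)
  refine hom_eq_zero ((coeff k).comp (mulL (monom d p x * monom d q y) -
    (mulL (monom d p x)).comp (mulL (monom d q y)))) (K := k - p - q - 1)
    (fun T' hT' => ?_) (fun r z => ?_) T
  · exact ((ordLE_mul (ordLE_mul (ordLE_monom p x) (ordLE_monom q y)) hT').sub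
      ((ordLE_mul (ordLE_monom p x) (ordLE_mul (ordLE_monom q y) hT')).mono (by omega))) k (by omega)
  have := monom_assoc (d := d) p q r x y z
  change (monom d p x * monom d q y * monom d r z - monom d p x * (monom d q y * monom d r z)).val k
    = 0
  rw [this, sub_self]
  rfl

instance : One (PDO d) := ⟨monom d 0 1⟩

theorem one_def : (1 : PDO d) = monom d 0 1 := rfl

theorem monom_zero_mul_val (x : S) (Q : PDO d) (k : ℤ) : (monom d 0 x * Q).val k = x * Q.val k := by
  obtain ⟨b, hb⟩ := Q.2
  rw [mul_val, monom_val, single_comp_apply d 0 x hb k (n := (b - k).toNat + 1) (by omega),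
    Finset.sum_range_succ', Finset.sum_eq_zero]
  · simp
  · intro l _
    rw [Ring.choose_zero_succ, zero_smul]

theorem one_mul' (P : PDO d) : 1 * P = P := by
  ext k
  rw [one_def, monom_zero_mul_val, one_mul]

theorem mul_monom_of_const (P : PDO d) (q : ℤ) {y : S} (hy : d y = 0) (k : ℤ) :
    (P * monom d q y).val k = P.val (k - q) * y := by
  obtain ⟨a, ha⟩ := P.2
  rw [mul_val, monom_val, comp_single_apply d ha q y k (n := (a + q - k).toNat + 1) (by omega),
    Finset.sum_range_succ', Finset.sum_eq_zero]
  · simp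
  · intro l _
    rw [Function.iterate_succ_apply, hy, iterate_derivation_zero, mul_zero, smul_zero]

theorem mul_one' (P : PDO d) : P * 1 = P := by
  ext k
  rw [one_def, mul_monom_of_const P 0 d.map_one_eq_zero, mul_one, sub_zero]

noncomputable instance : Ring (PDO d) :=
  { (inferInstance : AddCommGroup (PDO d)), (inferInstance : Mul (PDO d)),
    (inferInstance : One (PDO d)) with
    left_distrib := mul_add'
    right_distrib := add_mul'
    zero_mul := fun P => (mulR P).map_zero
    mul_zero := fun P => (mulL P).map_zero
    mul_assoc := mul_assoc'
    one_mul := one_mul'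
    mul_one := mul_one' }

end PDO

end FrobeniusKP

namespace FrobeniusKP

open PsiDO

variable {R S : Type} [CommRing R] [CommRing S] [Algebra R S]

/-! ### Powers, commutators and the splitting into differential and integral parts -/

namespace PDO

variable {d : Derivation R S S}

theorem monom_val_apply (p k : ℤ) (x : S) : (monom d p x).val k = if k = p then x else 0 := by
  rw [monom_val, Pi.single_apply]

theorem dpow_eq (s : ℤ) : dpow s = (monom d s 1).val := by
  ext k
  rw [monom_val_apply]
  rfl

theorem fn_eq (x : S) : fn x = (monom d 0 x).val := by
  ext k
  rw [monom_val_apply]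
  rfl

theorem pow_val (P : PDO d) (r : ℕ) : (P ^ r).val = PsiDO.pow d P.val r := by
  induction r with
  | zero => rw [pow_zero, one_def, PsiDO.pow, dpow_eq (d := d)]
  | succ r ih => rw [pow_succ', mul_val, ih]; rfl

theorem comm_val (P Q : PDO d) : (P * Q - Q * P).val = comm d P.val Q.val := rfl

variable (d) in
/-- The differential part of an operator, as an additive map. -/
def posPart : PDO d →+ PDO d where
  toFun P := ⟨pos P.val, by
    obtain ⟨a, ha⟩ := P.exists_ordLE
    refine ⟨a, fun k hk => ?_⟩
    simp [pos, ha k hk]⟩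
  map_zero' := by ext k; simp [pos]
  map_add' P Q := by
    ext k
    by_cases hk : 0 ≤ k <;> simp [pos, hk]

theorem posPart_val (P : PDO d) : (posPart d P).val = pos P.val := rfl

theorem posPart_val_of_nonneg (P : PDO d) {k : ℤ} (hk : 0 ≤ k) :
    (posPart d P).val k = P.val k := by
  simp [posPart_val, pos, hk]

theorem posPart_val_of_neg (P : PDO d) {k : ℤ} (hk : k < 0) : (posPart d P).val k = 0 := by
  simp [posPart_val, pos, hk]

theorem ordLE_negPart (P : PDO d) : OrdLE (P - posPart d P).val (-1) := by
  intro k hk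
  rw [sub_val, Pi.sub_apply, posPart_val_of_nonneg P (by omega), sub_self]

theorem ordLE_posPart {P : PDO d} {a : ℤ} (h : OrdLE P.val a) : OrdLE (posPart d P).val a := by
  intro k hk
  simp [posPart_val, pos, h k hk]

theorem posPart_eq_zero {P : PDO d} {a : ℤ} (h : OrdLE P.val a) (ha : a < 0) :
    posPart d P = 0 := by
  ext k
  by_cases hk : 0 ≤ k
  · rw [posPart_val_of_nonneg P hk, h k (by omega)]; rfl
  · rw [posPart_val_of_neg P (by omega)]; rfl

/-- The operator is a differential operator. -/
def IsDiff (P : PDO d) : Prop := ∀ k < 0, P.val k = 0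

theorem isDiff_posPart (P : PDO d) : IsDiff (posPart d P) := fun _ hk => posPart_val_of_neg P hk

theorem choose_eq_zero_of_lt {p : ℤ} {l : ℕ} (hp : 0 ≤ p) (h : p < l) : Ring.choose p l = 0 := by
  obtain ⟨n, rfl⟩ := Int.eq_ofNat_of_zero_le hp
  rw [Ring.choose_natCast, Nat.choose_eq_zero_of_lt (by omega), Nat.cast_zero]

theorem IsDiff.mul {P Q : PDO d} (hP : IsDiff P) (hQ : IsDiff Q) : IsDiff (P * Q) := by
  intro k hk
  rw [mul_val, comp]
  refine (finsum_congr fun p => ?_).trans finsum_zero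
  by_cases h1 : p.1 < 0
  · rw [hP _ h1, zero_mul, smul_zero]
  by_cases h2 : k - p.1 + p.2 < 0
  · rw [hQ _ h2, iterate_derivation_zero, mul_zero, smul_zero]
  -- Here `0 ≤ p.1` and `k < 0` force `p.1 < p.2`, so the binomial coefficient vanishes.
  rw [choose_eq_zero_of_lt (by omega) (by omega), zero_smul]

theorem eq_posPart_of_isDiff {P : PDO d} (h : IsDiff P) : posPart d P = P := by
  ext k
  by_cases hk : 0 ≤ k
  · rw [posPart_val_of_nonneg P hk]
  · rw [posPart_val_of_neg P (by omega), h k (by omega)]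

/-! #### The trace property of the residue -/

theorem mul_iterate_sub_mem_range (l : ℕ) (x y : S) :
    ∃ s, x * d^[l] y - (-1) ^ l * (d^[l] x * y) = d s := by
  induction l generalizing x with
  | zero => exact ⟨0, by simp⟩
  | succ l ih =>
    obtain ⟨s, hs⟩ := ih (d x)
    refine ⟨x * d^[l] y - s, ?_⟩
    rw [map_sub, ← hs, d.leibniz, smul_eq_mul, smul_eq_mul, Function.iterate_succ_apply',
      Function.iterate_succ_apply]
    ring

theorem choose_neg_sub (p : ℤ) (l : ℕ) : Ring.choose (l - 1 - p) l = (-1) ^ l * Ring.choose p l := by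
  have h := Ring.choose_neg (p + 1 - l : ℤ) l
  have e1 : -(p + 1 - (l : ℤ)) = l - 1 - p := by ring
  have e2 : p + 1 - (l : ℤ) + l - 1 = p := by ring
  rw [e1, e2] at h
  rw [h, Units.smul_def, smul_eq_mul]
  congr 1

/-- In either order the residue comes from the same number `l = p + q + 1` of derivatives. The two
binomial coefficients differ by `(-1)^l`, which is exactly the sign of `l` integrations by parts. -/
theorem monom_mul_monom_comm_res (p q : ℤ) (x y : S) :
    ∃ s, (monom d p x * monom d q y - monom d q y * monom d p x).val (-1) = d s := by
  by_cases h : p + q < -1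
  · refine ⟨0, ?_⟩
    rw [sub_val, Pi.sub_apply, monom_mul_monom_of_lt x y (by omega),
      monom_mul_monom_of_lt y x (by omega), map_zero, sub_zero]
  · obtain ⟨l, hl⟩ : ∃ l : ℕ, q = l - 1 - p := ⟨(p + q + 1).toNat, by omega⟩
    obtain ⟨s, hs⟩ := mul_iterate_sub_mem_range (d := d) l x y
    refine ⟨Ring.choose p l • s, ?_⟩
    have e1 : (-1 : ℤ) = p + q - l := by omega
    have e2 : (-1 : ℤ) = q + p - l := by omega
    have h1 := monom_mul_monom (d := d) p q x y l
    have h2 := monom_mul_monom (d := d) q p y x l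
    rw [← e1] at h1
    rw [← e2, hl, choose_neg_sub, ← hl] at h2
    rw [sub_val, Pi.sub_apply, h1, h2, map_zsmul, ← hs]
    simp only [zsmul_eq_mul, Int.cast_mul, Int.cast_pow, Int.cast_neg, Int.cast_one]
    ring

/-- Terms of low order cannot reach the residue, so both factors reduce to monomials, where the
residue of the commutator is a derivative. -/
theorem res_mul_comm {G : Type*} [AddCommGroup G] (T : S →+ G) (hT : ∀ s, T (d s) = 0)
    (P Q : PDO d) : T ((P * Q).val (-1)) = T ((Q * P).val (-1)) := by
  obtain ⟨a, ha⟩ := P.exists_ordLE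
  obtain ⟨b, hb⟩ := Q.exists_ordLE
  have h : (T.comp ((coeff (-1)).comp (mulR Q - mulL Q))) P = 0 := by
    refine hom_eq_zero _ (K := -2 - b) (fun P' hP' => ?_) (fun p x => ?_) P
    · have h1 : ((P' * Q) - (Q * P')).val (-1) = 0 :=
        ((ordLE_mul hP' hb).sub ((ordLE_mul hb hP').mono (by omega))) (-1) (by omega)
      exact (congrArg T h1).trans T.map_zero
    have h2 : (T.comp ((coeff (-1)).comp (mulL (monom d p x) - mulR (monom d p x)))) Q = 0 := by
      refine hom_eq_zero _ (K := -2 - p) (fun Q' hQ' => ?_) (fun q y => ?_) Q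
      · have h1 : (monom d p x * Q' - Q' * monom d p x).val (-1) = 0 :=
          ((ordLE_mul (ordLE_monom p x) hQ').sub
            ((ordLE_mul hQ' (ordLE_monom p x)).mono (by omega))) (-1) (by omega)
        exact (congrArg T h1).trans T.map_zero
      obtain ⟨s, hs⟩ := monom_mul_monom_comm_res (d := d) p q x y
      exact (congrArg T hs).trans (hT s)
    exact h2
  have h3 : T ((P * Q - Q * P).val (-1)) = 0 := h
  rwa [sub_val, Pi.sub_apply, map_sub, sub_eq_zero] at h3

/-! #### Leading coefficients -/

theorem mul_lead {P Q : PDO d} {a b : ℤ} (hP : OrdLE P.val a) (hQ : OrdLE Q.val b) :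
    (P * Q).val (a + b) = P.val a * Q.val b := comp_lead d hP hQ

/-- Coefficients commute, so the terms without derivatives cancel and only the single-derivative
terms of `comp_sublead` survive at this order. -/
theorem comm_sublead {P Q : PDO d} {a b : ℤ} (hP : OrdLE P.val a) (hQ : OrdLE Q.val b) :
    (P * Q - Q * P).val (a + b - 1) =
      a • (P.val a * d (Q.val b)) - b • (Q.val b * d (P.val a)) := by
  have h2 := comp_sublead d hQ hP
  rw [add_comm b a, ← mul_val] at h2
  rw [sub_val, Pi.sub_apply, h2, mul_val, comp_sublead d hP hQ]
  ring

theorem ordLE_pred {P : PsiDO S} {a : ℤ} (h : OrdLE P a) (h0 : P a = 0) : OrdLE P (a - 1) := by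
  intro k hk
  rcases eq_or_ne k a with rfl | hne
  · exact h0
  · exact h k (by omega)

theorem eq_zero_of_forall_ordLE {P : PDO d} (a : ℤ) (h : ∀ n : ℕ, OrdLE P.val (a - n)) : P = 0 := by
  ext k
  exact h (a - k + 1).toNat k (by omega)

theorem eq_zero_of_ordLE_pred {P : PDO d} (h : ∀ k, OrdLE P.val k → P.val k = 0) : P = 0 := by
  obtain ⟨a, ha⟩ := P.exists_ordLE
  refine eq_zero_of_forall_ordLE a fun n => ?_
  induction n with
  | zero => simpa using ha
  | succ n ih =>
    have := ordLE_pred ih (h _ ih)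
    push_cast
    rwa [← sub_sub]

/-- The operator is monic of order `a`. -/
structure IsMonic (P : PDO d) (a : ℤ) : Prop where
  ordLE : OrdLE P.val a
  lead : P.val a = 1

theorem IsMonic.mul {P Q : PDO d} {a b : ℤ} (hP : IsMonic P a) (hQ : IsMonic Q b) :
    IsMonic (P * Q) (a + b) :=
  ⟨ordLE_mul hP.1 hQ.1, by rw [mul_lead hP.1 hQ.1, hP.2, hQ.2, one_mul]⟩

theorem isMonic_monom (a : ℤ) : IsMonic (monom d a 1) a :=
  ⟨ordLE_monom a 1, by rw [monom_val_apply, if_pos rfl]⟩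

theorem IsMonic.pow {P : PDO d} {a : ℤ} (hP : IsMonic P a) (r : ℕ) : IsMonic (P ^ r) (r * a) := by
  induction r with
  | zero =>
    rw [pow_zero, Nat.cast_zero, zero_mul]
    exact isMonic_monom 0
  | succ r ih =>
    have h := ih.mul hP
    rw [pow_succ]
    convert h using 1
    push_cast
    ring

/-- The difference of powers telescopes, and each of the `r` summands has monic cofactors, so it
contributes the leading coefficient of `P - Q` once. This linearisation drives the extraction of
roots. -/
theorem pow_sub_pow {P Q : PDO d} (hP : IsMonic P 1) (hQ : IsMonic Q 1) {k : ℤ}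
    (h : OrdLE (P - Q).val k) (r : ℕ) :
    OrdLE (P ^ r - Q ^ r).val (k + r - 1) ∧
      (P ^ r - Q ^ r).val (k + r - 1) = r • (P - Q).val k := by
  induction r with
  | zero => simp [ordLE_zero]
  | succ r ih =>
    have e : P ^ (r + 1) - Q ^ (r + 1) = (P - Q) * P ^ r + Q * (P ^ r - Q ^ r) := by
      rw [pow_succ', pow_succ']
      noncomm_ring
    have e1 : k + ((r + 1 : ℕ) : ℤ) - 1 = k + r * 1 := by push_cast; ring
    have e2 : 1 + (k + r - 1) = k + (r : ℤ) * 1 := by ring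
    have h1 := ordLE_mul h (hP.pow r).1
    have h2 := ordLE_mul hQ.1 ih.1
    have h3 := mul_lead h (hP.pow r).1
    have h4 := mul_lead hQ.1 ih.1
    rw [e2] at h2 h4
    rw [e, e1]
    refine ⟨h1.add h2, ?_⟩
    rw [add_val, Pi.add_apply, h3, h4, (hP.pow r).2, hQ.2, ih.2, mul_one, one_mul, succ_nsmul']

/-! #### Contractions -/

/-- Completeness of the order filtration: each application of `F` lowers the order of a difference
by one, so every coefficient of the iterates of `0` is eventually constant, and the limit is fixed.
-/
theorem exists_fixedPoint (F : PDO d → PDO d) (a : ℤ)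
    (hF : ∀ P, OrdLE P.val a → OrdLE (F P).val a)
    (hc : ∀ P Q k, OrdLE P.val a → OrdLE Q.val a → OrdLE (P - Q).val k →
      OrdLE (F P - F Q).val (k - 1)) : ∃ P, OrdLE P.val a ∧ F P = P := by
  have hX : ∀ n, OrdLE (F^[n] 0).val a := by
    intro n
    induction n with
    | zero => exact ordLE_zero a
    | succ n ih => rw [Function.iterate_succ_apply']; exact hF _ ih
  have hstep : ∀ n : ℕ, OrdLE (F^[n + 1] 0 - F^[n] 0).val (a - n) := by
    intro n
    induction n with
    | zero => simpa using (hX 1).sub (hX 0)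
    | succ n ih =>
      have h := hc _ _ _ (hX (n + 1)) (hX n) ih
      rw [← Function.iterate_succ_apply' F, ← Function.iterate_succ_apply' F] at h
      push_cast
      rwa [← sub_sub]
  have hstab : ∀ (k : ℤ) (n j : ℕ), a - n < k → (F^[n + j] 0).val k = (F^[n] 0).val k := by
    intro k n j hk
    induction j with
    | zero => rfl
    | succ j ih =>
      have := hstep (n + j) k (by push_cast; omega)
      rw [sub_val, Pi.sub_apply, sub_eq_zero] at this
      rw [← ih, ← this]
      rfl
  -- The coefficient of `∂^k` no longer changes after `a - k + 1` iterations. For `k > a` the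
  -- truncation by `toNat` is harmless, because all iterates vanish there.
  let P : PDO d := ⟨fun k => (F^[(a - k).toNat + 1] 0).val k, a, fun k hk => hX _ k hk⟩
  have hPX : ∀ n : ℕ, OrdLE (P - F^[n] 0).val (a - n) := by
    intro n k hk
    rw [sub_val, Pi.sub_apply, sub_eq_zero]
    change (F^[(a - k).toNat + 1] 0).val k = _
    by_cases hka : a < k
    · rw [hX _ k hka, hX _ k hka]
    · obtain ⟨j, hj⟩ : ∃ j, n = (a - k).toNat + 1 + j := ⟨n - ((a - k).toNat + 1), by omega⟩
      rw [hj, hstab k _ j (by push_cast; omega)]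
  have hP : OrdLE P.val a := fun k hk => hX _ k hk
  refine ⟨P, hP, ?_⟩
  rw [← sub_eq_zero]
  refine eq_zero_of_forall_ordLE (a - 1) fun n => ?_
  have h1 := hc _ _ _ hP (hX n) (hPX n)
  have h2 := hPX (n + 1)
  rw [Function.iterate_succ_apply'] at h2
  have e : F P - P = (F P - F (F^[n] 0)) - (P - F (F^[n] 0)) := by abel
  rw [e]
  push_cast at h2
  exact (h1.mono (by omega)).sub (h2.mono (by omega))

theorem fixedPoint_unique (F : PDO d → PDO d) (a : ℤ)
    (hc : ∀ P Q k, OrdLE P.val a → OrdLE Q.val a → OrdLE (P - Q).val k →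
      OrdLE (F P - F Q).val (k - 1)) {P Q : PDO d} (hP : OrdLE P.val a) (hQ : OrdLE Q.val a)
    (hFP : F P = P) (hFQ : F Q = Q) : P = Q := by
  rw [← sub_eq_zero]
  refine eq_zero_of_ordLE_pred fun k hk => ?_
  have := hc P Q k hP hQ hk
  rw [hFP, hFQ] at this
  exact this k (by omega)

theorem monom_mul_monom_one (p q : ℤ) (x : S) :
    monom d p x * monom d q 1 = monom d (p + q) x := by
  ext k
  rw [mul_monom_of_const _ _ d.map_one_eq_zero, mul_one, monom_val_apply, monom_val_apply]
  exact if_congr (by omega) rfl rfl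

theorem monom_one_mul_monom_neg (p : ℤ) : monom d p 1 * monom d (-p) 1 = 1 := by
  rw [monom_mul_monom_one, add_neg_cancel, one_def]

/-- With `P = ∂^a + N` and `N` of lower order, `P Q = 1` is the fixed-point equation `Q = ∂^{-a} (1
- N Q)`, whose right-hand side is a contraction. -/
theorem exists_right_inverse {P : PDO d} {a : ℤ} (hP : IsMonic P a) :
    ∃ Q, IsMonic Q (-a) ∧ P * Q = 1 := by
  have hN : OrdLE (P - monom d a 1).val (a - 1) :=
    ordLE_pred (hP.1.sub (ordLE_monom a 1)) (by
      rw [sub_val, Pi.sub_apply, hP.2, monom_val_apply, if_pos rfl, sub_self])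
  obtain ⟨Q, hQ, hFQ⟩ := exists_fixedPoint
    (fun Q => monom d (-a) 1 * (1 - (P - monom d a 1) * Q)) (-a)
    (fun Q hQ => by
      have h1 : OrdLE (1 - (P - monom d a 1) * Q).val 0 :=
        (ordLE_monom (d := d) 0 1).sub ((ordLE_mul hN hQ).mono (by omega))
      exact (ordLE_mul (ordLE_monom (-a) 1) h1).mono (by omega))
    (fun Q Q' k hQ hQ' h => by
      have e : monom d (-a) 1 * (1 - (P - monom d a 1) * Q) -
          monom d (-a) 1 * (1 - (P - monom d a 1) * Q') =
          -(monom d (-a) 1 * ((P - monom d a 1) * (Q - Q'))) := by noncomm_ring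
      rw [e]
      exact (ordLE_mul (ordLE_monom (-a) 1) (ordLE_mul hN h)).neg.mono (by omega))
  have hPQ : P * Q = 1 := by
    have h := congrArg (monom d a 1 * ·) hFQ
    simp only [← mul_assoc, monom_one_mul_monom_neg, one_mul] at h
    calc P * Q = (P - monom d a 1) * Q + monom d a 1 * Q := by noncomm_ring
      _ = 1 := by rw [← h]; abel
  refine ⟨Q, ⟨hQ, ?_⟩, hPQ⟩
  have h1 := mul_lead hP.1 hQ
  rw [hPQ, hP.2, one_mul, add_neg_cancel, one_def, monom_val_apply, if_pos rfl] at h1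
  exact h1.symm

theorem exists_inverse {P : PDO d} {a : ℤ} (hP : IsMonic P a) :
    ∃ Q, OrdLE Q.val (-a) ∧ P * Q = 1 ∧ Q * P = 1 := by
  obtain ⟨Q, hQ, hPQ⟩ := exists_right_inverse hP
  obtain ⟨P', -, hQP'⟩ := exists_right_inverse hQ
  have : P = P' := by
    calc P = P * (Q * P') := by rw [hQP', mul_one]
      _ = P' := by rw [← mul_assoc, hPQ, one_mul]
  exact ⟨Q, hQ.1, hPQ, this ▸ hQP'⟩

/-- A simplified Newton iteration: `L = ∂ + U` is corrected by `c = 1/m` times the error `M - L^m`,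
shifted down by `m - 1` orders. By `pow_sub_pow` the leading part of a difference cancels, so this
is a contraction, and its fixed points are exactly the roots. -/
theorem existsUnique_root (m : ℕ) (c : S) (hc : (m : S) * c = 1) {M : PDO d}
    (hM : IsMonic M m) : ∃! L : PDO d, IsMonic L 1 ∧ L ^ m = M := by
  let F : PDO d → PDO d := fun U =>
    U + monom d 0 c * (M - (monom d 1 1 + U) ^ m) * monom d (1 - m) 1
  have hmon : ∀ U : PDO d, OrdLE U.val 0 → IsMonic (monom d 1 1 + U) 1 := fun U hU =>
    ⟨(ordLE_monom 1 1).add (hU.mono (by omega)), by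
      rw [add_val, Pi.add_apply, hU 1 (by omega), monom_val_apply, if_pos rfl, add_zero]⟩
  have hcoeff : ∀ (Q : PDO d) (k : ℤ),
      (monom d 0 c * Q * monom d (1 - m) 1).val k = c * Q.val (k + m - 1) := by
    intro Q k
    rw [mul_monom_of_const _ _ d.map_one_eq_zero, monom_zero_mul_val, mul_one]
    congr 2
    ring
  have hF : ∀ U, OrdLE U.val 0 → OrdLE (F U).val 0 := by
    intro U hU k hk
    have h := (hmon U hU).pow m
    rw [mul_one] at h
    have hlt : OrdLE (M - (monom d 1 1 + U) ^ m).val (m - 1) :=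
      ordLE_pred (hM.1.sub h.1) (by rw [sub_val, Pi.sub_apply, hM.2, h.2, sub_self])
    rw [add_val, Pi.add_apply, hcoeff, hU k hk, hlt _ (by omega), mul_zero, add_zero]
  have hcon : ∀ U U' k, OrdLE U.val 0 → OrdLE U'.val 0 → OrdLE (U - U').val k →
      OrdLE (F U - F U').val (k - 1) := by
    intro U U' k hU hU' h
    have h' : OrdLE ((monom d 1 1 + U) - (monom d 1 1 + U')).val k := by
      rwa [add_sub_add_left_eq_sub]
    obtain ⟨h1, h2⟩ := pow_sub_pow (hmon U hU) (hmon U' hU') h' m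
    rw [add_sub_add_left_eq_sub] at h2
    have e : ∀ j, (F U - F U').val j = (U - U').val j -
        c * ((monom d 1 1 + U) ^ m - (monom d 1 1 + U') ^ m).val (j + m - 1) := by
      intro j
      rw [sub_val, Pi.sub_apply, add_val, add_val, Pi.add_apply, Pi.add_apply, hcoeff, hcoeff]
      simp only [sub_val, Pi.sub_apply]
      ring
    refine ordLE_pred (fun j hj => ?_) ?_
    · rw [e, h j hj, h1 _ (by omega), mul_zero, sub_zero]
    · rw [e, h2, nsmul_eq_mul, ← mul_assoc, mul_comm c, hc, one_mul, sub_self]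
  have hfix : ∀ U, F U = U ↔ (monom d 1 1 + U) ^ m = M := by
    intro U
    constructor
    · intro h
      have h0 : monom d 0 c * (M - (monom d 1 1 + U) ^ m) * monom d (1 - m) 1 = 0 := by
        simpa [F] using h
      symm
      rw [← sub_eq_zero]
      ext k
      have h1 := hcoeff (M - (monom d 1 1 + U) ^ m) (k - m + 1)
      have e : k - m + 1 + m - 1 = k := by ring
      rw [h0, e] at h1
      calc _ = (m : S) * c * (M - (monom d 1 1 + U) ^ m).val k := by rw [hc, one_mul]
        _ = 0 := by rw [mul_assoc, ← h1]; simp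
    · intro h
      simp only [F, h, sub_self, mul_zero, zero_mul, add_zero]
  obtain ⟨U, hU, hFU⟩ := exists_fixedPoint F 0 hF hcon
  refine ⟨monom d 1 1 + U, ⟨hmon U hU, (hfix U).mp hFU⟩, ?_⟩
  rintro L ⟨hL, hLm⟩
  have hU' : OrdLE (L - monom d 1 1).val 0 :=
    ordLE_pred (hL.1.sub (ordLE_monom 1 1)) (by
      rw [Pi.sub_apply, hL.2, monom_val_apply, if_pos rfl, sub_self])
  have := fixedPoint_unique F 0 hcon hU' hU ((hfix _).mpr (by rwa [add_sub_cancel])) hFU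
  rw [← this, add_sub_cancel]

/-! #### Right coefficients -/

/-- The right coefficients: `Y_i` in `Y = ∑ ∂^{-i-1} Y_i`. -/
noncomputable def rightCoeff (Y : PDO d) (i : ℤ) : S := (monom d i 1 * Y).val (-1)

theorem monom_eq_mul (p : ℤ) (x : S) : monom d p x = monom d 0 x * monom d p 1 := by
  rw [monom_mul_monom_one, zero_add]

theorem res_monom_mul (i : ℤ) (x : S) (Y : PDO d) :
    (monom d i x * Y).val (-1) = x * rightCoeff Y i := by
  rw [monom_eq_mul, mul_assoc, monom_zero_mul_val, rightCoeff]

theorem rightCoeff_add (Y Z : PDO d) (i : ℤ) :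
    rightCoeff (Y + Z) i = rightCoeff Y i + rightCoeff Z i := by
  rw [rightCoeff, mul_add, add_val, Pi.add_apply, rightCoeff, rightCoeff]

theorem rightCoeff_sub (Y Z : PDO d) (i : ℤ) :
    rightCoeff (Y - Z) i = rightCoeff Y i - rightCoeff Z i := by
  rw [rightCoeff, mul_sub, sub_val, Pi.sub_apply, rightCoeff, rightCoeff]

theorem rightCoeff_eq_zero {Y : PDO d} {b i : ℤ} (hY : OrdLE Y.val b) (h : i + b < -1) :
    rightCoeff Y i = 0 := ordLE_mul (ordLE_monom i 1) hY _ h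

theorem res_mul {P Y : PDO d} {N b K : ℤ} (hP : OrdLE P.val N) (hY : OrdLE Y.val b)
    (hK : K + b < -1) :
    (P * Y).val (-1) = ∑ i ∈ Finset.Ioc K N, P.val i * rightCoeff Y i := by
  have h := ordLE_mul (ordLE_sub_sum_monom P hP K) hY (-1) hK
  rw [sub_mul, sub_val, Pi.sub_apply, sub_eq_zero, Finset.sum_mul, sum_val] at h
  rw [h]
  exact Finset.sum_congr rfl fun i _ => res_monom_mul i _ Y

/-- If `Y` has order at most `b`, its coefficient of `∂^b` is the right coefficient with index `-1 -
b`. The order can therefore be lowered repeatedly until it reaches `-N - 2`. -/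
theorem ordLE_of_rightCoeff {Y : PDO d} {N : ℤ} (h : ∀ i ≤ N, rightCoeff Y i = 0) :
    OrdLE Y.val (-N - 2) := by
  obtain ⟨b, hb⟩ := Y.exists_ordLE
  have : ∀ n : ℕ, OrdLE Y.val (max (-N - 2) (b - n)) := by
    intro n
    induction n with
    | zero => exact hb.mono (by simp)
    | succ n ih =>
      by_cases hn : b - n ≤ -N - 2
      · exact ih.mono (by omega)
      · have ih' : OrdLE Y.val (b - n) := ih.mono (by omega)
        have h1 := mul_lead (ordLE_monom (d := d) (-1 - (b - n)) 1) ih'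
        have e : -1 - (b - n) + (b - n) = -1 := by ring
        rw [e, ← rightCoeff, h _ (by omega), monom_val_apply, if_pos rfl, one_mul] at h1
        exact (ordLE_pred ih' h1.symm).mono (by push_cast; omega)
  exact (this (b + N + 2).toNat).mono (by omega)

/-- For `i < j` the order is below `-1`; for `i > j` the binomial coefficient is that of `i - j - 1`
over `i - j`, which is zero. -/
theorem rightCoeff_monom_mul (i j : ℤ) (x : S) :
    rightCoeff (monom d (-j - 1) 1 * monom d 0 x) i = if i = j then x else 0 := by
  rw [rightCoeff, ← mul_assoc, monom_mul_monom_one]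
  by_cases hlt : i < j
  · rw [monom_mul_monom_of_lt 1 x (by omega), if_neg (by omega)]
  · obtain ⟨l, hl⟩ := Int.le.dest (not_lt.mp hlt)
    have h := monom_mul_monom (d := d) (i + (-j - 1)) 0 1 x l
    have e : i + (-j - 1) + 0 - l = -1 := by omega
    rw [e] at h
    rw [h]
    rcases Nat.eq_zero_or_pos l with rfl | hl0
    · rw [if_pos (by omega), Ring.choose_zero_right]
      simp
    · rw [if_neg (by omega), choose_eq_zero_of_lt (by omega) (by omega), zero_smul]

/-! #### Derivations acting on coefficients -/

/-- A derivation of the coefficients acts on the operators. -/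
def mapCoeff (D : S →+ S) : PDO d →+ PDO d where
  toFun P := ⟨fun k => D (P.val k), P.exists_ordLE.imp fun a ha k hk => by simp [ha k hk]⟩
  map_zero' := by ext k; exact D.map_zero
  map_add' P Q := by ext k; exact D.map_add _ _

theorem mapCoeff_val (D : S →+ S) (P : PDO d) (k : ℤ) : (mapCoeff D P).val k = D (P.val k) := rfl

theorem iterate_comm {D : S →+ S} (hD : ∀ s, D (d s) = d (D s)) (l : ℕ) (s : S) :
    D (d^[l] s) = d^[l] (D s) := by
  induction l generalizing s with
  | zero => rfl
  | succ l ih => rw [Function.iterate_succ_apply, ih, hD, Function.iterate_succ_apply]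

theorem mapCoeff_mul {D : S →+ S} (hD : ∀ s, D (d s) = d (D s))
    (hmul : ∀ x y, D (x * y) = D x * y + x * D y) (P Q : PDO d) :
    mapCoeff D (P * Q) = mapCoeff D P * Q + P * mapCoeff D Q := by
  obtain ⟨a, ha⟩ := P.exists_ordLE
  obtain ⟨b, hb⟩ := Q.exists_ordLE
  have ha' : OrdLE (mapCoeff D P).val a := fun k hk => by rw [mapCoeff_val, ha k hk, map_zero]
  have hb' : OrdLE (mapCoeff D Q).val b := fun k hk => by rw [mapCoeff_val, hb k hk, map_zero]
  ext k
  rw [mapCoeff_val, add_val, Pi.add_apply, mul_val, mul_val, mul_val, comp_apply_eq_sum d ha hb,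
    comp_apply_eq_sum d ha' hb, comp_apply_eq_sum d ha hb', map_sum, ← Finset.sum_add_distrib]
  refine Finset.sum_congr rfl fun p _ => ?_
  rw [map_zsmul, hmul, iterate_comm hD, smul_add]
  rfl

theorem mapCoeff_posPart (D : S →+ S) (P : PDO d) :
    mapCoeff D (posPart d P) = posPart d (mapCoeff D P) := by
  ext k
  by_cases hk : 0 ≤ k
  · rw [mapCoeff_val, posPart_val_of_nonneg _ hk, posPart_val_of_nonneg _ hk, mapCoeff_val]
  · rw [mapCoeff_val, posPart_val_of_neg _ (by omega), posPart_val_of_neg _ (by omega), map_zero]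

end PDO

end FrobeniusKP

namespace FrobeniusKP

open MvPolynomial

/-! ### Variational calculus -/

section Calculus

variable {N : ℤ} {n : ℕ} {R : Type} [CommRing R]

theorem pderiv_pderiv_swap {σ : Type} (i j : σ) (f : MvPolynomial σ R) :
    pderiv i (pderiv j f) = pderiv j (pderiv i f) := by
  classical
  have h : ⁅pderiv (R := R) i, pderiv (R := R) j⁆ = 0 := by
    refine derivation_ext fun v => ?_
    rw [Derivation.commutator_apply, pderiv_X, pderiv_X, Pi.single_apply, Pi.single_apply]
    split_ifs <;> simp
  have h2 := DFunLike.congr_fun h f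
  rw [Derivation.commutator_apply] at h2
  exact sub_eq_zero.mp h2

theorem dx_X (v : Comp N n × ℕ) : dx N n R (X v) = X (v.1, v.2 + 1) := mkDerivation_X _ _ _

/-- The chain rule. Comparing the derivations only on the variables of `f` keeps the sum finite
although there are infinitely many variables. -/
theorem derivation_eq_sum {σ : Type} (D : Derivation R (MvPolynomial σ R) (MvPolynomial σ R))
    (f : MvPolynomial σ R) (s : Finset σ) (hs : f.vars ⊆ s) :
    D f = ∑ v ∈ s, D (X v) * pderiv v f := by
  let E : Derivation R (MvPolynomial σ R) (MvPolynomial σ R) :=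
    ∑ v ∈ s, D (X v) • pderiv v
  have hE : ∀ g, E g = ∑ v ∈ s, D (X v) * pderiv v g := by
    intro g
    simp only [E]
    have h := congrFun (map_sum Derivation.coeFnAddMonoidHom (fun v => D (X v) • pderiv v) s) g
    rw [Finset.sum_apply] at h
    exact h
  rw [← hE]
  refine derivation_eq_of_forall_mem_vars fun v hv => ?_
  rw [hE, Finset.sum_eq_single v]
  · rw [pderiv_X_self, mul_one]
  · intro w _ hw
    rw [pderiv_X_of_ne hw.symm, mul_zero]
  · intro h
    exact absurd (hs hv) h

theorem pderiv_zero_dx (α : Comp N n) (f : DiffPoly N n R) :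
    pderiv (α, 0) (dx N n R f) = dx N n R (pderiv (α, 0) f) := by
  classical
  have h : ⁅pderiv (R := R) (α, 0), dx N n R⁆ = 0 := by
    refine derivation_ext fun v => ?_
    rw [Derivation.commutator_apply, dx_X, pderiv_X, pderiv_X, Pi.single_apply, Pi.single_apply]
    have : (v.1, v.2 + 1) ≠ (α, 0) := fun h => by simpa using congrArg Prod.snd h
    rw [if_neg this]
    split_ifs <;> simp
  have h2 := DFunLike.congr_fun h f
  rw [Derivation.commutator_apply] at h2
  exact sub_eq_zero.mp h2

/-- A commutator of derivations can be read off on the generators. The extra term arises because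
`dx` produces the variable of order `j + 1` from the one of order `j`. -/
theorem pderiv_succ_dx (α : Comp N n) (j : ℕ) (f : DiffPoly N n R) :
    pderiv (α, j + 1) (dx N n R f) = dx N n R (pderiv (α, j + 1) f) + pderiv (α, j) f := by
  classical
  have h : ⁅pderiv (R := R) (α, j + 1), dx N n R⁆ = pderiv (α, j) := by
    refine derivation_ext fun v => ?_
    rw [Derivation.commutator_apply, dx_X, pderiv_X, pderiv_X, pderiv_X, Pi.single_apply,
      Pi.single_apply, Pi.single_apply]
    have : (v.1, v.2 + 1) = (α, j + 1) ↔ v = (α, j) := by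
      simp [Prod.ext_iff]
    simp only [this]
    split_ifs <;> simp
  have h2 := DFunLike.congr_fun h f
  rw [Derivation.commutator_apply] at h2
  rw [← h2]
  abel

/-- All jet variables in `f` are derivatives of order less than `J` of the fields in `s`. -/
def JetIn (f : DiffPoly N n R) (s : Finset (Comp N n)) (J : ℕ) : Prop :=
  f.vars ⊆ s ×ˢ Finset.range J

theorem exists_jetIn (f : DiffPoly N n R) : ∃ s J, JetIn f s J := by
  classical
  refine ⟨f.vars.image Prod.fst, f.vars.sup Prod.snd + 1, fun v hv => ?_⟩
  exact Finset.mem_product.mpr ⟨Finset.mem_image_of_mem _ hv,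
    Finset.mem_range.mpr (Nat.lt_succ_iff.mpr (Finset.le_sup (f := Prod.snd) hv))⟩

theorem JetIn.pderiv_of_le {f : DiffPoly N n R} {s : Finset (Comp N n)} {J : ℕ} (h : JetIn f s J)
    (α : Comp N n) {j : ℕ} (hj : J ≤ j) : pderiv (α, j) f = 0 :=
  pderiv_eq_zero_of_notMem_vars fun hv => by
    have := (Finset.mem_product.mp (h hv)).2
    rw [Finset.mem_range] at this
    exact absurd this (by simpa using hj)

theorem JetIn.pderiv_of_notMem {f : DiffPoly N n R} {s : Finset (Comp N n)} {J : ℕ}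
    (h : JetIn f s J) {α : Comp N n} (hα : α ∉ s) (j : ℕ) : pderiv (α, j) f = 0 :=
  pderiv_eq_zero_of_notMem_vars fun hv => hα (Finset.mem_product.mp (h hv)).1

end Calculus

section Variational

variable {N : ℤ} {n : ℕ}

theorem varDeriv_eq_sum {f : DiffPoly N n ℝ} {α : Comp N n} {J : ℕ}
    (h : ∀ j, J ≤ j → pderiv (α, j) f = 0) :
    varDeriv f α = ∑ j ∈ Finset.range J, (-1) ^ j * (dx N n ℝ)^[j] (pderiv (α, j) f) := by
  refine finsum_eq_sum_of_support_subset _ fun j hj => ?_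
  rw [Finset.mem_coe, Finset.mem_range]
  by_contra hJ
  exact hj (by beta_reduce; rw [h j (not_lt.mp hJ), iterate_derivation_zero, mul_zero])

theorem JetIn.varDeriv_eq_sum {f : DiffPoly N n ℝ} {s : Finset (Comp N n)} {J : ℕ}
    (h : JetIn f s J) (α : Comp N n) :
    varDeriv f α = ∑ j ∈ Finset.range J, (-1) ^ j * (dx N n ℝ)^[j] (pderiv (α, j) f) :=
  FrobeniusKP.varDeriv_eq_sum fun _ hj => h.pderiv_of_le α hj

theorem JetIn.varDeriv_of_notMem {f : DiffPoly N n ℝ} {s : Finset (Comp N n)} {J : ℕ}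
    (h : JetIn f s J) {α : Comp N n} (hα : α ∉ s) : varDeriv f α = 0 := by
  rw [h.varDeriv_eq_sum]
  refine Finset.sum_eq_zero fun j _ => ?_
  rw [h.pderiv_of_notMem hα, iterate_derivation_zero, mul_zero]

theorem exists_bound_pderiv (f : DiffPoly N n ℝ) : ∃ J, ∀ α j, J ≤ j → pderiv (α, j) f = 0 := by
  obtain ⟨s, J, h⟩ := exists_jetIn f
  exact ⟨J, fun α j hj => h.pderiv_of_le α hj⟩

theorem varDeriv_add (f g : DiffPoly N n ℝ) (α : Comp N n) :
    varDeriv (f + g) α = varDeriv f α + varDeriv g α := by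
  obtain ⟨J, hJ⟩ := exists_bound_pderiv f
  obtain ⟨K, hK⟩ := exists_bound_pderiv g
  have h1 : ∀ j, max J K ≤ j → pderiv (α, j) f = 0 := fun j hj => hJ α j (le_of_max_le_left hj)
  have h2 : ∀ j, max J K ≤ j → pderiv (α, j) g = 0 := fun j hj => hK α j (le_of_max_le_right hj)
  rw [varDeriv_eq_sum h1, varDeriv_eq_sum h2,
    varDeriv_eq_sum (J := max J K) fun j hj => by rw [map_add, h1 j hj, h2 j hj, add_zero],
    ← Finset.sum_add_distrib]
  refine Finset.sum_congr rfl fun j _ => ?_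
  rw [map_add, iterate_derivation_add, mul_add]

theorem iterate_dx_smul (a : ℝ) (j : ℕ) (f : DiffPoly N n ℝ) :
    (dx N n ℝ)^[j] (a • f) = a • (dx N n ℝ)^[j] f := by
  induction j generalizing f with
  | zero => rfl
  | succ j ih => rw [Function.iterate_succ_apply, Derivation.map_smul, ih, Function.iterate_succ_apply]

theorem varDeriv_smul (a : ℝ) (f : DiffPoly N n ℝ) (α : Comp N n) :
    varDeriv (a • f) α = a • varDeriv f α := by
  obtain ⟨J, hJ⟩ := exists_bound_pderiv f
  rw [varDeriv_eq_sum (hJ α),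
    varDeriv_eq_sum (J := J) fun j hj => by rw [Derivation.map_smul, hJ α j hj, smul_zero], Finset.smul_sum]
  refine Finset.sum_congr rfl fun j _ => ?_
  rw [Derivation.map_smul, iterate_dx_smul, mul_smul_comm]

/-- The variational derivative as a linear map. -/
noncomputable def varDerivₗ (α : Comp N n) : DiffPoly N n ℝ →ₗ[ℝ] DiffPoly N n ℝ where
  toFun f := varDeriv f α
  map_add' f g := varDeriv_add f g α
  map_smul' a f := varDeriv_smul a f α

theorem varDeriv_dx (f : DiffPoly N n ℝ) (α : Comp N n) : varDeriv (dx N n ℝ f) α = 0 := by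
  obtain ⟨J, hJ⟩ := exists_bound_pderiv f
  have h : ∀ j, J + 1 ≤ j → pderiv (α, j) (dx N n ℝ f) = 0 := by
    intro j hj
    obtain ⟨i, rfl⟩ : ∃ i, j = i + 1 := ⟨j - 1, by omega⟩
    rw [pderiv_succ_dx, hJ α _ (by omega), hJ α _ (by omega), map_zero, add_zero]
  rw [varDeriv_eq_sum h]
  -- The alternating sum telescopes to a boundary term, which vanishes once `K` exceeds the order of
  -- `f`.
  have key : ∀ K, ∑ j ∈ Finset.range (K + 1),
      (-1) ^ j * (dx N n ℝ)^[j] (pderiv (α, j) (dx N n ℝ f)) =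
      (-1) ^ K * (dx N n ℝ)^[K + 1] (pderiv (α, K) f) := by
    intro K
    induction K with
    | zero => simp [pderiv_zero_dx]
    | succ K ih =>
      rw [Finset.sum_range_succ, ih, pderiv_succ_dx, iterate_derivation_add,
        ← Function.iterate_succ_apply]
      ring
  rw [key, hJ α J le_rfl, iterate_derivation_zero, mul_zero]

/-- `∫ f dx` as a linear map. -/
noncomputable def integralₗ (N : ℤ) (n : ℕ) : DiffPoly N n ℝ →ₗ[ℝ] Functional N n :=
  (LinearMap.range (dx N n ℝ).toLinearMap).mkQ

theorem integral_add (f g : DiffPoly N n ℝ) : integral (f + g) = integral f + integral g :=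
  map_add (integralₗ N n) f g

theorem integral_sub (f g : DiffPoly N n ℝ) : integral (f - g) = integral f - integral g :=
  map_sub (integralₗ N n) f g

theorem integral_neg (f : DiffPoly N n ℝ) : integral (-f) = -integral f :=
  map_neg (integralₗ N n) f

theorem integral_zero : integral (0 : DiffPoly N n ℝ) = 0 := map_zero (integralₗ N n)

theorem integral_smul (a : ℝ) (f : DiffPoly N n ℝ) : integral (a • f) = a • integral f :=
  map_smul (integralₗ N n) a f

theorem integral_sum {ι : Type*} (s : Finset ι) (f : ι → DiffPoly N n ℝ) :
    integral (∑ i ∈ s, f i) = ∑ i ∈ s, integral (f i) :=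
  map_sum (integralₗ N n) f s

theorem integral_dx (f : DiffPoly N n ℝ) : integral (dx N n ℝ f) = 0 :=
  (Submodule.Quotient.mk_eq_zero _).mpr ⟨f, rfl⟩

theorem integral_eq_zero_iff (f : DiffPoly N n ℝ) : integral f = 0 ↔ ∃ g, dx N n ℝ g = f :=
  Submodule.Quotient.mk_eq_zero _

theorem integral_surjective (F : Functional N n) : ∃ f, integral f = F :=
  Submodule.Quotient.mk_surjective _ F

theorem varDeriv_eq_of_integral_eq {f g : DiffPoly N n ℝ} (h : integral f = integral g)
    (α : Comp N n) : varDeriv f α = varDeriv g α := by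
  rw [← sub_eq_zero, ← integral_sub] at h
  obtain ⟨k, hk⟩ := (integral_eq_zero_iff _).mp h
  have h1 := varDeriv_dx k α
  rw [hk] at h1
  have h2 := map_sub (varDerivₗ α) f g
  exact sub_eq_zero.mp (h2.symm.trans h1)

theorem integral_iterate_mul (l : ℕ) (x y : DiffPoly N n ℝ) :
    integral ((dx N n ℝ)^[l] x * y) = integral (x * ((-1) ^ l * (dx N n ℝ)^[l] y)) := by
  obtain ⟨s, hs⟩ := PDO.mul_iterate_sub_mem_range (d := dx N n ℝ) l y x
  have h := integral_dx s
  rw [← hs, integral_sub, sub_eq_zero] at h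
  rw [mul_comm, h]
  congr 1
  ring

theorem evol_eq_sum {f : DiffPoly N n ℝ} {s : Finset (Comp N n)} {J : ℕ} (h : JetIn f s J)
    (c : Comp N n → DiffPoly N n ℝ) :
    evol N n ℝ c f = ∑ α ∈ s, ∑ j ∈ Finset.range J, (dx N n ℝ)^[j] (c α) * pderiv (α, j) f := by
  classical
  rw [derivation_eq_sum _ f _ h, Finset.sum_product]
  refine Finset.sum_congr rfl fun α _ => Finset.sum_congr rfl fun j _ => ?_
  rw [evol, mkDerivation_X, Algebra.algebraMap_self, map_id]

theorem JetIn.finsum_mul_varDeriv {f : DiffPoly N n ℝ} {s : Finset (Comp N n)} {J : ℕ}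
    (h : JetIn f s J) (c : Comp N n → DiffPoly N n ℝ) :
    ∑ᶠ α, c α * varDeriv f α = ∑ α ∈ s, c α * varDeriv f α := by
  refine finsum_eq_sum_of_support_subset _ fun α hα => ?_
  by_contra hs
  exact hα (by beta_reduce; rw [h.varDeriv_of_notMem hs, mul_zero])

/-- First variation: integration by parts moves the `x`-derivatives from `c` onto the partial
derivatives of `f`. -/
theorem integral_evol (c : Comp N n → DiffPoly N n ℝ) (f : DiffPoly N n ℝ) :
    integral (evol N n ℝ c f) = integral (∑ᶠ α, c α * varDeriv f α) := by
  obtain ⟨s, J, h⟩ := exists_jetIn f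
  rw [h.finsum_mul_varDeriv, evol_eq_sum h, integral_sum, integral_sum]
  refine Finset.sum_congr rfl fun α _ => ?_
  rw [h.varDeriv_eq_sum, Finset.mul_sum, integral_sum, integral_sum]
  exact Finset.sum_congr rfl fun j _ => integral_iterate_mul _ _ _

theorem evol_dx {R : Type} [CommRing R] [Algebra ℝ R] (c : Comp N n → DiffPoly N n ℝ)
    (f : DiffPoly N n R) : evol N n R c (dx N n R f) = dx N n R (evol N n R c f) := by
  have hmap : ∀ g : DiffPoly N n ℝ,
      dx N n R (MvPolynomial.map (algebraMap ℝ R) g) =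
        MvPolynomial.map (algebraMap ℝ R) (dx N n ℝ g) := by
    intro g
    induction g using MvPolynomial.induction_on with
    | C a => simp
    | add p q hp hq => simp only [map_add, hp, hq]
    | mul_X p v hp =>
      simp only [map_mul, map_X, Derivation.leibniz, dx_X, hp, map_add, smul_eq_mul]
  have h : ⁅evol N n R c, dx N n R⁆ = 0 := by
    refine derivation_ext fun v => ?_
    rw [Derivation.commutator_apply, dx_X, evol, mkDerivation_X, mkDerivation_X, hmap,
      ← Function.iterate_succ_apply' (dx N n ℝ), sub_self]
    rfl
  have h2 := DFunLike.congr_fun h f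
  rw [Derivation.commutator_apply] at h2
  exact sub_eq_zero.mp h2

theorem evol_iterate_dx {R : Type} [CommRing R] [Algebra ℝ R] (c : Comp N n → DiffPoly N n ℝ)
    (j : ℕ) (f : DiffPoly N n R) :
    evol N n R c ((dx N n R)^[j] f) = (dx N n R)^[j] (evol N n R c f) := by
  induction j generalizing f with
  | zero => rfl
  | succ j ih => rw [Function.iterate_succ_apply, ih, evol_dx, Function.iterate_succ_apply]

theorem evol_X (c : Comp N n → DiffPoly N n ℝ) (v : Comp N n × ℕ) :
    evol N n ℝ c (X v) = (dx N n ℝ)^[v.2] (c v.1) := by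
  rw [evol, mkDerivation_X, Algebra.algebraMap_self, map_id]

theorem evol_comm (b c : Comp N n → DiffPoly N n ℝ) (f : DiffPoly N n ℝ) :
    evol N n ℝ b (evol N n ℝ c f) - evol N n ℝ c (evol N n ℝ b f) =
      evol N n ℝ (fun α => evol N n ℝ b (c α) - evol N n ℝ c (b α)) f := by
  have h : ⁅evol N n ℝ b, evol N n ℝ c⁆ =
      evol N n ℝ (fun α => evol N n ℝ b (c α) - evol N n ℝ c (b α)) := by
    refine derivation_ext fun v => ?_
    rw [Derivation.commutator_apply, evol_X, evol_X, evol_X, evol_iterate_dx, evol_iterate_dx]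
    exact (iterate_map_sub (dx N n ℝ) v.2 _ _).symm
  rw [← h, Derivation.commutator_apply]

/-- The second variation of a functional is symmetric. -/
theorem hessian_symm (f : DiffPoly N n ℝ) (b c : Comp N n → DiffPoly N n ℝ) :
    integral (∑ᶠ α, c α * evol N n ℝ b (varDeriv f α)) =
      integral (∑ᶠ α, b α * evol N n ℝ c (varDeriv f α)) := by
  obtain ⟨s, J, h⟩ := exists_jetIn f
  have hfin : ∀ b c : Comp N n → DiffPoly N n ℝ, ∑ᶠ α, c α * evol N n ℝ b (varDeriv f α) =
      ∑ α ∈ s, c α * evol N n ℝ b (varDeriv f α) := by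
    intro b c
    refine finsum_eq_sum_of_support_subset _ fun α hα => ?_
    by_contra hs
    exact hα (by beta_reduce; rw [h.varDeriv_of_notMem hs, map_zero, mul_zero])
  have hdx : ∀ (b : Comp N n → DiffPoly N n ℝ) {x y : DiffPoly N n ℝ}, integral x = integral y →
      integral (evol N n ℝ b x) = integral (evol N n ℝ b y) := by
    intro b x y hxy
    rw [← sub_eq_zero, ← integral_sub] at hxy ⊢
    obtain ⟨k, hk⟩ := (integral_eq_zero_iff _).mp hxy
    rw [← map_sub, ← hk, evol_dx, integral_dx]
  -- The mixed second variation is a first-variation term plus a Hessian term. After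
  -- antisymmetrisation the first-variation terms account for the commutator field of `evol_comm`,
  -- so the Hessian terms must agree.
  have key : ∀ b c : Comp N n → DiffPoly N n ℝ, integral (evol N n ℝ b (evol N n ℝ c f)) =
      integral (∑ α ∈ s, evol N n ℝ b (c α) * varDeriv f α) +
        integral (∑ᶠ α, c α * evol N n ℝ b (varDeriv f α)) := by
    intro b c
    rw [hdx b (integral_evol c f), h.finsum_mul_varDeriv, hfin, ← integral_add, map_sum,
      ← Finset.sum_add_distrib]
    congr 1
    refine Finset.sum_congr rfl fun α _ => ?_
    rw [Derivation.leibniz, smul_eq_mul, smul_eq_mul]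
    ring
  have h1 := congrArg integral (evol_comm b c f)
  rw [integral_sub, key b c, key c b, integral_evol, h.finsum_mul_varDeriv] at h1
  simp only [sub_mul, Finset.sum_sub_distrib] at h1
  rw [integral_sub] at h1
  have h2 := sub_eq_zero.mpr h1
  rw [← sub_eq_zero, ← h2]
  abel

/-- A differential polynomial of order at most `K` in the field `α`. -/
theorem pderiv_iterate_dx {f : DiffPoly N n ℝ} {α : Comp N n} {K : ℕ}
    (h : ∀ j, K < j → pderiv (α, j) f = 0) (i : ℕ) :
    (∀ j, K + i < j → pderiv (α, j) ((dx N n ℝ)^[i] f) = 0) ∧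
      pderiv (α, K + i) ((dx N n ℝ)^[i] f) = pderiv (α, K) f := by
  induction i with
  | zero => exact ⟨h, rfl⟩
  | succ i ih =>
    rw [Function.iterate_succ_apply']
    refine ⟨fun j hj => ?_, ?_⟩
    · obtain ⟨k, rfl⟩ : ∃ k, j = k + 1 := ⟨j - 1, by omega⟩
      rw [pderiv_succ_dx, ih.1 _ (by omega), ih.1 _ (by omega), map_zero, add_zero]
    · rw [← add_assoc, pderiv_succ_dx, ih.1 _ (by omega), ih.2, map_zero, zero_add]

/-- The pairing of differential polynomials modulo total derivatives is non-degenerate. -/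
theorem eq_zero_of_integral_mul [Nonempty (Comp N n)] {w : DiffPoly N n ℝ}
    (h : ∀ u, integral (u * w) = 0) : w = 0 := by
  obtain ⟨α⟩ := ‹Nonempty (Comp N n)›
  -- The test factor will be `X (α, J) ^ 2`, with `J` strictly above the order of `w` in `α`. In the
  -- variational derivative the variable of order `2 J` then comes only from the term `j = J`, with
  -- coefficient `± 2 w`.
  obtain ⟨J, hJ⟩ := exists_bound_pderiv w
  have hX : ∀ j, pderiv (α, j) ((X (α, J)) ^ 2 * w : DiffPoly N n ℝ) =
      (if j = J then 2 * X (α, J) * w else 0) + X (α, J) ^ 2 * pderiv (α, j) w := by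
    intro j
    rw [Derivation.leibniz, Derivation.leibniz_pow, smul_eq_mul, smul_eq_mul]
    split_ifs with hj
    · subst hj
      rw [pderiv_X_self]
      simp only [nsmul_eq_mul, smul_eq_mul]
      push_cast
      ring
    · rw [pderiv_X_of_ne (fun h => hj (congrArg Prod.snd h).symm)]
      simp
  have hb : ∀ j, J + 1 ≤ j → pderiv (α, j) ((X (α, J)) ^ 2 * w : DiffPoly N n ℝ) = 0 := by
    intro j hj
    rw [hX, if_neg (by omega), hJ α j (by omega), mul_zero, add_zero]
  have h0 : varDeriv ((X (α, J)) ^ 2 * w) α = 0 := by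
    have := varDeriv_eq_of_integral_eq ((h (X (α, J) ^ 2)).trans integral_zero.symm) α
    rw [this]
    exact map_zero (varDerivₗ α)
  rw [varDeriv_eq_sum hb] at h0
  have h1 := congrArg (pderiv (α, J + J)) h0
  rw [map_sum, map_zero, Finset.sum_range_succ, Finset.sum_eq_zero, zero_add] at h1
  · rw [hX, if_pos rfl, hJ α J le_rfl, mul_zero, add_zero] at h1
    have hord : ∀ j, J < j → pderiv (α, j) (2 * X (α, J) * w : DiffPoly N n ℝ) = 0 := by
      intro j hj
      have e : (2 : DiffPoly N n ℝ) * X (α, J) * w = (2 : ℝ) • (X (α, J) * w) := by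
        rw [smul_eq_C_mul, mul_assoc]; rfl
      rw [e, Derivation.map_smul, Derivation.leibniz, hJ α j hj.le,
        pderiv_X_of_ne (fun h => hj.ne (congrArg Prod.snd h))]
      simp
    have e1 : ((-1 : DiffPoly N n ℝ)) ^ J * (dx N n ℝ)^[J] (2 * X (α, J) * w) =
        ((-1 : ℝ) ^ J) • (dx N n ℝ)^[J] (2 * X (α, J) * w) := by
      rw [smul_eq_C_mul, map_pow, map_neg, map_one]
    have e : (2 : DiffPoly N n ℝ) * X (α, J) * w = (2 : ℝ) • (X (α, J) * w) := by
      rw [smul_eq_C_mul, mul_assoc]; rfl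
    rw [e1, Derivation.map_smul, (pderiv_iterate_dx hord J).2, e, Derivation.map_smul, Derivation.leibniz,
      hJ α J le_rfl, pderiv_X_self, smul_zero, zero_add, smul_eq_mul, mul_one, smul_smul] at h1
    exact (smul_eq_zero.mp h1).resolve_left (mul_ne_zero (pow_ne_zero _ (by norm_num)) two_ne_zero)
  · intro j hj
    rw [Finset.mem_range] at hj
    have hord : ∀ i, J < i → pderiv (α, i) (pderiv (α, j) ((X (α, J)) ^ 2 * w : DiffPoly N n ℝ)) = 0 := by
      intro i hi
      rw [hX, if_neg hj.ne, zero_add, Derivation.leibniz, Derivation.leibniz_pow,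
        pderiv_X_of_ne (fun h => hi.ne (congrArg Prod.snd h)),
        pderiv_pderiv_swap, hJ α i hi.le]
      simp
    have e1 : ∀ y : DiffPoly N n ℝ, ((-1 : DiffPoly N n ℝ)) ^ j * y = ((-1 : ℝ) ^ j) • y := by
      intro y
      rw [smul_eq_C_mul, map_pow, map_neg, map_one]
    rw [e1, Derivation.map_smul, (pderiv_iterate_dx hord j).1 _ (by omega), smul_zero]

end Variational

end FrobeniusKP

namespace FrobeniusKP

open MvPolynomial PsiDO

section Valued

variable {N : ℤ} {n : ℕ} {A : Type} [CommRing A] [Algebra ℝ A]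

/-! ### Algebra-valued differential polynomials -/

theorem coeff_applyCoeff (φ : A →ₗ[ℝ] ℝ) (F : DiffPoly N n A) (s : (Comp N n × ℕ) →₀ ℕ) :
    (applyCoeff φ F).coeff s = φ (F.coeff s) := by
  classical
  rw [applyCoeff, coeff_sum]
  simp only [coeff_monomial]
  rw [Finset.sum_ite_eq' F.support s fun t => φ (F.coeff t)]
  split_ifs with h
  · rfl
  · rw [notMem_support_iff.mp h, map_zero]

/-- `applyCoeff` as a linear map. -/
noncomputable def applyCoeffₗ (φ : A →ₗ[ℝ] ℝ) : DiffPoly N n A →ₗ[ℝ] DiffPoly N n ℝ where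
  toFun := applyCoeff φ
  map_add' F G := by ext s; simp [coeff_applyCoeff]
  map_smul' a F := by ext s; simp [coeff_applyCoeff]

theorem applyCoeff_add (φ : A →ₗ[ℝ] ℝ) (F G : DiffPoly N n A) :
    applyCoeff φ (F + G) = applyCoeff φ F + applyCoeff φ G := map_add (applyCoeffₗ φ) F G

theorem applyCoeff_sub (φ : A →ₗ[ℝ] ℝ) (F G : DiffPoly N n A) :
    applyCoeff φ (F - G) = applyCoeff φ F - applyCoeff φ G := map_sub (applyCoeffₗ φ) F G

theorem applyCoeff_zero (φ : A →ₗ[ℝ] ℝ) : applyCoeff φ (0 : DiffPoly N n A) = 0 :=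
  map_zero (applyCoeffₗ φ)

theorem applyCoeff_sum {ι : Type*} (φ : A →ₗ[ℝ] ℝ) (s : Finset ι) (F : ι → DiffPoly N n A) :
    applyCoeff φ (∑ i ∈ s, F i) = ∑ i ∈ s, applyCoeff φ (F i) := map_sum (applyCoeffₗ φ) F s

theorem applyCoeff_C_mul_map (φ : A →ₗ[ℝ] ℝ) (a : A) (f : DiffPoly N n ℝ) :
    applyCoeff φ (C a * map (algebraMap ℝ A) f) = φ a • f := by
  ext s
  rw [coeff_applyCoeff, coeff_C_mul, coeff_map, coeff_smul, mul_comm, ← Algebra.smul_def,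
    map_smul, smul_eq_mul, smul_eq_mul, mul_comm]

/-- Every `A`-valued monomial is a constant times a real monomial. Compatibilities of `applyCoeff`
with derivations thus reduce to the real case. -/
theorem valued_induction {P : DiffPoly N n A → Prop} (hadd : ∀ F G, P F → P G → P (F + G))
    (h : ∀ a f, P (C a * map (algebraMap ℝ A) f)) (F : DiffPoly N n A) : P F := by
  induction F using MvPolynomial.induction_on' with
  | monomial s a =>
    have := h a (monomial s 1)
    rwa [map_monomial, map_one, C_mul_monomial, mul_one] at this
  | add p q hp hq => exact hadd p q hp hq

theorem dx_map (g : DiffPoly N n ℝ) :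
    dx N n A (map (algebraMap ℝ A) g) = map (algebraMap ℝ A) (dx N n ℝ g) := by
  induction g using MvPolynomial.induction_on with
  | C a => simp
  | add p q hp hq => simp only [map_add, hp, hq]
  | mul_X p v hp => simp only [map_mul, map_X, Derivation.leibniz, dx_X, hp, map_add, smul_eq_mul]

theorem evol_map (c : Comp N n → DiffPoly N n ℝ) (g : DiffPoly N n ℝ) :
    evol N n A c (map (algebraMap ℝ A) g) = map (algebraMap ℝ A) (evol N n ℝ c g) := by
  induction g using MvPolynomial.induction_on with
  | C a => simp
  | add p q hp hq => simp only [map_add, hp, hq]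
  | mul_X p v hp =>
    have : evol N n A c (X v) = map (algebraMap ℝ A) (evol N n ℝ c (X v)) := by
      rw [evol_X, evol, mkDerivation_X]
    simp only [map_mul, map_X, Derivation.leibniz, this, hp, map_add, smul_eq_mul]

theorem evol_C_mul (c : Comp N n → DiffPoly N n ℝ) (a : A) (F : DiffPoly N n A) :
    evol N n A c (C a * F) = C a * evol N n A c F := by
  rw [Derivation.leibniz, derivation_C, smul_zero, add_zero, smul_eq_mul]

omit [Algebra ℝ A] in
theorem dx_C_mul (a : A) (F : DiffPoly N n A) : dx N n A (C a * F) = C a * dx N n A F := by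
  rw [Derivation.leibniz, derivation_C, smul_zero, add_zero, smul_eq_mul]

theorem applyCoeff_dx (φ : A →ₗ[ℝ] ℝ) (F : DiffPoly N n A) :
    applyCoeff φ (dx N n A F) = dx N n ℝ (applyCoeff φ F) := by
  induction F using valued_induction with
  | hadd F G hF hG => rw [map_add, applyCoeff_add, hF, hG, applyCoeff_add, map_add]
  | h a f =>
    rw [dx_C_mul, dx_map, applyCoeff_C_mul_map, applyCoeff_C_mul_map, Derivation.map_smul]

theorem applyCoeff_evol (φ : A →ₗ[ℝ] ℝ) (c : Comp N n → DiffPoly N n ℝ) (F : DiffPoly N n A) :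
    applyCoeff φ (evol N n A c F) = evol N n ℝ c (applyCoeff φ F) := by
  induction F using valued_induction with
  | hadd F G hF hG => rw [map_add, applyCoeff_add, hF, hG, applyCoeff_add, map_add]
  | h a f =>
    rw [evol_C_mul, evol_map, applyCoeff_C_mul_map, applyCoeff_C_mul_map, Derivation.map_smul]

variable (b : Module.Basis (Fin n) ℝ A)

theorem sum_C_mul_map_coord (F : DiffPoly N n A) :
    ∑ q, C (b q) * map (algebraMap ℝ A) (applyCoeff (b.coord q) F) = F := by
  ext s
  rw [coeff_sum]
  conv_rhs => rw [← b.sum_repr (F.coeff s)]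
  refine Finset.sum_congr rfl fun q _ => ?_
  rw [coeff_C_mul, coeff_map, coeff_applyCoeff, mul_comm, ← Algebra.smul_def]
  rfl

theorem applyCoeff_C_mul (φ : A →ₗ[ℝ] ℝ) (a : A) (F : DiffPoly N n A) :
    applyCoeff φ (C a * F) = applyCoeff (φ ∘ₗ LinearMap.mulLeft ℝ a) F := by
  ext s
  rw [coeff_applyCoeff, coeff_applyCoeff, coeff_C_mul]
  rfl

theorem applyCoeff_map_mul (φ : A →ₗ[ℝ] ℝ) (f : DiffPoly N n ℝ) (F : DiffPoly N n A) :
    applyCoeff φ (map (algebraMap ℝ A) f * F) = f * applyCoeff φ F := by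
  induction F using valued_induction with
  | hadd F G hF hG => rw [mul_add, applyCoeff_add, hF, hG, applyCoeff_add, mul_add]
  | h a g =>
    rw [mul_left_comm, ← map_mul, applyCoeff_C_mul_map, applyCoeff_C_mul_map, mul_smul_comm]

theorem applyCoeff_mul (φ : A →ₗ[ℝ] ℝ) (F G : DiffPoly N n A) :
    applyCoeff φ (F * G) =
      ∑ q, applyCoeff (b.coord q) F * applyCoeff φ (C (b q) * G) := by
  conv_lhs => rw [← sum_C_mul_map_coord b F]
  rw [Finset.sum_mul, applyCoeff_sum]
  refine Finset.sum_congr rfl fun q _ => ?_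
  rw [mul_comm (C (b q)), mul_assoc, applyCoeff_map_mul]

/-! ### Dual bases -/

theorem eq_zero_of_forall_basis {ω : A →ₗ[ℝ] ℝ} (hω : IsTraceForm ω) {a : A}
    (h : ∀ q, ω (b q * a) = 0) : a = 0 := by
  refine hω a fun x => ?_
  have : ω ∘ₗ LinearMap.mulRight ℝ a = 0 := b.ext fun q => h q
  rw [mul_comm]
  exact LinearMap.congr_fun this x

/-- A kernel vector of the Gram matrix would give a nonzero element orthogonal to all of `A`. Hence
the determinant is a unit, and the matrix inverse inside `dualVec` is genuine. -/
theorem dualVec_mul {ω : A →ₗ[ℝ] ℝ} (hω : IsTraceForm ω) (p q : Fin n) :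
    ω (b p * dualVec b ω q) = if p = q then 1 else 0 := by
  let G : Matrix (Fin n) (Fin n) ℝ := Matrix.of fun p p' => ω (b p * b p')
  have hG : IsUnit G.det := by
    rw [isUnit_iff_ne_zero]
    intro h0
    obtain ⟨v, hv0, hv⟩ := Matrix.exists_mulVec_eq_zero_iff.mpr h0
    have : ∑ q, v q • b q = 0 := by
      refine eq_zero_of_forall_basis b hω fun p => ?_
      have := congrFun hv p
      rw [Matrix.mulVec, dotProduct] at this
      rw [Finset.mul_sum, map_sum]
      refine (Finset.sum_congr rfl fun q _ => ?_).trans this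
      rw [mul_smul_comm, map_smul, smul_eq_mul, mul_comm]
      rfl
    exact hv0 (funext fun q => Fintype.linearIndependent_iff.mp b.linearIndependent v this q)
  have h := congrFun (congrFun (Matrix.nonsing_inv_mul G hG) q) p
  rw [Matrix.mul_apply, Matrix.one_apply] at h
  rw [dualVec, Finset.mul_sum, map_sum]
  simp only [eq_comm (a := p), ← h]
  refine Finset.sum_congr rfl fun r _ => ?_
  rw [mul_smul_comm, map_smul, smul_eq_mul, mul_comm (b p)]
  rfl

theorem applyCoeff_basis_mul_valuedVarDeriv {ω : A →ₗ[ℝ] ℝ} (hω : IsTraceForm ω)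
    (f : DiffPoly N n ℝ) (i : Set.Iic N) (q : Fin n) :
    applyCoeff ω (C (b q) * valuedVarDeriv b ω f i) = varDeriv f (i, q) := by
  rw [valuedVarDeriv, Finset.mul_sum, applyCoeff_sum, Finset.sum_eq_single q]
  · rw [← mul_assoc, ← map_mul, applyCoeff_C_mul_map, dualVec_mul b hω, if_pos rfl, one_smul]
  · intro p _ hp
    rw [← mul_assoc, ← map_mul, applyCoeff_C_mul_map, dualVec_mul b hω, if_neg hp.symm, zero_smul]
  · simp

theorem eq_zero_of_applyCoeff {ω : A →ₗ[ℝ] ℝ} (hω : IsTraceForm ω) {F : DiffPoly N n A}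
    (h : ∀ q, applyCoeff ω (C (b q) * F) = 0) : F = 0 := by
  ext s
  rw [coeff_zero]
  refine eq_zero_of_forall_basis b hω fun q => ?_
  rw [← coeff_C_mul, ← coeff_applyCoeff, h, coeff_zero]

/-! ### Operators with algebra-valued coefficients -/

/-- The action of an evolutionary vector field on operators. -/
noncomputable def evolOp (A : Type) [CommRing A] [Algebra ℝ A] (c : Comp N n → DiffPoly N n ℝ) :
    PDO (dx N n A) →+ PDO (dx N n A) :=
  PDO.mapCoeff (evol N n A c : DiffPoly N n A →+ DiffPoly N n A)

theorem evolOp_val (c : Comp N n → DiffPoly N n ℝ) (P : PDO (dx N n A)) (k : ℤ) :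
    (evolOp A c P).val k = evol N n A c (P.val k) := rfl

theorem evolOp_mul (c : Comp N n → DiffPoly N n ℝ) (P Q : PDO (dx N n A)) :
    evolOp A c (P * Q) = evolOp A c P * Q + P * evolOp A c Q :=
  PDO.mapCoeff_mul (fun s => evol_dx c s)
    (fun x y => by
      change evol N n A c (x * y) = evol N n A c x * y + x * evol N n A c y
      rw [Derivation.leibniz, smul_eq_mul, smul_eq_mul]; ring) P Q

theorem evolOp_posPart (c : Comp N n → DiffPoly N n ℝ) (P : PDO (dx N n A)) :
    evolOp A c (PDO.posPart _ P) = PDO.posPart _ (evolOp A c P) := PDO.mapCoeff_posPart _ P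

theorem evolOp_monom (c : Comp N n → DiffPoly N n ℝ) (i : ℤ) (x : DiffPoly N n A) :
    evolOp A c (PDO.monom _ i x) = PDO.monom _ i (evol N n A c x) := by
  ext1 k
  rw [evolOp_val, PDO.monom_val_apply, PDO.monom_val_apply]
  split_ifs
  · rfl
  · exact map_zero _

/-- The functional `∫ tr res P dx`. -/
noncomputable def trRes (ω : A →ₗ[ℝ] ℝ) : PDO (dx N n A) →+ Functional N n :=
  (((integralₗ N n).comp (applyCoeffₗ ω)).toAddMonoidHom).comp (PDO.coeff (-1))

theorem trRes_apply (ω : A →ₗ[ℝ] ℝ) (P : PDO (dx N n A)) :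
    trRes ω P = integral (applyCoeff ω (P.val (-1))) := rfl

theorem trRes_mul_comm (ω : A →ₗ[ℝ] ℝ) (P Q : PDO (dx N n A)) :
    trRes ω (P * Q) = trRes ω (Q * P) :=
  PDO.res_mul_comm (((integralₗ N n).comp (applyCoeffₗ ω)).toAddMonoidHom)
    (fun s => by
      change integral (applyCoeff ω (dx N n A s)) = 0
      rw [applyCoeff_dx, integral_dx]) P Q

theorem trRes_eq_zero_of_ordLE (ω : A →ₗ[ℝ] ℝ) {P : PDO (dx N n A)} {a : ℤ}
    (h : OrdLE P.val a) (ha : a < -1) : trRes ω P = 0 := by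
  rw [trRes_apply, h (-1) ha, applyCoeff_zero, integral_zero]

theorem trRes_eq_zero_of_isDiff (ω : A →ₗ[ℝ] ℝ) {P : PDO (dx N n A)} (h : PDO.IsDiff P) :
    trRes ω P = 0 := by
  rw [trRes_apply, h (-1) (by omega), applyCoeff_zero, integral_zero]

/-- The scalar components of a covector. -/
noncomputable def coComponents (ω : A →ₗ[ℝ] ℝ) (Y : PDO (dx N n A)) :
    Comp N n → DiffPoly N n ℝ :=
  fun α => applyCoeff ω (C (b α.2) * PDO.rightCoeff Y α.1)

/-- Left coefficients of a vector field meet right coefficients of a covector in the residue without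
further derivatives. This is an exact identity of densities, before integration. -/
theorem applyCoeff_res_mul (ω : A →ₗ[ℝ] ℝ) {P : PDO (dx N n A)} (hP : OrdLE P.val N)
    (Y : PDO (dx N n A)) :
    applyCoeff ω ((P * Y).val (-1)) =
      ∑ᶠ α, components b P.val α * coComponents b ω Y α := by
  classical
  obtain ⟨a, ha⟩ := Y.exists_ordLE
  let s : Finset (Comp N n) :=
    ((Finset.Ioc (-a - 2) N).subtype (· ∈ Set.Iic N)) ×ˢ Finset.univ
  have hs : (Function.support fun α => components b P.val α * coComponents b ω Y α) ⊆ ↑s := by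
    intro α hα
    by_contra h
    refine hα ?_
    have h1 : α.1.1 ≤ -a - 2 := by
      by_contra h2
      refine h ?_
      simp only [s, Finset.coe_product, Set.mem_prod, Finset.mem_coe, Finset.mem_subtype,
        Finset.mem_Ioc, Finset.mem_univ, and_true]
      exact ⟨by omega, α.1.2⟩
    beta_reduce
    rw [coComponents, PDO.rightCoeff_eq_zero ha (by omega), mul_zero, applyCoeff_zero, mul_zero]
  rw [finsum_eq_sum_of_support_subset _ hs, PDO.res_mul hP ha (K := -a - 2) (by omega),
    applyCoeff_sum, Finset.sum_product,
    ← Finset.sum_subtype_of_mem (p := (· ∈ Set.Iic N))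
      (fun i => applyCoeff ω (P.val i * PDO.rightCoeff Y i))
      (fun i hi => (Finset.mem_Ioc.mp hi).2)]
  refine Finset.sum_congr rfl fun i _ => ?_
  rw [applyCoeff_mul b]
  rfl

theorem coComponents_sub (ω : A →ₗ[ℝ] ℝ) (Y Z : PDO (dx N n A)) (α : Comp N n) :
    coComponents b ω (Y - Z) α = coComponents b ω Y α - coComponents b ω Z α := by
  rw [coComponents, PDO.rightCoeff_sub, mul_sub, applyCoeff_sub]
  rfl

theorem coComponents_evolOp (ω : A →ₗ[ℝ] ℝ) (c : Comp N n → DiffPoly N n ℝ)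
    (Y : PDO (dx N n A)) (α : Comp N n) :
    coComponents b ω (evolOp A c Y) α = evol N n ℝ c (coComponents b ω Y α) := by
  have h : evolOp A c (PDO.monom _ α.1 1 * Y) = PDO.monom _ α.1 1 * evolOp A c Y := by
    rw [evolOp_mul, evolOp_monom, Derivation.map_one_eq_zero, map_zero, zero_mul, zero_add]
  rw [coComponents, PDO.rightCoeff, ← h, evolOp_val, ← evol_C_mul, applyCoeff_evol]
  rfl

theorem ordLE_of_coComponents {ω : A →ₗ[ℝ] ℝ} (hω : IsTraceForm ω) {Y : PDO (dx N n A)}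
    (h : ∀ α, coComponents b ω Y α = 0) : OrdLE Y.val (-N - 2) :=
  PDO.ordLE_of_rightCoeff fun i hi =>
    eq_zero_of_applyCoeff b hω fun q => h (⟨i, hi⟩, q)

/-- The vector field on operators with given scalar components. -/
noncomputable def vectorOp (c : Comp N n → DiffPoly N n ℝ) : PDO (dx N n A) where
  val k := if h : k ≤ N then ∑ q, C (b q) * map (algebraMap ℝ A) (c (⟨k, h⟩, q)) else 0
  exists_ordLE := ⟨N, fun _ hk => dif_neg (not_le.mpr hk)⟩

theorem ordLE_vectorOp (c : Comp N n → DiffPoly N n ℝ) : OrdLE (vectorOp b c).val N :=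
  fun _ hk => dif_neg (not_le.mpr hk)

theorem vectorOp_components {P : PDO (dx N n A)} (hP : OrdLE P.val N) :
    vectorOp b (components b P.val) = P := by
  ext1 k
  by_cases hk : k ≤ N
  · exact (dif_pos hk).trans (sum_C_mul_map_coord b (P.val k))
  · rw [hP k (not_le.mp hk)]
    exact dif_neg hk

theorem components_vectorOp (c : Comp N n → DiffPoly N n ℝ) :
    components b (vectorOp b c).val = c := by
  funext ⟨i, p⟩
  have h : (vectorOp b c).val i = ∑ q, C (b q) * map (algebraMap ℝ A) (c (i, q)) := dif_pos i.2
  rw [components, h, applyCoeff_sum, Finset.sum_eq_single p]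
  · rw [applyCoeff_C_mul_map]
    simp
  · intro q _ hq
    rw [applyCoeff_C_mul_map]
    simp [hq]
  · simp

theorem evol_field (c : Comp N n → DiffPoly N n ℝ) (i : Set.Iic N) :
    evol N n A c (field b i 0) = (vectorOp b c).val i := by
  have h : (vectorOp b c).val i = ∑ q, C (b q) * map (algebraMap ℝ A) (c (i, q)) := dif_pos i.2
  rw [h, field, map_sum]
  refine Finset.sum_congr rfl fun q _ => ?_
  rw [evol_C_mul, evol, mkDerivation_X]
  rfl

end Valued

end FrobeniusKP

namespace FrobeniusKP

open MvPolynomial PsiDO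

/-! ### The quadratic Adler bracket in a ring with a trace and a splitting -/

section Abstract

variable {Q V : Type*} [Ring Q] [AddCommGroup V]

/-- A trace on a ring that vanishes on products within either half of a splitting
`x = p x + (x - p x)`. -/
structure IsSplitTrace (p : Q →+ Q) (τ : Q →+ V) : Prop where
  comm : ∀ x y, τ (x * y) = τ (y * x)
  pos₂ : ∀ x y, τ (p x * p y) = 0
  neg₂ : ∀ x y, τ ((x - p x) * (y - p y)) = 0
  pos₃ : ∀ x y z, τ (p x * p y * p z) = 0
  neg₃ : ∀ x y z, τ ((x - p x) * (y - p y) * (z - p z)) = 0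

/-- The Adler map `X ↦ (M X)_+ M - M (X M)_+`. -/
def adler (p : Q →+ Q) (M X : Q) : Q := p (M * X) * M - M * p (X * M)

/-- The derivative of `M ↦ adler p M X` in the direction `D`. -/
def adlerDeriv (p : Q →+ Q) (M D X : Q) : Q :=
  p (D * X) * M + p (M * X) * D - D * p (X * M) - M * p (X * D)

namespace IsSplitTrace

variable {p : Q →+ Q} {τ : Q →+ V} (h : IsSplitTrace p τ)

include h

theorem rot (x y z : Q) : τ (x * y * z) = τ (z * x * y) := by
  rw [h.comm, mul_assoc]

theorem pos_mul (x y : Q) : τ (p x * y) = τ (p x * (y - p y)) := by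
  rw [mul_sub, map_sub, h.pos₂, sub_zero]

theorem mul_neg (x y : Q) : τ (p x * y) = τ (x * (y - p y)) := by
  have h1 := h.neg₂ x y
  rw [sub_mul, map_sub, sub_eq_zero] at h1
  rw [h1, h.pos_mul]

/-- The two summands have the traces of `x` times the complementary part of `y` and of `x` times `p
y`. -/
theorem pos_add_pos (x y : Q) : τ (p x * y) + τ (p y * x) = τ (x * y) := by
  rw [h.mul_neg x y, h.comm (p y), ← map_add, ← mul_add, sub_add_cancel]

theorem adler_mul (M X Y : Q) :
    τ (adler p M X * Y) = τ (p (M * X) * (M * Y)) - τ (p (X * M) * (Y * M)) := by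
  rw [adler, sub_mul, map_sub, mul_assoc, mul_assoc M, h.comm M, mul_assoc]

/-- Symmetrising, `pos_add_pos` removes the projections and leaves the traces of `M X M Y` and of `X
M Y M`, which agree by cyclicity. -/
theorem adler_skew (M X Y : Q) : τ (adler p M X * Y) = -τ (adler p M Y * X) := by
  rw [eq_neg_iff_add_eq_zero, h.adler_mul, h.adler_mul]
  have h1 := h.pos_add_pos (M * X) (M * Y)
  have h2 := h.pos_add_pos (X * M) (Y * M)
  have h3 : τ (M * X * (M * Y)) = τ (X * M * (Y * M)) := by
    rw [mul_assoc, h.comm M]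
    congr 1
    noncomm_ring
  rw [h3, ← h2] at h1
  rw [← sub_eq_zero] at h1
  rw [← h1]
  abel

/-- A triple product has eight sign patterns. For `c a b`, the patterns `(+,±,-)`, `(-,+,±)`,
`(±,-,+)` form the three cyclic terms, and the remaining `+++` and `---` have trace zero; likewise
for `c b a`. -/
theorem cyclic_sum_neg_right (a b c : Q) :
    (τ (p c * a * (b - p b)) - τ (p c * b * (a - p a))) +
      (τ (p a * b * (c - p c)) - τ (p a * c * (b - p b))) +
      (τ (p b * c * (a - p a)) - τ (p b * a * (c - p c))) = τ (c * a * b) - τ (c * b * a) := by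
  rw [h.rot (p a) b, h.rot (p b) a, ← h.rot c _ (p a), ← h.rot c _ (p b)]
  have e1 : τ (p c * a * (b - p b)) + τ ((c - p c) * p a * b) + τ (c * (a - p a) * p b) =
      τ (c * a * b) := by
    have e : c * a * b = p c * a * (b - p b) + (c - p c) * p a * b + c * (a - p a) * p b +
        p c * p a * p b + (c - p c) * (a - p a) * (b - p b) := by noncomm_ring
    rw [e, map_add, map_add, map_add, map_add, h.pos₃, h.neg₃, add_zero, add_zero]
  have e2 : τ (p c * b * (a - p a)) + τ ((c - p c) * p b * a) + τ (c * (b - p b) * p a) =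
      τ (c * b * a) := by
    have e : c * b * a = p c * b * (a - p a) + (c - p c) * p b * a + c * (b - p b) * p a +
        p c * p b * p a + (c - p c) * (b - p b) * (a - p a) := by noncomm_ring
    rw [e, map_add, map_add, map_add, map_add, h.pos₃, h.neg₃, add_zero, add_zero]
  rw [← e1, ← e2]
  abel

/-- The same count with the other grouping, `(+,-,±)`, `(-,±,+)`, `(±,+,-)`. -/
theorem cyclic_sum_neg_left (a b c : Q) :
    (τ (p c * (b - p b) * a) - τ (p c * (a - p a) * b)) +
      (τ (p a * (c - p c) * b) - τ (p a * (b - p b) * c)) +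
      (τ (p b * (a - p a) * c) - τ (p b * (c - p c) * a)) = τ (c * b * a) - τ (c * a * b) := by
  rw [h.rot (p a) _ c, h.rot (p b) _ c, ← h.rot (c - p c) b, ← h.rot (c - p c) a]
  have e1 : τ (p c * (b - p b) * a) + τ ((c - p c) * b * p a) + τ (c * p b * (a - p a)) =
      τ (c * b * a) := by
    have e : c * b * a = p c * (b - p b) * a + (c - p c) * b * p a + c * p b * (a - p a) +
        p c * p b * p a + (c - p c) * (b - p b) * (a - p a) := by noncomm_ring
    rw [e, map_add, map_add, map_add, map_add, h.pos₃, h.neg₃, add_zero, add_zero]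
  have e2 : τ (p c * (a - p a) * b) + τ ((c - p c) * a * p b) + τ (c * p a * (b - p b)) =
      τ (c * a * b) := by
    have e : c * a * b = p c * (a - p a) * b + (c - p c) * a * p b + c * p a * (b - p b) +
        p c * p a * p b + (c - p c) * (a - p a) * (b - p b) := by noncomm_ring
    rw [e, map_add, map_add, map_add, map_add, h.pos₃, h.neg₃, add_zero, add_zero]
  rw [← e1, ← e2]
  abel

/-- Cyclicity brings the direction `D` to the front; moving `p` off a factor that contains `D` turns
it into the complementary projection of the other factor. -/
theorem adlerDeriv_mul (M D A B : Q) :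
    τ (adlerDeriv p M D A * B) =
      τ (D * (A * (M * B - p (M * B)) + B * p (M * A) - (B * M - p (B * M)) * A -
        p (A * M) * B)) := by
  have e1 : τ (p (D * A) * M * B) = τ (D * (A * (M * B - p (M * B)))) := by
    rw [mul_assoc, h.mul_neg, mul_assoc]
  have e2 : τ (p (M * A) * D * B) = τ (D * (B * p (M * A))) := by
    rw [mul_assoc, h.comm, mul_assoc]
  have e3 : τ (M * p (A * D) * B) = τ (D * ((B * M - p (B * M)) * A)) := by
    rw [h.rot, h.comm, h.mul_neg, mul_assoc, h.comm A, mul_assoc]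
  rw [adlerDeriv, sub_mul, sub_mul, add_mul, map_sub, map_sub, map_add, e1, e2, e3]
  simp only [mul_sub, mul_add, map_sub, map_add, mul_assoc]
  abel

/-- The first two groups have the shapes handled by `cyclic_sum_neg_right` and
`cyclic_sum_neg_left`. The last group mixes both sides of `M` and cancels by itself when summed
cyclically over `A`, `B`, `C`. -/
theorem adlerDeriv_adler (M A B C : Q) :
    τ (adlerDeriv p M (adler p M C) A * B) =
      (τ (p (M * C) * (M * A) * (M * B - p (M * B))) -
          τ (p (M * C) * (M * B) * (M * A - p (M * A)))) +
        (τ (p (C * M) * (B * M - p (B * M)) * (A * M)) -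
          τ (p (C * M) * (A * M - p (A * M)) * (B * M))) +
        (τ (p (M * C) * M * p (B * M) * A) - τ (p (M * C) * M * p (A * M) * B) +
          τ (p (M * B) * M * p (C * M) * A) - τ (p (M * A) * M * p (C * M) * B)) := by
  have cyc : ∀ Y Z W : Q, τ (M * p (C * M) * (Y * Z)) = τ (p (C * M) * Y * (Z * M)) := by
    intro Y Z _
    rw [mul_assoc, h.comm]
    congr 1
    noncomm_ring
  have t1 : τ (p (M * B) * M * p (C * M) * A) = τ (M * p (C * M) * (A * p (M * B))) := by
    rw [mul_assoc, mul_assoc, h.comm]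
    congr 1
    noncomm_ring
  have t2 : τ (p (M * A) * M * p (C * M) * B) = τ (M * p (C * M) * (B * p (M * A))) := by
    rw [mul_assoc, mul_assoc, h.comm]
    congr 1
    noncomm_ring
  have u1 : τ (p (C * M) * (B * M - p (B * M)) * (A * M)) =
      τ (M * p (C * M) * ((B * M - p (B * M)) * A)) := (cyc _ _ 0).symm
  have u2 : τ (p (C * M) * (A * M - p (A * M)) * (B * M)) =
      τ (M * p (C * M) * ((A * M - p (A * M)) * B)) := (cyc _ _ 0).symm
  rw [h.adlerDeriv_mul, t1, t2, u1, u2]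
  simp only [← map_sub, ← map_add]
  congr 1
  rw [adler]
  noncomm_ring

/-- The Jacobi identity for the Adler map. -/
theorem adler_jacobi (M A B C : Q) :
    τ (adlerDeriv p M (adler p M C) A * B) + τ (adlerDeriv p M (adler p M A) B * C) +
      τ (adlerDeriv p M (adler p M B) C * A) = 0 := by
  have h1 := h.cyclic_sum_neg_right (M * A) (M * B) (M * C)
  have h2 := h.cyclic_sum_neg_left (A * M) (B * M) (C * M)
  -- Moving the leading `M` to the end makes the right-hand sides of `h1` and `h2` opposite to each
  -- other.
  have e : ∀ X Y Z : Q, τ (M * X * (M * Y) * (M * Z)) = τ (X * M * (Y * M) * (Z * M)) := by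
    intro X Y Z
    rw [mul_assoc, mul_assoc, h.comm]
    congr 1
    noncomm_ring
  rw [e, e, ← sub_eq_zero] at h1
  rw [← sub_eq_zero] at h2
  rw [h.adlerDeriv_adler M A B C, h.adlerDeriv_adler M B C A, h.adlerDeriv_adler M C A B,
    ← add_zero (0 : V)]
  nth_rw 1 [← h1]
  rw [← h2]
  abel

end IsSplitTrace

end Abstract

/-! ### The Adler maps on pseudo-differential operators and their pencil -/

section Operators

variable {N : ℤ} {n : ℕ} {A : Type} [CommRing A] [Algebra ℝ A]

/-- A product of differential operators has no coefficient at `∂^{-1}`, and a product of at least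
two integral operators has order at most `-2`. -/
theorem isSplitTrace_trRes (ω : A →ₗ[ℝ] ℝ) :
    IsSplitTrace (PDO.posPart (dx N n A)) (trRes ω) where
  comm := trRes_mul_comm ω
  pos₂ x y := trRes_eq_zero_of_isDiff ω ((PDO.isDiff_posPart x).mul (PDO.isDiff_posPart y))
  neg₂ x y := trRes_eq_zero_of_ordLE ω
    (PDO.ordLE_mul (PDO.ordLE_negPart x) (PDO.ordLE_negPart y)) (by omega)
  pos₃ x y z := trRes_eq_zero_of_isDiff ω
    (((PDO.isDiff_posPart x).mul (PDO.isDiff_posPart y)).mul (PDO.isDiff_posPart z))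
  neg₃ x y z := trRes_eq_zero_of_ordLE ω
    (PDO.ordLE_mul (PDO.ordLE_mul (PDO.ordLE_negPart x) (PDO.ordLE_negPart y))
      (PDO.ordLE_negPart z)) (by omega)

omit [Algebra ℝ A] in
theorem adler_val (L X : PDO (dx N n A)) :
    (adler (PDO.posPart _) L X).val = adlerZero (dx N n A) L.val X.val := rfl

/-- The operator `H^{(∞)}`. -/
noncomputable def adlerInf (L X : PDO (dx N n A)) : PDO (dx N n A) :=
  let p := PDO.posPart (dx N n A)
  let u := (L - p L) * p X - p X * (L - p L)
  (u - p u) - p (p L * (X - p X) - (X - p X) * p L)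

omit [Algebra ℝ A] in
theorem adlerInf_val (L X : PDO (dx N n A)) :
    (adlerInf L X).val = adlerInfty (dx N n A) L.val X.val := rfl

variable (N n A) in
/-- The operator of multiplication by a constant. -/
noncomputable def constOp : A →+ PDO (dx N n A) :=
  (PDO.monom (dx N n A) 0).comp (C : A →+* DiffPoly N n A).toAddMonoidHom

omit [Algebra ℝ A] in
theorem constOp_mul_val (a : A) (P : PDO (dx N n A)) (k : ℤ) :
    (constOp N n A a * P).val k = C a * P.val k := PDO.monom_zero_mul_val _ _ _

omit [Algebra ℝ A] in
theorem constOp_comm (a : A) (P : PDO (dx N n A)) :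
    P * constOp N n A a = constOp N n A a * P := by
  ext1 k
  rw [constOp_mul_val]
  refine (PDO.mul_monom_of_const P 0 (derivation_C _ a) k).trans ?_
  rw [sub_zero, mul_comm]

omit [Algebra ℝ A] in
theorem posPart_constOp_mul (a : A) (P : PDO (dx N n A)) :
    PDO.posPart _ (constOp N n A a * P) = constOp N n A a * PDO.posPart _ P := by
  ext1 k
  rw [constOp_mul_val]
  by_cases hk : 0 ≤ k
  · rw [PDO.posPart_val_of_nonneg _ hk, PDO.posPart_val_of_nonneg _ hk, constOp_mul_val]
  · rw [PDO.posPart_val_of_neg _ (not_le.mp hk), PDO.posPart_val_of_neg _ (not_le.mp hk), mul_zero]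

theorem trRes_constOp_mul (ω : A →ₗ[ℝ] ℝ) (a : ℝ) (P : PDO (dx N n A)) :
    trRes ω (constOp N n A (algebraMap ℝ A a) * P) = a • trRes ω P := by
  have h : ∀ F : DiffPoly N n A, C (algebraMap ℝ A a) * F = a • F := by
    intro F
    rw [← smul_eq_C_mul, algebraMap_smul]
  rw [trRes_apply, trRes_apply, constOp_mul_val, h, ← integral_smul]
  exact congrArg integral (map_smul (applyCoeffₗ ω) a _)

omit [Algebra ℝ A] in
/-- The shift `𝓛 ↦ 𝓛 + a` generates the pencil of the two Adler maps. -/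
theorem adler_add_constOp (a : A) (L X : PDO (dx N n A)) :
    adler (PDO.posPart _) (L + constOp N n A a) X =
      adler (PDO.posPart _) L X - constOp N n A a * adlerInf L X := by
  let p := PDO.posPart (dx N n A)
  have hX := constOp_comm a X
  have hL := constOp_comm a L
  have hpX := constOp_comm a (p X)
  have hpLX := constOp_comm a (p (L * X))
  -- Two integral parts multiply to order at most `-2` and contribute nothing to the differential
  -- part.
  have e1 : p (L * (X - p X)) = p (p L * (X - p X)) := by
    rw [← sub_eq_zero, ← map_sub, ← sub_mul]
    exact PDO.posPart_eq_zero (PDO.ordLE_mul (PDO.ordLE_negPart L) (PDO.ordLE_negPart X)) (by omega)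
  have e2 : p ((X - p X) * L) = p ((X - p X) * p L) := by
    rw [← sub_eq_zero, ← map_sub, ← mul_sub]
    exact PDO.posPart_eq_zero (PDO.ordLE_mul (PDO.ordLE_negPart X) (PDO.ordLE_negPart L)) (by omega)
  have e3 : p (p L * p X) = p L * p X :=
    PDO.eq_posPart_of_isDiff ((PDO.isDiff_posPart L).mul (PDO.isDiff_posPart X))
  have e4 : p (p X * p L) = p X * p L :=
    PDO.eq_posPart_of_isDiff ((PDO.isDiff_posPart X).mul (PDO.isDiff_posPart L))
  -- The left-hand side is the coefficient linear in the shift. The quadratic terms cancel, because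
  -- the shift is central and adds the same multiple of `p X` to both differential parts.
  have key : p (L * X) - p (X * L) + p X * L - L * p X = -adlerInf L X := by
    have d1 : p (L * X) = p (L * p X) + p (L * (X - p X)) := by
      rw [← map_add, ← mul_add, add_sub_cancel]
    have d2 : p (X * L) = p (p X * L) + p ((X - p X) * L) := by
      rw [← map_add, ← add_mul, add_sub_cancel]
    rw [d1, d2, e1, e2, adlerInf]
    simp only [sub_mul, mul_sub, map_sub]
    change _ = -(L * p X - p L * p X - (p X * L - p X * p L) - (p (L * p X) - p (p L * p X) -
      (p (p X * L) - p (p X * p L))) - (p (p L * X) - p (p L * p X) -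
      (p (X * p L) - p (p X * p L))))
    rw [e3, e4]
    abel
  have s1 : p ((L + constOp N n A a) * X) = p (L * X) + constOp N n A a * p X := by
    rw [add_mul, map_add]
    exact congrArg _ (posPart_constOp_mul a X)
  have s2 : p (X * (L + constOp N n A a)) = p (X * L) + constOp N n A a * p X := by
    rw [mul_add, map_add, hX]
    exact congrArg _ (posPart_constOp_mul a X)
  have hneg : constOp N n A a * adlerInf L X =
      -(constOp N n A a * (p (L * X) - p (X * L) + p X * L - L * p X)) := by
    rw [key]
    noncomm_ring
  change p ((L + constOp N n A a) * X) * (L + constOp N n A a) -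
    (L + constOp N n A a) * p (X * (L + constOp N n A a)) = p (L * X) * L - L * p (X * L) - _
  rw [s1, s2, hneg]
  simp only [mul_add, add_mul, mul_sub]
  rw [hpLX, mul_assoc _ (p X) (constOp N n A a), hpX, ← mul_assoc L, hL]
  simp only [mul_assoc]
  abel

end Operators

end FrobeniusKP

namespace FrobeniusKP

open MvPolynomial PsiDO

section Phase

variable {n : ℕ} {A : Type} [CommRing A] [Algebra ℝ A] (b : Module.Basis (Fin n) ℝ A)
  (ω : A →ₗ[ℝ] ℝ) (m : ℕ) (reduced : Bool)

theorem top_lt : top m reduced < m := by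
  rw [top]
  split_ifs <;> omega

theorem le_top : (m : ℤ) - 2 ≤ top m reduced := by
  rw [top]
  split_ifs <;> omega

theorem top_of_reduced (h : reduced = true) : top m reduced = m - 2 := by
  rw [top, if_pos h]

theorem top_of_not_reduced (h : ¬reduced = true) : top m reduced = m - 1 := by
  rw [top, if_neg h]

/-! ### The operator `𝓛` and its shifts -/

/-- The operator `𝓛`. -/
noncomputable def laxOp : PDO (dx (top m reduced) n A) where
  val := laxPower b m (top m reduced)
  exists_ordLE := ⟨m, fun k hk => by
    have h := top_lt m reduced
    rw [laxPower, dif_neg (by omega), if_neg (by omega)]⟩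

theorem laxOp_val : (laxOp b m reduced).val = laxPower b m (top m reduced) := rfl

theorem laxOp_val_of_le {k : ℤ} (h : k ≤ top m reduced) :
    (laxOp b m reduced).val k = field b ⟨k, h⟩ 0 := dif_pos h

theorem isMonic_laxOp : PDO.IsMonic (laxOp b m reduced) m := by
  have h := top_lt m reduced
  refine ⟨fun k hk => ?_, ?_⟩
  · rw [laxOp_val, laxPower, dif_neg (by omega), if_neg (by omega)]
  · rw [laxOp_val, laxPower, dif_neg (by omega), if_pos rfl]

theorem evolOp_laxOp (c : Comp (top m reduced) n → DiffPoly (top m reduced) n ℝ) :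
    evolOp A c (laxOp b m reduced) = vectorOp b c := by
  ext1 k
  rw [evolOp_val]
  by_cases h : k ≤ top m reduced
  · rw [laxOp_val_of_le b m reduced h, evol_field]
  · rw [ordLE_vectorOp b c k (not_le.mp h), laxOp_val, laxPower, dif_neg h]
    split_ifs
    · exact Derivation.map_one_eq_zero _
    · exact map_zero _

theorem evolOp_constOp {N : ℤ} (c : Comp N n → DiffPoly N n ℝ) (a : A) :
    evolOp A c (constOp N n A a) = 0 := by
  refine (evolOp_monom c 0 _).trans ?_
  have : evol N n A c (C a) = 0 := derivation_C _ a
  exact (congrArg _ this).trans (map_zero _)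

/-- The operator `𝓛 + a`. -/
noncomputable def shiftOp (a : ℝ) : PDO (dx (top m reduced) n A) :=
  laxOp b m reduced + constOp _ n A (algebraMap ℝ A a)

theorem shiftOp_zero : shiftOp b m reduced 0 = laxOp b m reduced := by
  rw [shiftOp, map_zero, map_zero, add_zero]

theorem evolOp_shiftOp (a : ℝ) (c : Comp (top m reduced) n → DiffPoly (top m reduced) n ℝ) :
    evolOp A c (shiftOp b m reduced a) = vectorOp b c := by
  rw [shiftOp, map_add, evolOp_laxOp, evolOp_constOp, add_zero]

theorem isMonic_shiftOp (hm : 1 ≤ m) (a : ℝ) : PDO.IsMonic (shiftOp b m reduced a) m := by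
  refine ⟨(isMonic_laxOp b m reduced).1.add ((PDO.ordLE_monom 0 _).mono (by omega)), ?_⟩
  have : (constOp (top m reduced) n A (algebraMap ℝ A a)).val m = 0 :=
    PDO.ordLE_monom 0 _ _ (by omega)
  rw [shiftOp, PDO.add_val, Pi.add_apply, (isMonic_laxOp b m reduced).2, this, add_zero]

/-! ### The covectors `δf/δ𝓛` -/

variable {ω} in
theorem valuedVarDeriv_eq_zero {N : ℤ} {f : DiffPoly N n ℝ} {s : Finset (Comp N n)} {J : ℕ}
    (h : JetIn f s J) {i : Set.Iic N} (hi : ∀ q, (i, q) ∉ s) : valuedVarDeriv b ω f i = 0 :=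
  Finset.sum_eq_zero fun q _ => by rw [h.varDeriv_of_notMem (hi q), map_zero, mul_zero]

theorem exists_valuedVarDeriv_support {N : ℤ} (f : DiffPoly N n ℝ) :
    ∃ s : Finset (Set.Iic N), ∀ i ∉ s, valuedVarDeriv b ω f i = 0 := by
  classical
  obtain ⟨s, J, h⟩ := exists_jetIn f
  refine ⟨s.image Prod.fst, fun i hi => valuedVarDeriv_eq_zero b h fun q hq => hi ?_⟩
  exact Finset.mem_image.mpr ⟨(i, q), hq, rfl⟩

theorem gradient_eq_sum {N : ℤ} {f : DiffPoly N n ℝ} {s : Finset (Set.Iic N)}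
    (hs : ∀ i ∉ s, valuedVarDeriv b ω f i = 0) :
    gradient b ω f = (∑ i ∈ s, PDO.monom (dx N n A) (-i - 1) 1 *
      PDO.monom _ 0 (valuedVarDeriv b ω f i)).val := by
  have e : ∀ (i : Set.Iic N) (k : ℤ), comp (dx N n A) (dpow (-(i : ℤ) - 1))
      (fn (valuedVarDeriv b ω f i)) k = (PDO.monom (dx N n A) (-i - 1) 1 *
      PDO.monom _ 0 (valuedVarDeriv b ω f i)).val k := by
    intro i k
    rw [PDO.dpow_eq (d := dx N n A), PDO.fn_eq (d := dx N n A), PDO.mul_val]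
  ext1 k
  rw [PDO.sum_val, gradient]
  simp only [e]
  refine finsum_eq_sum_of_support_subset _ fun i hi => ?_
  by_contra h
  refine hi ?_
  beta_reduce
  rw [hs i h, map_zero, mul_zero]
  rfl

/-- The operator `∑_{i ≤ N} ∂^{-i-1} δf/δV_i`. -/
noncomputable def gradientOp {N : ℤ} (f : DiffPoly N n ℝ) : PDO (dx N n A) where
  val := gradient b ω f
  exists_ordLE := by
    obtain ⟨s, hs⟩ := exists_valuedVarDeriv_support b ω f
    rw [gradient_eq_sum b ω hs]
    exact PDO.exists_ordLE _

theorem gradientOp_eq_sum {N : ℤ} {f : DiffPoly N n ℝ} {s : Finset (Set.Iic N)}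
    (hs : ∀ i ∉ s, valuedVarDeriv b ω f i = 0) :
    gradientOp b ω f = ∑ i ∈ s, PDO.monom (dx N n A) (-i - 1) 1 *
      PDO.monom _ 0 (valuedVarDeriv b ω f i) := PDO.val_injective (gradient_eq_sum b ω hs)

omit [Algebra ℝ A] in
theorem rightCoeff_sum {N : ℤ} {ι : Type*} (s : Finset ι) (F : ι → PDO (dx N n A)) (i : ℤ) :
    PDO.rightCoeff (∑ j ∈ s, F j) i = ∑ j ∈ s, PDO.rightCoeff (F j) i := by
  rw [PDO.rightCoeff, Finset.mul_sum, PDO.sum_val]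
  rfl

theorem rightCoeff_gradientOp {N : ℤ} (f : DiffPoly N n ℝ) (i : Set.Iic N) :
    PDO.rightCoeff (gradientOp b ω f) i = valuedVarDeriv b ω f i := by
  classical
  obtain ⟨s, hs⟩ := exists_valuedVarDeriv_support b ω f
  rw [gradientOp_eq_sum b ω hs, rightCoeff_sum]
  simp only [PDO.rightCoeff_monom_mul, Subtype.coe_inj]
  rw [Finset.sum_ite_eq s i]
  split_ifs with h
  · rfl
  · exact (hs i h).symm

/-- The operator `δf/δ𝓛`. -/
noncomputable def covectorOp (f : DiffPoly (top m reduced) n ℝ) : PDO (dx (top m reduced) n A) :=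
  gradientOp b ω f + if reduced = true then
    PDO.monom _ (-m) 1 * PDO.monom _ 0 (constrained b ω m f) else 0

theorem covectorOp_val (f : DiffPoly (top m reduced) n ℝ) :
    (covectorOp b ω m reduced f).val = covector b ω m reduced f := by
  rw [covectorOp, covector, PDO.add_val]
  congr 1
  split_ifs
  · rw [PDO.mul_val, PDO.dpow_eq (d := dx (top m reduced) n A),
      PDO.fn_eq (d := dx (top m reduced) n A)]
  · rfl

/-- The constrained term sits at index `m - 1`, just above the free indices in the reduced case, so
it leaves their right coefficients untouched. -/
theorem rightCoeff_covectorOp (f : DiffPoly (top m reduced) n ℝ) (i : Set.Iic (top m reduced)) :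
    PDO.rightCoeff (covectorOp b ω m reduced f) i = valuedVarDeriv b ω f i := by
  rw [covectorOp, PDO.rightCoeff_add, rightCoeff_gradientOp]
  split_ifs with h
  · have e : (-m : ℤ) = -(m - 1 : ℤ) - 1 := by ring
    have hi : (i : ℤ) ≤ m - 2 := le_trans i.2 (top_of_reduced m reduced h).le
    rw [e, PDO.rightCoeff_monom_mul, if_neg (by omega), add_zero]
  · rw [PDO.rightCoeff, mul_zero, PDO.zero_val]
    exact add_zero _

theorem coComponents_covectorOp {ω : A →ₗ[ℝ] ℝ} (hω : IsTraceForm ω)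
    (f : DiffPoly (top m reduced) n ℝ) :
    coComponents b ω (covectorOp b ω m reduced f) = varDeriv f := by
  funext α
  rw [coComponents, rightCoeff_covectorOp, applyCoeff_basis_mul_valuedVarDeriv b hω]

/-! ### Tangency -/

variable {N : ℤ}

-- In terms of integral parts `M X M` drops out and `M (X M)_- - (M X)_- M` remains, where both
-- terms have order at most `m - 1`. Since the top coefficient is a residue of a commutator, the
-- constraint on `X_{m-1}` lowers the order once more.
omit [Algebra ℝ A] in
theorem ordLE_adler {M : PDO (dx N n A)} (hM : PDO.IsMonic M m) (X : PDO (dx N n A)) :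
    OrdLE (adler (PDO.posPart _) M X).val (m - 1) ∧
      (adler (PDO.posPart _) M X).val (m - 1) = -(M * X - X * M).val (-1) := by
  let p := PDO.posPart (dx N n A)
  have e : adler p M X = M * (X * M - p (X * M)) - (M * X - p (M * X)) * M := by
    rw [adler]
    noncomm_ring
  have h1 := PDO.ordLE_mul hM.1 (PDO.ordLE_negPart (X * M))
  have h2 := PDO.ordLE_mul (PDO.ordLE_negPart (M * X)) hM.1
  have h3 := PDO.mul_lead hM.1 (PDO.ordLE_negPart (X * M))
  have h4 := PDO.mul_lead (PDO.ordLE_negPart (M * X)) hM.1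
  have e2 : (m : ℤ) + -1 = m - 1 := by ring
  have e3 : -1 + (m : ℤ) = m - 1 := by ring
  rw [e2] at h1 h3
  rw [e3] at h2 h4
  change OrdLE (adler p M X).val (m - 1) ∧ (adler p M X).val (m - 1) = _
  rw [e]
  refine ⟨h1.sub h2, ?_⟩
  rw [PDO.sub_val, Pi.sub_apply, h3, h4, hM.2, one_mul, mul_one, PDO.sub_val, PDO.sub_val,
    Pi.sub_apply, Pi.sub_apply, PDO.posPart_val_of_neg _ (by omega),
    PDO.posPart_val_of_neg _ (by omega), PDO.sub_val, Pi.sub_apply]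
  ring

-- The terms without derivatives, at `j = i`, cancel between the two products. All others contain at
-- least one derivative, which is why the equation for `X_{m-1}` has a differential polynomial
-- solution.
omit [Algebra ℝ A] in
theorem res_comm_monom {L : PDO (dx N n A)} (hL : PDO.IsMonic L m) {i : ℤ} (hi : i < m)
    (x : DiffPoly N n A) :
    (L * (PDO.monom _ (-i - 1) 1 * PDO.monom _ 0 x) -
      PDO.monom _ (-i - 1) 1 * PDO.monom _ 0 x * L).val (-1) =
    -∑ j ∈ Finset.Icc (i + 1) m, Ring.choose (-i - 1) (j - i).toNat •
      (dx N n A)^[(j - i).toNat] (x * L.val j) := by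
  obtain ⟨l, hl⟩ := Int.le.dest hi.le
  have h1 : (L * (PDO.monom _ (-i - 1) 1 * PDO.monom _ 0 x)).val (-1) = L.val i * x := by
    rw [PDO.res_mul hL.1 (PDO.ordLE_mul (PDO.ordLE_monom _ _) (PDO.ordLE_monom _ _)) (K := i - 1)
      (by omega), Finset.sum_eq_single i]
    · rw [PDO.rightCoeff_monom_mul, if_pos rfl]
    · intro j _ hj
      rw [PDO.rightCoeff_monom_mul, if_neg hj, mul_zero]
    · intro h
      exact absurd (Finset.mem_Ioc.mpr ⟨by omega, hi.le⟩) h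
  have h2 : (PDO.monom _ (-i - 1) 1 * PDO.monom _ 0 x * L).val (-1) =
      ∑ k ∈ Finset.range l, Ring.choose (-i - 1) (k + 1) •
        (dx N n A)^[k + 1] (x * L.val (i + (k + 1))) + x * L.val i := by
    rw [mul_assoc, PDO.mul_val, PDO.monom_val,
      single_comp_apply _ _ _ (PDO.ordLE_mul (PDO.ordLE_monom 0 x) hL.1) _ (n := l + 1) (by omega),
      Finset.sum_range_succ']
    have e : ∀ k : ℕ, -1 - (-i - 1) + (k : ℤ) = i + k := fun k => by ring
    simp only [e, PDO.monom_zero_mul_val, one_mul]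
    simp
  have h3 : ∑ j ∈ Finset.Icc (i + 1) (m : ℤ), Ring.choose (-i - 1) (j - i).toNat •
      (dx N n A)^[(j - i).toNat] (x * L.val j) =
      ∑ k ∈ Finset.range l, Ring.choose (-i - 1) (k + 1) •
        (dx N n A)^[k + 1] (x * L.val (i + (k + 1))) := by
    refine Finset.sum_nbij' (fun j => (j - i - 1).toNat) (fun k => i + (k + 1)) ?_ ?_ ?_ ?_ ?_
    · intro j hj
      rw [Finset.mem_Icc] at hj
      rw [Finset.mem_range]
      omega
    · intro k hk
      rw [Finset.mem_range] at hk
      rw [Finset.mem_Icc]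
      omega
    · intro j hj
      rw [Finset.mem_Icc] at hj
      omega
    · intro k _
      omega
    · intro j hj
      rw [Finset.mem_Icc] at hj
      have e1 : (j - i).toNat = (j - i - 1).toNat + 1 := by omega
      have e2 : i + (((j - i - 1).toNat : ℤ) + 1) = j := by omega
      rw [e1, e2]
  rw [PDO.sub_val, Pi.sub_apply, h1, h2, h3]
  ring

theorem dx_real_smul (a : ℝ) (F : DiffPoly N n A) : dx N n A (a • F) = a • dx N n A F := by
  rw [← algebraMap_smul A a F, Derivation.map_smul, algebraMap_smul]

/-- The constraint on `δf/δ𝓛` in the reduced case. -/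
theorem res_comm_covectorOp (hm : 1 ≤ m) (hr : reduced = true)
    (f : DiffPoly (top m reduced) n ℝ) :
    (laxOp b m reduced * covectorOp b ω m reduced f -
      covectorOp b ω m reduced f * laxOp b m reduced).val (-1) = 0 := by
  obtain ⟨s, hs⟩ := exists_valuedVarDeriv_support b ω f
  have htop := top_lt m reduced
  have hL := isMonic_laxOp b m reduced
  have e : laxOp b m reduced * covectorOp b ω m reduced f -
      covectorOp b ω m reduced f * laxOp b m reduced =
      ∑ i ∈ s, (laxOp b m reduced * (PDO.monom _ (-i - 1) 1 *
          PDO.monom _ 0 (valuedVarDeriv b ω f i)) -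
        PDO.monom _ (-i - 1) 1 * PDO.monom _ 0 (valuedVarDeriv b ω f i) * laxOp b m reduced) +
      (laxOp b m reduced * (PDO.monom _ (-(m - 1 : ℤ) - 1) 1 *
          PDO.monom _ 0 (constrained b ω m f)) -
        PDO.monom _ (-(m - 1 : ℤ) - 1) 1 * PDO.monom _ 0 (constrained b ω m f) *
          laxOp b m reduced) := by
    have e1 : -(m - 1 : ℤ) - 1 = -m := by ring
    rw [covectorOp, if_pos hr, gradientOp_eq_sum b ω hs, e1, Finset.sum_sub_distrib, mul_add,
      add_mul, Finset.mul_sum, Finset.sum_mul]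
    abel
  have hcon : constrained b ω m f = (1 / (m : ℝ)) • ∑ i ∈ s,
      ∑ j ∈ Finset.Icc ((i : ℤ) + 1) m, Ring.choose (-(i : ℤ) - 1) (j - (i : ℤ)).toNat •
      (dx _ n A)^[(j - (i : ℤ) - 1).toNat] (valuedVarDeriv b ω f i * laxPower b m _ j) := by
    rw [constrained]
    congr 1
    refine finsum_eq_sum_of_support_subset _ fun i hi => ?_
    by_contra h
    refine hi (Finset.sum_eq_zero fun j _ => ?_)
    rw [hs i h, zero_mul, iterate_derivation_zero, smul_zero]
  -- The index `m - 1` contributes only one derivative of `X_{m-1}`, with binomial coefficient `-m`;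
  -- this is the origin of the factor `1 / m` in `constrained`.
  have hlast : ∑ j ∈ Finset.Icc ((m - 1 : ℤ) + 1) m, Ring.choose (-(m - 1 : ℤ) - 1)
      (j - (m - 1 : ℤ)).toNat • (dx _ n A)^[(j - (m - 1 : ℤ)).toNat]
        (constrained b ω m f * (laxOp b m reduced).val j) =
      -((m : ℝ) • dx _ n A (constrained b ω m f)) := by
    have e1 : (m - 1 : ℤ) + 1 = m := by ring
    have e2 : ((m : ℤ) - (m - 1)).toNat = 1 := by omega
    rw [e1, Finset.Icc_self, Finset.sum_singleton, e2, Ring.choose_one_right, hL.2, mul_one,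
      Function.iterate_one]
    have e3 : -((m : ℤ) - 1) - 1 = -(m : ℤ) := by ring
    rw [e3, neg_smul, Nat.cast_smul_eq_nsmul ℝ m, natCast_zsmul]
  have hd : (m : ℝ) • dx _ n A (constrained b ω m f) = ∑ i ∈ s,
      ∑ j ∈ Finset.Icc ((i : ℤ) + 1) m, Ring.choose (-(i : ℤ) - 1) (j - (i : ℤ)).toNat •
      (dx _ n A)^[(j - (i : ℤ)).toNat] (valuedVarDeriv b ω f i * (laxOp b m reduced).val j) := by
    rw [hcon, dx_real_smul, smul_smul, mul_one_div_cancel (by positivity), one_smul,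
      map_sum]
    refine Finset.sum_congr rfl fun i _ => ?_
    rw [map_sum]
    refine Finset.sum_congr rfl fun j hj => ?_
    rw [Finset.mem_Icc] at hj
    have e1 : (j - (i : ℤ)).toNat = (j - (i : ℤ) - 1).toNat + 1 := by omega
    rw [map_zsmul, ← Function.iterate_succ_apply' (dx _ n A), ← Nat.succ_eq_add_one] at *
    rw [e1]
    rfl
  rw [e, PDO.add_val, Pi.add_apply, PDO.sum_val, res_comm_monom m hL (by omega), hlast, hd,
    neg_neg, ← Finset.sum_add_distrib]
  refine Finset.sum_eq_zero fun i _ => ?_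
  have hi : (i : ℤ) ≤ top m reduced := i.2
  rw [res_comm_monom m hL (by omega), neg_add_cancel]

/-- The Adler maps send covectors to vector fields on the phase space. -/
theorem ordLE_adler_covectorOp (hm : 1 ≤ m) (a : ℝ) (f : DiffPoly (top m reduced) n ℝ) :
    OrdLE (adler (PDO.posPart _) (shiftOp b m reduced a) (covectorOp b ω m reduced f)).val
      (top m reduced) := by
  obtain ⟨h1, h2⟩ := ordLE_adler m (isMonic_shiftOp b m reduced hm a) (covectorOp b ω m reduced f)
  by_cases hr : reduced = true
  -- The shift is central, so it does not alter the commutator whose residue the constraint kills.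
  · have h3 := PDO.ordLE_pred h1 (by
      rw [h2, neg_eq_zero, ← res_comm_covectorOp b ω m reduced hm hr f]
      congr 1
      rw [shiftOp, add_mul, mul_add, constOp_comm, add_sub_add_right_eq_sub])
    have ht := top_of_reduced m reduced hr
    exact h3.mono (by omega)
  · exact h1.mono (top_of_not_reduced m reduced hr).ge

/-- The slope of the pencil is recovered from the shifts `0` and `1`, so tangency, skew-symmetry and
locality pass from `adler` to `adlerInf`. -/
theorem adlerInf_eq (X : PDO (dx (top m reduced) n A)) :
    adlerInf (laxOp b m reduced) X = adler (PDO.posPart _) (laxOp b m reduced) X -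
      adler (PDO.posPart _) (shiftOp b m reduced 1) X := by
  have h1 : constOp (top m reduced) n A (algebraMap ℝ A 1) = 1 := by
    rw [map_one, constOp, AddMonoidHom.comp_apply]
    exact congrArg _ (map_one C)
  rw [shiftOp, adler_add_constOp, h1, one_mul]
  abel

theorem ordLE_adlerInf_covectorOp (hm : 1 ≤ m) (f : DiffPoly (top m reduced) n ℝ) :
    OrdLE (adlerInf (laxOp b m reduced) (covectorOp b ω m reduced f)).val (top m reduced) := by
  rw [adlerInf_eq]
  have h := ordLE_adler_covectorOp b ω m reduced hm 0 f
  rw [shiftOp_zero] at h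
  exact h.sub (ordLE_adler_covectorOp b ω m reduced hm 1 f)

end Phase

end FrobeniusKP

namespace FrobeniusKP

open MvPolynomial PsiDO

/-! ### The brackets -/

/-- Skew-symmetry and the Jacobi identity for a pencil of brackets follow from those for
three of its members. -/
theorem isPoisson_pencil {N : ℤ} {B₀ B₁ : Bracket N n} (h0 : IsPoisson B₀)
    (h1 : IsPoisson (B₀ - B₁)) (h2 : IsPoisson (B₀ + B₁)) (s t : ℝ) :
    IsPoisson (s • B₀ + t • B₁) := by
  have hs1 : ∀ F G, B₁ F G = -B₁ G F := by
    intro F G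
    have e0 := h0.skew F G
    have e1 := h2.skew F G
    simp only [LinearMap.add_apply] at e1
    rw [e0, neg_add] at e1
    exact add_left_cancel e1
  refine ⟨fun F G => ?_, fun F G H => ?_⟩
  · simp only [LinearMap.add_apply, LinearMap.smul_apply]
    rw [h0.skew F G, hs1 F G]
    module
  · have e0 := h0.jacobi F G H
    have e1 := h1.jacobi F G H
    have e2 := h2.jacobi F G H
    simp only [LinearMap.add_apply, LinearMap.sub_apply, map_add, map_sub] at e1 e2
    -- The Jacobi sum is a quadratic form in `(s, t)`. The three weights interpolate it from its
    -- values at `(1, 0)`, `(1, -1)` and `(1, 1)`.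
    have key : (s • B₀ + t • B₁) ((s • B₀ + t • B₁) F G) H +
        (s • B₀ + t • B₁) ((s • B₀ + t • B₁) G H) F +
        (s • B₀ + t • B₁) ((s • B₀ + t • B₁) H F) G =
        (s ^ 2 - t ^ 2) • (0 : Functional N n) + ((t ^ 2 - s * t) / 2) • (0 : Functional N n) +
          ((t ^ 2 + s * t) / 2) • (0 : Functional N n) := by
      nth_rw 1 [← e0]
      nth_rw 1 [← e1]
      rw [← e2]
      simp only [LinearMap.add_apply, LinearMap.smul_apply, map_add, map_smul]
      module
    rw [key]
    simp

section Brackets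

variable {n : ℕ} {A : Type} [CommRing A] [Algebra ℝ A] (b : Module.Basis (Fin n) ℝ A)
  {ω : A →ₗ[ℝ] ℝ} (hω : IsTraceForm ω) (m : ℕ) (reduced : Bool)

include hω

theorem applyCoeff_res_mul_covectorOp {P : PDO (dx (top m reduced) n A)}
    (hP : OrdLE P.val (top m reduced)) (g : DiffPoly (top m reduced) n ℝ) :
    applyCoeff ω ((P * covectorOp b ω m reduced g).val (-1)) =
      ∑ᶠ α, components b P.val α * varDeriv g α := by
  rw [applyCoeff_res_mul b ω hP, coComponents_covectorOp b m reduced hω]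

theorem trRes_mul_covectorOp {P : PDO (dx (top m reduced) n A)}
    (hP : OrdLE P.val (top m reduced)) (g : DiffPoly (top m reduced) n ℝ) :
    trRes ω (P * covectorOp b ω m reduced g) = integral (evol _ n ℝ (components b P.val) g) := by
  rw [trRes_apply, applyCoeff_res_mul_covectorOp b hω m reduced hP, integral_evol]

/-- A skew-symmetric map of covectors to vector fields defines a bracket on functionals. -/
theorem exists_bracket (H : PDO (dx (top m reduced) n A) → PDO (dx (top m reduced) n A))
    (htan : ∀ f, OrdLE (H (covectorOp b ω m reduced f)).val (top m reduced))
    (hskew : ∀ X Y, trRes ω (H X * Y) = -trRes ω (H Y * X)) :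
    ∃ B : Bracket (top m reduced) n, ∀ f g, B (integral f) (integral g) =
      trRes ω (H (covectorOp b ω m reduced f) * covectorOp b ω m reduced g) := by
  let c : DiffPoly (top m reduced) n ℝ → Comp (top m reduced) n → DiffPoly (top m reduced) n ℝ :=
    fun f => components b (H (covectorOp b ω m reduced f)).val
  let β₀ : DiffPoly (top m reduced) n ℝ → DiffPoly (top m reduced) n ℝ →
      Functional (top m reduced) n :=
    fun f g => trRes ω (H (covectorOp b ω m reduced f) * covectorOp b ω m reduced g)
  -- In its second argument the bracket is an evolutionary vector field, hence linear and zero on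
  -- total derivatives. Skew-symmetry carries both properties to the first argument.
  have h0 : ∀ f g, β₀ f g = integral (evol _ n ℝ (c f) g) := fun f g =>
    trRes_mul_covectorOp b hω m reduced (htan f) g
  have hadd : ∀ f g g', β₀ f (g + g') = β₀ f g + β₀ f g' := fun f g g' => by
    rw [h0, h0, h0, map_add, integral_add]
  have hsmul : ∀ (a : ℝ) f g, β₀ f (a • g) = a • β₀ f g := fun a f g => by
    rw [h0, h0, Derivation.map_smul, integral_smul]
  have hsk : ∀ f g, β₀ f g = -β₀ g f := fun f g => hskew _ _
  have hker : ∀ f g, β₀ f (dx _ n ℝ g) = 0 := fun f g => by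
    rw [h0, evol_dx, integral_dx]
  let β : DiffPoly (top m reduced) n ℝ →ₗ[ℝ] DiffPoly (top m reduced) n ℝ →ₗ[ℝ]
      Functional (top m reduced) n :=
    LinearMap.mk₂ ℝ β₀ (fun f f' g => by rw [hsk, hadd, neg_add, ← hsk, ← hsk])
      (fun a f g => by rw [hsk, hsmul, ← smul_neg, ← hsk]) hadd (fun a f g => hsmul a f g)
  have h1 : LinearMap.range (dx (top m reduced) n ℝ).toLinearMap ≤ LinearMap.ker β := by
    rintro _ ⟨f, rfl⟩
    refine LinearMap.mem_ker.mpr (LinearMap.ext fun g => ?_)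
    change β₀ (dx _ n ℝ f) g = 0
    rw [hsk, hker, neg_zero]
  let β' := (LinearMap.range (dx (top m reduced) n ℝ).toLinearMap).liftQ β h1
  have h2 : LinearMap.range (dx (top m reduced) n ℝ).toLinearMap ≤ LinearMap.ker β'.flip := by
    rintro _ ⟨g, rfl⟩
    refine LinearMap.mem_ker.mpr (LinearMap.ext fun F => ?_)
    obtain ⟨f, rfl⟩ := integral_surjective F
    exact hker f g
  exact ⟨((LinearMap.range (dx (top m reduced) n ℝ).toLinearMap).liftQ β'.flip h2).flip,
    fun f g => rfl⟩

omit hω in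
theorem derivation_adler {Q : Type*} [Ring Q] {p : Q →+ Q} (D : Q →+ Q)
    (hD : ∀ x y, D (x * y) = D x * y + x * D y) (hp : ∀ x, D (p x) = p (D x)) (M Y : Q) :
    D (adler p M Y) = adlerDeriv p M (D M) Y + adler p M (D Y) := by
  rw [adlerDeriv, adler, adler, map_sub, hD, hD, hp, hp, hD, hD, map_add, map_add]
  noncomm_ring

/-- The brackets of the shifted Adler map satisfy the Jacobi identity. -/
theorem isPoisson_of_adler (hm : 1 ≤ m) (a : ℝ) {B : Bracket (top m reduced) n}
    (hB : ∀ f g, B (integral f) (integral g) =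
      trRes ω (adler (PDO.posPart _) (shiftOp b m reduced a) (covectorOp b ω m reduced f) *
        covectorOp b ω m reduced g)) : IsPoisson B := by
  let X := covectorOp b ω m reduced
  let M := shiftOp b m reduced a
  let p := PDO.posPart (dx (top m reduced) n A)
  have hτ : IsSplitTrace p (trRes ω) := isSplitTrace_trRes ω
  have htan : ∀ f, OrdLE (adler p M (X f)).val (top m reduced) :=
    ordLE_adler_covectorOp b ω m reduced hm a
  have hskew : ∀ f g, B (integral f) (integral g) = -B (integral g) (integral f) := fun f g => by
    rw [hB, hB, hτ.adler_skew]
  let c : DiffPoly (top m reduced) n ℝ → Comp (top m reduced) n → DiffPoly (top m reduced) n ℝ :=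
    fun f => components b (adler p M (X f)).val
  have hX : ∀ f h, coComponents b ω (evolOp A (c h) (X f)) =
      fun α => evol _ n ℝ (c h) (varDeriv f α) := fun f h => by
    funext α
    rw [coComponents_evolOp, coComponents_covectorOp b m reduced hω]
  have hess : ∀ f g h, trRes ω (adler p M (X g) * evolOp A (c h) (X f)) =
      integral (∑ᶠ α, c g α * evol _ n ℝ (c h) (varDeriv f α)) := fun f g h => by
    rw [trRes_apply, applyCoeff_res_mul b ω (htan g), hX]
  have hevol : ∀ h Y, evolOp A (c h) (adler p M Y) =
      adlerDeriv p M (adler p M (X h)) Y + adler p M (evolOp A (c h) Y) := by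
    intro h Y
    have hM : evolOp A (c h) M = adler p M (X h) := by
      rw [evolOp_shiftOp, vectorOp_components b (htan h)]
    rw [derivation_adler (evolOp A (c h)) (evolOp_mul (c h)) (evolOp_posPart (c h)), hM]
  -- Differentiating the density of the inner bracket along the field of `h` gives one term from the
  -- Adler map itself and one from each of the two covectors; the latter are second variations.
  have hjac : ∀ f g h, B (integral h) (B (integral f) (integral g)) =
      trRes ω (adlerDeriv p M (adler p M (X h)) (X f) * X g) -
        integral (∑ᶠ α, c g α * evol _ n ℝ (c h) (varDeriv f α)) +
        integral (∑ᶠ α, c f α * evol _ n ℝ (c h) (varDeriv g α)) := by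
    intro f g h
    have e1 : B (integral h) (B (integral f) (integral g)) =
        trRes ω (evolOp A (c h) (adler p M (X f) * X g)) := by
      rw [hB f g, trRes_apply, hB, trRes_mul_covectorOp b hω m reduced (htan h), trRes_apply,
        evolOp_val, applyCoeff_evol]
    rw [e1, evolOp_mul, hevol, add_mul, map_add, map_add, hess, ← hess f g h,
      hτ.adler_skew M (evolOp A (c h) (X f))]
    abel
  constructor
  · intro F G
    obtain ⟨f, rfl⟩ := integral_surjective F
    obtain ⟨g, rfl⟩ := integral_surjective G
    exact hskew f g
  · intro F G K
    obtain ⟨f, rfl⟩ := integral_surjective F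
    obtain ⟨g, rfl⟩ := integral_surjective G
    obtain ⟨h, rfl⟩ := integral_surjective K
    have sk : ∀ F (f : DiffPoly (top m reduced) n ℝ), B F (integral f) = -B (integral f) F := by
      intro F f
      obtain ⟨k, rfl⟩ := integral_surjective F
      exact hskew k f
    -- In the cyclic sum the six second-variation terms cancel in pairs by the symmetry of the
    -- Hessian, and exactly this identity remains.
    have hj := hτ.adler_jacobi M (X f) (X g) (X h)
    rw [sk (B (integral f) (integral g)) h, sk (B (integral g) (integral h)) f,
      sk (B (integral h) (integral f)) g, hjac f g h, hjac g h f, hjac h f g, hessian_symm f (c h) (c g),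
      hessian_symm g (c h) (c f), hessian_symm h (c g) (c f), ← neg_eq_zero, ← hj]
    abel

end Brackets

end FrobeniusKP

namespace FrobeniusKP

open MvPolynomial PsiDO

section Pencil

variable {n : ℕ} {A : Type} [CommRing A] [Algebra ℝ A] (b : Module.Basis (Fin n) ℝ A)
  {ω : A →ₗ[ℝ] ℝ} (hω : IsTraceForm ω) (m : ℕ) (reduced : Bool)

include hω

/-- The Adler maps of `𝓛` induce two brackets on functionals, whose linear combinations are
Poisson brackets. -/
theorem exists_brackets (hm : 1 ≤ m) : ∃ B₀ B₁ : Bracket (top m reduced) n,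
    (∀ f g, B₀ (integral f) (integral g) =
      trRes ω (adler (PDO.posPart _) (laxOp b m reduced) (covectorOp b ω m reduced f) *
        covectorOp b ω m reduced g)) ∧
    (∀ f g, B₁ (integral f) (integral g) =
      trRes ω (adlerInf (laxOp b m reduced) (covectorOp b ω m reduced f) *
        covectorOp b ω m reduced g)) ∧
    ∀ s t : ℝ, IsPoisson (s • B₀ + t • B₁) := by
  have hτ : IsSplitTrace (PDO.posPart (dx (top m reduced) n A)) (trRes ω) := isSplitTrace_trRes ω
  obtain ⟨B₀, h0⟩ := exists_bracket b hω m reduced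
    (fun X => adler (PDO.posPart _) (laxOp b m reduced) X)
    (fun f => by
      have := ordLE_adler_covectorOp b ω m reduced hm 0 f
      rwa [shiftOp_zero] at this)
    (fun X Y => hτ.adler_skew _ X Y)
  obtain ⟨B₁, h1⟩ := exists_bracket b hω m reduced
    (fun X => adlerInf (laxOp b m reduced) X)
    (ordLE_adlerInf_covectorOp b ω m reduced hm)
    (fun X Y => by
      rw [adlerInf_eq, adlerInf_eq, sub_mul, sub_mul, map_sub, map_sub, hτ.adler_skew _ X Y,
        hτ.adler_skew _ X Y]
      abel)
  -- The shift by `a` realises the member `B₀ - a B₁` of the pencil; the values `0`, `1`, `-1` are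
  -- used below.
  have hshift : ∀ (a : ℝ) f g, B₀ (integral f) (integral g) - a • B₁ (integral f) (integral g) =
      trRes ω (adler (PDO.posPart _) (shiftOp b m reduced a) (covectorOp b ω m reduced f) *
        covectorOp b ω m reduced g) := by
    intro a f g
    rw [h0, h1, shiftOp, adler_add_constOp, sub_mul, map_sub, mul_assoc, trRes_constOp_mul]
  refine ⟨B₀, B₁, h0, h1, isPoisson_pencil ?_ ?_ ?_⟩
  · refine isPoisson_of_adler b hω m reduced hm 0 fun f g => ?_
    rw [← hshift, zero_smul, sub_zero]
  · refine isPoisson_of_adler b hω m reduced hm 1 fun f g => ?_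
    rw [← hshift, one_smul]
    rfl
  · refine isPoisson_of_adler b hω m reduced hm (-1) fun f g => ?_
    rw [← hshift, neg_one_smul, sub_neg_eq_add]
    rfl

end Pencil

end FrobeniusKP

namespace FrobeniusKP

open MvPolynomial PsiDO

/-! ### Locality -/

section Covector

variable {n : ℕ} {A : Type} [CommRing A] [Algebra ℝ A] (b : Module.Basis (Fin n) ℝ A)
  (ω : A →ₗ[ℝ] ℝ) (m : ℕ) (reduced : Bool)

/-- The contribution of `X_i` to the constrained coefficient `X_{m-1}`. -/
noncomputable def constraintTerm (i : ℤ) :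
    DiffPoly (top m reduced) n A →+ DiffPoly (top m reduced) n A :=
  AddMonoidHom.mk' (fun x => (1 / (m : ℝ)) • ∑ j ∈ Finset.Icc (i + 1) (m : ℤ),
    Ring.choose (-i - 1) (j - i).toNat •
      (dx _ n A)^[(j - i - 1).toNat] (x * laxPower b m (top m reduced) j)) fun x y => by
    rw [← smul_add, ← Finset.sum_add_distrib]
    congr 1
    refine Finset.sum_congr rfl fun j _ => ?_
    rw [add_mul, iterate_derivation_add, smul_add]

theorem constraintTerm_apply (i : ℤ) (x : DiffPoly (top m reduced) n A) :
    constraintTerm b m reduced i x = (1 / (m : ℝ)) • ∑ j ∈ Finset.Icc (i + 1) (m : ℤ),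
    Ring.choose (-i - 1) (j - i).toNat •
      (dx _ n A)^[(j - i - 1).toNat] (x * laxPower b m (top m reduced) j) := rfl

/-- The contribution of `X_i` to the operator `δf/δ𝓛`. -/
noncomputable def covectorTerm (i : ℤ) :
    DiffPoly (top m reduced) n A →+ PDO (dx (top m reduced) n A) :=
  (PDO.mulL (PDO.monom _ (-i - 1) 1)).comp (PDO.monom _ 0) +
    if reduced = true then (PDO.mulL (PDO.monom _ (-m) 1)).comp
      ((PDO.monom _ 0).comp (constraintTerm b m reduced i)) else 0

theorem covectorTerm_apply (i : ℤ) (x : DiffPoly (top m reduced) n A) :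
    covectorTerm b m reduced i x = PDO.monom _ (-i - 1) 1 * PDO.monom _ 0 x +
      if reduced = true then PDO.monom _ (-m) 1 * PDO.monom _ 0 (constraintTerm b m reduced i x)
        else 0 := by
  rw [covectorTerm]
  split_ifs <;> rfl

/-- Each variational derivative enters through one additive term, which includes its share of
`X_{m-1}`. Locality, closure and the change of trace form can then be checked term by term. -/
theorem covectorOp_eq_sum {f : DiffPoly (top m reduced) n ℝ}
    {s : Finset (Set.Iic (top m reduced))} (hs : ∀ i ∉ s, valuedVarDeriv b ω f i = 0) :
    covectorOp b ω m reduced f =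
      ∑ i ∈ s, covectorTerm b m reduced i (valuedVarDeriv b ω f i) := by
  have hcon : constrained b ω m f =
      ∑ i ∈ s, constraintTerm b m reduced i (valuedVarDeriv b ω f i) := by
    simp only [constraintTerm_apply]
    rw [constrained, ← Finset.smul_sum]
    congr 1
    refine finsum_eq_sum_of_support_subset _ fun i hi => ?_
    by_contra h
    refine hi (Finset.sum_eq_zero fun j _ => ?_)
    rw [hs i h, zero_mul, iterate_derivation_zero, smul_zero]
  simp only [covectorTerm_apply]
  rw [covectorOp, gradientOp_eq_sum b ω hs, Finset.sum_add_distrib]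
  congr 1
  split_ifs
  · rw [hcon, map_sum, Finset.mul_sum]
  · rw [Finset.sum_const_zero]

end Covector

/-! ### Operators depending on a scalar function through differential operators -/

section Families

variable {N : ℤ} {n : ℕ} {A : Type} [CommRing A] [Algebra ℝ A]

variable (N n A) in
/-- The `A`-valued differential operators on scalar differential polynomials. -/
noncomputable def diffOps : Submodule (DiffPoly N n A) (DiffPoly N n ℝ → DiffPoly N n A) :=
  Submodule.span _ (Set.range fun (s : ℕ) u => map (algebraMap ℝ A) ((dx N n ℝ)^[s] u))

theorem dx_comp_mem_diffOps {T : DiffPoly N n ℝ → DiffPoly N n A} (hT : T ∈ diffOps N n A) :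
    (fun u => dx N n A (T u)) ∈ diffOps N n A := by
  induction hT using Submodule.span_induction with
  | mem T hT =>
    obtain ⟨s, rfl⟩ := hT
    refine Submodule.subset_span ⟨s + 1, ?_⟩
    funext u
    beta_reduce
    rw [dx_map, Function.iterate_succ_apply']
  | zero =>
    convert zero_mem (diffOps N n A) using 1
    funext u
    exact map_zero _
  | add T T' _ _ h h' =>
    convert add_mem h h' using 1
    funext u
    exact map_add _ _ _
  | smul a T hT h =>
    convert add_mem (Submodule.smul_mem _ a h) (Submodule.smul_mem _ (dx N n A a) hT) using 1
    funext u
    change dx N n A (a * T u) = a * dx N n A (T u) + dx N n A a * T u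
    rw [Derivation.leibniz, smul_eq_mul, smul_eq_mul, mul_comm (T u)]

theorem iterate_dx_comp_mem_diffOps {T : DiffPoly N n ℝ → DiffPoly N n A}
    (hT : T ∈ diffOps N n A) (l : ℕ) : (fun u => (dx N n A)^[l] (T u)) ∈ diffOps N n A := by
  induction l with
  | zero => exact hT
  | succ l ih =>
    simp only [Function.iterate_succ_apply']
    exact dx_comp_mem_diffOps ih

theorem mul_mem_diffOps {T : DiffPoly N n ℝ → DiffPoly N n A} (hT : T ∈ diffOps N n A)
    (a : DiffPoly N n A) : (fun u => a * T u) ∈ diffOps N n A := Submodule.smul_mem _ a hT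

theorem sum_mem_diffOps {ι : Type*} (s : Finset ι) {T : ι → DiffPoly N n ℝ → DiffPoly N n A}
    (hT : ∀ i ∈ s, T i ∈ diffOps N n A) : (fun u => ∑ i ∈ s, T i u) ∈ diffOps N n A := by
  convert Submodule.sum_mem _ hT using 1
  funext u
  rw [Finset.sum_apply]

/-- The derivatives of `u` are scalar and pass through `φ`, so it is enough to apply `φ` to the
coefficients of the operator. -/
theorem exists_scalar_of_mem_diffOps {T : DiffPoly N n ℝ → DiffPoly N n A}
    (hT : T ∈ diffOps N n A) (φ : A →ₗ[ℝ] ℝ) : ∃ J : ℕ →₀ DiffPoly N n ℝ,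
      ∀ u, applyCoeff φ (T u) = J.sum fun s a => a * (dx N n ℝ)^[s] u := by
  obtain ⟨c, rfl⟩ := Finsupp.mem_span_range_iff_exists_finsupp.mp hT
  refine ⟨c.mapRange (applyCoeff φ) (applyCoeff_zero φ), fun u => ?_⟩
  rw [Finsupp.sum_mapRange_index fun s => zero_mul _, Finsupp.sum, Finsupp.sum, Finset.sum_apply,
    applyCoeff_sum]
  refine Finset.sum_congr rfl fun s _ => ?_
  rw [Pi.smul_apply, smul_eq_mul, mul_comm, applyCoeff_map_mul, mul_comm]

/-- The families of pseudo-differential operators, of bounded order, whose coefficients depend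
on a scalar differential polynomial through differential operators. -/
def IsDiffFamily (T : DiffPoly N n ℝ → PDO (dx N n A)) : Prop :=
  (∃ a, ∀ u, OrdLE (T u).val a) ∧ ∀ k, (fun u => (T u).val k) ∈ diffOps N n A

namespace IsDiffFamily

variable {T T' : DiffPoly N n ℝ → PDO (dx N n A)}

theorem add (hT : IsDiffFamily T) (hT' : IsDiffFamily T') :
    IsDiffFamily fun u => T u + T' u := by
  obtain ⟨⟨a, ha⟩, h⟩ := hT
  obtain ⟨⟨a', ha'⟩, h'⟩ := hT'
  refine ⟨⟨max a a', fun u => ?_⟩, fun k => add_mem (h k) (h' k)⟩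
  exact ((ha u).mono (le_max_left _ _)).add ((ha' u).mono (le_max_right _ _))

theorem sub (hT : IsDiffFamily T) (hT' : IsDiffFamily T') :
    IsDiffFamily fun u => T u - T' u := by
  obtain ⟨⟨a, ha⟩, h⟩ := hT
  obtain ⟨⟨a', ha'⟩, h'⟩ := hT'
  refine ⟨⟨max a a', fun u => ?_⟩, fun k => sub_mem (h k) (h' k)⟩
  exact ((ha u).mono (le_max_left _ _)).sub ((ha' u).mono (le_max_right _ _))

/-- The order bound is uniform in `u`, so each coefficient of the product is a finite sum over a
range that does not depend on `u`. -/
theorem mul_left (hT : IsDiffFamily T) (P : PDO (dx N n A)) :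
    IsDiffFamily fun u => P * T u := by
  obtain ⟨⟨a, ha⟩, h⟩ := hT
  obtain ⟨c, hc⟩ := P.exists_ordLE
  refine ⟨⟨c + a, fun u => PDO.ordLE_mul hc (ha u)⟩, fun k => ?_⟩
  have h1 := sum_mem_diffOps (Finset.Icc (k - a) c ×ˢ Finset.range ((c + a - k).toNat + 1))
    (T := fun p u => Ring.choose p.1 p.2 •
      (P.val p.1 * (dx N n A)^[p.2] ((T u).val (k - p.1 + p.2)))) fun p _ =>
    zsmul_mem (mul_mem_diffOps (iterate_dx_comp_mem_diffOps (h _) p.2) (P.val p.1)) _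
  refine (congrArg (· ∈ diffOps N n A) (funext fun u => ?_)).mpr h1
  rw [PDO.mul_val, comp_apply_eq_sum _ hc (ha u) k]

theorem mul_right (hT : IsDiffFamily T) (P : PDO (dx N n A)) :
    IsDiffFamily fun u => T u * P := by
  obtain ⟨⟨a, ha⟩, h⟩ := hT
  obtain ⟨c, hc⟩ := P.exists_ordLE
  refine ⟨⟨a + c, fun u => PDO.ordLE_mul (ha u) hc⟩, fun k => ?_⟩
  have h1 := sum_mem_diffOps (Finset.Icc (k - c) a ×ˢ Finset.range ((a + c - k).toNat + 1))
    (T := fun p u => Ring.choose p.1 p.2 •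
      ((dx N n A)^[p.2] (P.val (k - p.1 + p.2)) * (T u).val p.1)) fun p _ =>
    zsmul_mem (mul_mem_diffOps (h p.1) _) _
  refine (congrArg (· ∈ diffOps N n A) (funext fun u => ?_)).mpr h1
  rw [PDO.mul_val, comp_apply_eq_sum _ (ha u) hc k]
  exact Finset.sum_congr rfl fun p _ => by rw [mul_comm]

theorem posPart (hT : IsDiffFamily T) : IsDiffFamily fun u => PDO.posPart _ (T u) := by
  obtain ⟨⟨a, ha⟩, h⟩ := hT
  refine ⟨⟨a, fun u => PDO.ordLE_posPart (ha u)⟩, fun k => ?_⟩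
  by_cases hk : 0 ≤ k
  · simp only [PDO.posPart_val_of_nonneg _ hk]
    exact h k
  · simp only [PDO.posPart_val_of_neg _ (not_le.mp hk)]
    exact zero_mem _

theorem monom {F : DiffPoly N n ℝ → DiffPoly N n A} (hF : F ∈ diffOps N n A) (i : ℤ) :
    IsDiffFamily fun u => PDO.monom _ i (F u) := by
  refine ⟨⟨i, fun u => PDO.ordLE_monom i _⟩, fun k => ?_⟩
  simp only [PDO.monom_val_apply]
  split_ifs
  · exact hF
  · exact zero_mem _

theorem adler (hT : IsDiffFamily T) (M : PDO (dx N n A)) :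
    IsDiffFamily fun u => adler (PDO.posPart _) M (T u) :=
  ((hT.mul_left M).posPart.mul_right M).sub ((hT.mul_right M).posPart.mul_left M)

end IsDiffFamily

end Families

/-! ### Local form of the brackets -/

section Locality

variable {n : ℕ} {A : Type} [CommRing A] [Algebra ℝ A] (b : Module.Basis (Fin n) ℝ A)
  {ω : A →ₗ[ℝ] ℝ} (hω : IsTraceForm ω) (m : ℕ) (reduced : Bool)

theorem isDiffFamily_covectorTerm (i : ℤ) (a : A) : IsDiffFamily fun u =>
    covectorTerm b m reduced i (C a * map (algebraMap ℝ A) u) := by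
  have h0 : (fun u => C a * map (algebraMap ℝ A) u) ∈ diffOps (top m reduced) n A :=
    mul_mem_diffOps (Submodule.subset_span ⟨0, rfl⟩) _
  simp only [covectorTerm_apply]
  refine ((IsDiffFamily.monom h0 0).mul_left _).add ?_
  split_ifs
  · refine (IsDiffFamily.monom ?_ 0).mul_left _
    simp only [constraintTerm_apply, ← algebraMap_smul A (1 / (m : ℝ)), smul_eq_C_mul]
    refine mul_mem_diffOps (sum_mem_diffOps _ fun j _ => zsmul_mem
      (iterate_dx_comp_mem_diffOps ?_ _) _) _
    simp only [mul_comm _ (laxPower b m (top m reduced) j)]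
    exact mul_mem_diffOps h0 _
  · exact ⟨⟨0, fun u => ordLE_zero _⟩, fun k => zero_mem _⟩

-- The entry `J α β` is the `α` component of `H` applied to the covector term fed by the single
-- variational derivative at `β`. Additivity of `H` reassembles the bracket from these entries.
include hω in
theorem isLocal_of_isDiffFamily {B : Bracket (top m reduced) n}
    {H : PDO (dx (top m reduced) n A) →+ PDO (dx (top m reduced) n A)}
    (hB : ∀ f g, B (integral f) (integral g) =
      trRes ω (H (covectorOp b ω m reduced f) * covectorOp b ω m reduced g))
    (htan : ∀ f, OrdLE (H (covectorOp b ω m reduced f)).val (top m reduced))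
    (hH : ∀ T, IsDiffFamily T → IsDiffFamily fun u => H (T u)) : IsLocal B := by
  classical
  have hex : ∀ α β : Comp (top m reduced) n, ∃ J : ℕ →₀ DiffPoly (top m reduced) n ℝ, ∀ u,
      applyCoeff (b.coord α.2) ((H (covectorTerm b m reduced β.1
        (C (dualVec b ω β.2) * map (algebraMap ℝ A) u))).val α.1) =
      J.sum fun s a => a * (dx _ n ℝ)^[s] u := fun α β =>
    exists_scalar_of_mem_diffOps ((hH _ (isDiffFamily_covectorTerm b m reduced β.1 _)).2 _) _
  choose J hJ using hex
  refine ⟨J, fun f g => ?_⟩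
  rw [hB, trRes_apply, applyCoeff_res_mul_covectorOp b hω m reduced (htan f)]
  congr 1
  refine finsum_congr fun α => ?_
  obtain ⟨s, K, hs⟩ := exists_jetIn f
  have hs' : ∀ i ∉ s.image Prod.fst, valuedVarDeriv b ω f i = 0 := fun i hi =>
    valuedVarDeriv_eq_zero b hs fun q hq => hi (Finset.mem_image_of_mem Prod.fst hq)
  have e : components b (H (covectorOp b ω m reduced f)).val α =
      ∑ β ∈ s.image Prod.fst ×ˢ Finset.univ,
        (J α β).sum fun s a => a * (dx _ n ℝ)^[s] (varDeriv f β) := by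
    rw [components, covectorOp_eq_sum b ω m reduced hs', map_sum, PDO.sum_val, applyCoeff_sum,
      Finset.sum_product]
    refine Finset.sum_congr rfl fun i _ => ?_
    rw [valuedVarDeriv, map_sum, map_sum, PDO.sum_val, applyCoeff_sum]
    exact Finset.sum_congr rfl fun q _ => hJ α (i, q) _
  rw [e, finsum_eq_sum_of_support_subset (s := s.image Prod.fst ×ˢ Finset.univ), Finset.sum_mul]
  · exact Finset.sum_congr rfl fun β _ => mul_comm _ _
  · intro β hβ
    by_contra h
    refine hβ ?_
    have hβs : β ∉ s := fun hβs => h (Finset.mem_coe.mpr (Finset.mem_product.mpr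
      ⟨Finset.mem_image_of_mem _ hβs, Finset.mem_univ _⟩))
    beta_reduce
    rw [hs.varDeriv_of_notMem hβs, Finsupp.sum]
    simp

end Locality

end FrobeniusKP

namespace FrobeniusKP

open MvPolynomial PsiDO

/-! ### The functionals `∫ tr F(V) dx` -/

section Valued

variable {N : ℤ} {n : ℕ} {A : Type} [CommRing A] [Algebra ℝ A] (b : Module.Basis (Fin n) ℝ A)

theorem applyCoeff_pderiv (φ : A →ₗ[ℝ] ℝ) (v : Comp N n × ℕ) (F : DiffPoly N n A) :
    applyCoeff φ (pderiv v F) = pderiv v (applyCoeff φ F) := by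
  induction F using valued_induction with
  | hadd F G hF hG => rw [map_add, applyCoeff_add, hF, hG, applyCoeff_add, map_add]
  | h a f =>
    rw [Derivation.leibniz, derivation_C, smul_zero, add_zero, smul_eq_mul, pderiv_map,
      applyCoeff_C_mul_map, applyCoeff_C_mul_map, Derivation.map_smul]

theorem dx_field (i : Set.Iic N) (j : ℕ) :
    dx N n A (field b i j) = field b i (j + 1) := by
  rw [field, field, map_sum]
  refine Finset.sum_congr rfl fun q _ => ?_
  rw [dx_C_mul, dx_X]

theorem field_mem_valuedPoly (i : Set.Iic N) (j : ℕ) : field b i j ∈ valuedPoly b N :=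
  Algebra.subset_adjoin ⟨(i, j), rfl⟩

theorem dx_mem_valuedPoly {F : DiffPoly N n A} (hF : F ∈ valuedPoly b N) :
    dx N n A F ∈ valuedPoly b N := by
  induction hF using Algebra.adjoin_induction with
  | mem F hF =>
    obtain ⟨⟨i, j⟩, rfl⟩ := hF
    rw [dx_field]
    exact field_mem_valuedPoly b i (j + 1)
  | algebraMap a =>
    rw [Derivation.map_algebraMap]
    exact zero_mem _
  | add F G _ _ h h' =>
    rw [map_add]
    exact add_mem h h'
  | mul F G hF hG h h' =>
    rw [Derivation.leibniz]
    exact add_mem (mul_mem hF h') (mul_mem hG h)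

theorem iterate_dx_mem_valuedPoly {F : DiffPoly N n A} (hF : F ∈ valuedPoly b N) (j : ℕ) :
    (dx N n A)^[j] F ∈ valuedPoly b N := by
  induction j with
  | zero => exact hF
  | succ j ih =>
    rw [Function.iterate_succ_apply']
    exact dx_mem_valuedPoly b ih

/-- The components of `V_i` enter `F` only through `∑ v_{[i]q} e_q`, so `G` is the formal derivative
of `F` in the `A`-valued variable and does not depend on `q`. -/
theorem exists_pderiv_eq {F : DiffPoly N n A} (hF : F ∈ valuedPoly b N) (i : Set.Iic N) (j : ℕ) :
    ∃ G ∈ valuedPoly b N, ∀ q, pderiv ((i, q), j) F = C (b q) * G := by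
  classical
  induction hF using Algebra.adjoin_induction with
  | mem F hF =>
    obtain ⟨⟨i', j'⟩, rfl⟩ := hF
    refine ⟨if (i', j') = (i, j) then 1 else 0, ?_, fun q => ?_⟩
    · split_ifs
      exacts [one_mem _, zero_mem _]
    · change pderiv ((i, q), j) (field b i' j') = _
      rw [field, map_sum, Finset.sum_eq_single q]
      · rw [Derivation.leibniz, derivation_C, smul_zero, add_zero, smul_eq_mul, pderiv_X,
          Pi.single_apply]
        congr 1
        refine if_congr ?_ rfl rfl
        simp only [Prod.mk.injEq]
        tauto
      · intro q' _ hq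
        rw [Derivation.leibniz, derivation_C, smul_zero, add_zero, pderiv_X_of_ne, smul_zero]
        intro h
        exact hq (congrArg (fun v => v.1.2) h)
      · intro h
        exact absurd (Finset.mem_univ _) h
  | algebraMap a =>
    refine ⟨0, zero_mem _, fun q => ?_⟩
    rw [Derivation.map_algebraMap, mul_zero]
  | add F G _ _ h h' =>
    obtain ⟨F', hF', h⟩ := h
    obtain ⟨G', hG', h'⟩ := h'
    exact ⟨F' + G', add_mem hF' hG', fun q => by rw [map_add, h, h', mul_add]⟩
  | mul F G hF hG h h' =>
    obtain ⟨F', hF', h⟩ := h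
    obtain ⟨G', hG', h'⟩ := h'
    refine ⟨F * G' + G * F', add_mem (mul_mem hF hG') (mul_mem hG hF'), fun q => ?_⟩
    rw [Derivation.leibniz, h, h', smul_eq_mul, smul_eq_mul]
    ring

theorem valuedVarDeriv_eq_of_forall {ω : A →ₗ[ℝ] ℝ} (hω : IsTraceForm ω) {f : DiffPoly N n ℝ}
    {i : Set.Iic N} {W : DiffPoly N n A}
    (h : ∀ q, varDeriv f (i, q) = applyCoeff ω (C (b q) * W)) : valuedVarDeriv b ω f i = W := by
  rw [← sub_eq_zero]
  refine eq_zero_of_applyCoeff b hω fun q => ?_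
  rw [mul_sub, applyCoeff_sub, applyCoeff_basis_mul_valuedVarDeriv b hω, h, sub_self]

/-- With `G j` the formal `A`-valued partial derivatives of `F`, the variational derivative of `tr
F` is `∑ (-∂)^j (G j)`, a formula that does not leave `valuedPoly`. -/
theorem valuedVarDeriv_mem_valuedPoly {ω : A →ₗ[ℝ] ℝ} (hω : IsTraceForm ω) {F : DiffPoly N n A}
    (hF : F ∈ valuedPoly b N) (i : Set.Iic N) :
    valuedVarDeriv b ω (applyCoeff ω F) i ∈ valuedPoly b N := by
  choose G hG h using exists_pderiv_eq b hF i
  obtain ⟨s, J, hJ⟩ := exists_jetIn (applyCoeff ω F)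
  have hiter : ∀ (j : ℕ) (P : DiffPoly N n A), applyCoeff ω ((dx N n A)^[j] P) =
      (dx N n ℝ)^[j] (applyCoeff ω P) := by
    intro j P
    induction j with
    | zero => rfl
    | succ j ih => rw [Function.iterate_succ_apply', Function.iterate_succ_apply', applyCoeff_dx, ih]
  have hC : ∀ (j : ℕ) (a : A) (P : DiffPoly N n A), (dx N n A)^[j] (C a * P) =
      C a * (dx N n A)^[j] P := by
    intro j a P
    induction j with
    | zero => rfl
    | succ j ih => rw [Function.iterate_succ_apply', Function.iterate_succ_apply', ih, dx_C_mul]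
  rw [valuedVarDeriv_eq_of_forall b hω
    (W := ∑ j ∈ Finset.range J, ((-1 : ℤ) ^ j) • (dx N n A)^[j] (G j))]
  · exact sum_mem fun j _ => zsmul_mem (iterate_dx_mem_valuedPoly b (hG j) j) _
  · intro q
    rw [hJ.varDeriv_eq_sum, Finset.mul_sum, applyCoeff_sum]
    refine Finset.sum_congr rfl fun j _ => ?_
    rw [← applyCoeff_pderiv, h, ← hiter, hC, mul_smul_comm]
    refine Eq.trans ?_ (map_zsmul (applyCoeffₗ ω) _ _).symm
    rw [zsmul_eq_mul]
    push_cast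
    rfl

/-! ### Operators with coefficients in `valuedPoly` -/

/-- The coefficients of the operator are differential polynomials in the fields `V_i`. -/
def IsValued (P : PDO (dx N n A)) : Prop := ∀ k, P.val k ∈ valuedPoly b N

namespace IsValued

variable {b} {P Q : PDO (dx N n A)}

theorem add (hP : IsValued b P) (hQ : IsValued b Q) : IsValued b (P + Q) :=
  fun k => add_mem (hP k) (hQ k)

theorem sub (hP : IsValued b P) (hQ : IsValued b Q) : IsValued b (P - Q) :=
  fun k => sub_mem (hP k) (hQ k)

theorem sum {ι : Type*} {s : Finset ι} {F : ι → PDO (dx N n A)}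
    (h : ∀ i ∈ s, IsValued b (F i)) : IsValued b (∑ i ∈ s, F i) := fun k => by
  rw [PDO.sum_val]
  exact sum_mem fun i hi => h i hi k

theorem mul (hP : IsValued b P) (hQ : IsValued b Q) : IsValued b (P * Q) := fun k => by
  obtain ⟨a, ha⟩ := P.exists_ordLE
  obtain ⟨c, hc⟩ := Q.exists_ordLE
  rw [PDO.mul_val, comp_apply_eq_sum _ ha hc]
  exact sum_mem fun p _ => zsmul_mem (mul_mem (hP _) (iterate_dx_mem_valuedPoly b (hQ _) _)) _

theorem monom {x : DiffPoly N n A} (hx : x ∈ valuedPoly b N) (i : ℤ) :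
    IsValued b (PDO.monom _ i x) := fun k => by
  rw [PDO.monom_val_apply]
  split_ifs
  exacts [hx, zero_mem _]

theorem posPart (hP : IsValued b P) : IsValued b (PDO.posPart _ P) := fun k => by
  by_cases hk : 0 ≤ k
  · rw [PDO.posPart_val_of_nonneg _ hk]
    exact hP k
  · rw [PDO.posPart_val_of_neg _ (not_le.mp hk)]
    exact zero_mem _

theorem adler (hP : IsValued b P) (hQ : IsValued b Q) :
    IsValued b (adler (PDO.posPart _) P Q) :=
  ((hP.mul hQ).posPart.mul hP).sub (hP.mul (hQ.mul hP).posPart)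

theorem adlerInf (hP : IsValued b P) (hQ : IsValued b Q) : IsValued b (adlerInf P Q) := by
  have h1 := hP.sub hP.posPart
  have h2 := hQ.posPart
  have h3 := (h1.mul h2).sub (h2.mul h1)
  have h4 := hP.posPart
  have h5 := hQ.sub hQ.posPart
  exact (h3.sub h3.posPart).sub ((h4.mul h5).sub (h5.mul h4)).posPart

end IsValued

end Valued

/-! ### Covectors of the functionals `∫ tr F(V) dx` -/

section Closed

variable {n : ℕ} {A : Type} [CommRing A] [Algebra ℝ A] (b : Module.Basis (Fin n) ℝ A)
  (m : ℕ) (reduced : Bool)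

theorem isValued_laxOp : IsValued b (laxOp b m reduced) := fun k => by
  rw [laxOp_val, laxPower]
  split_ifs
  exacts [field_mem_valuedPoly b _ _, one_mem _, zero_mem _]

theorem isValued_covectorOp {ω : A →ₗ[ℝ] ℝ} (hω : IsTraceForm ω)
    {F : DiffPoly (top m reduced) n A} (hF : F ∈ valuedPoly b (top m reduced)) :
    IsValued b (covectorOp b ω m reduced (applyCoeff ω F)) := by
  obtain ⟨s, hs⟩ := exists_valuedVarDeriv_support b ω (applyCoeff ω F)
  rw [covectorOp_eq_sum b ω m reduced hs]
  refine IsValued.sum fun i _ => ?_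
  have h := valuedVarDeriv_mem_valuedPoly b hω hF i
  rw [covectorTerm_apply]
  refine ((IsValued.monom (one_mem _) _).mul (IsValued.monom h 0)).add ?_
  split_ifs
  · refine (IsValued.monom (one_mem _) _).mul (IsValued.monom ?_ 0)
    rw [constraintTerm_apply, ← algebraMap_smul A]
    refine Subalgebra.smul_mem _ (sum_mem fun j _ => zsmul_mem (iterate_dx_mem_valuedPoly b
      (mul_mem h (isValued_laxOp b m reduced j)) _) _) _
  · exact fun k => zero_mem _

end Closed

end FrobeniusKP

namespace FrobeniusKP

open MvPolynomial PsiDO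

/-! ### Variation of traces of powers -/

section Cyclic

variable {Q V : Type*} [Ring Q] [AddCommGroup V]

/-- A cyclic form on the derivative of a power. -/
theorem trace_mul_derivation_pow {τ : Q →+ V} (hτ : ∀ x y, τ (x * y) = τ (y * x)) {D : Q →+ Q}
    (hD : ∀ x y, D (x * y) = D x * y + x * D y) {x y : Q} (hxy : Commute y x) (r : ℕ) :
    τ (y * D (x ^ (r + 1))) = (r + 1) • τ (y * x ^ r * D x) := by
  induction r generalizing y with
  | zero => simp
  | succ r ih =>
    have e1 : τ (y * (D x * x ^ (r + 1))) = τ (y * x ^ (r + 1) * D x) := by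
      rw [← mul_assoc, hτ, ← mul_assoc, (hxy.pow_right (r + 1)).eq]
    rw [pow_succ' x (r + 1), hD, mul_add, map_add, e1, ← mul_assoc y x,
      ih (hxy.mul_left (Commute.refl x)), mul_assoc y x, ← pow_succ', add_comm, ← succ_nsmul]

end Cyclic

/-! ### The Lax operator as the `m`-th root of `𝓛` -/

section Root

variable {n : ℕ} {A : Type} [CommRing A] [Algebra ℝ A] (b : Module.Basis (Fin n) ℝ A)
  (m : ℕ) (reduced : Bool)

theorem eq_zero_of_nsmul_eq_zero {N : ℤ} {m : ℕ} (hm : 1 ≤ m) {x : DiffPoly N n A}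
    (h : m • x = 0) : x = 0 := by
  have h1 : (m : ℝ) • x = 0 := by rw [Nat.cast_smul_eq_nsmul, h]
  have h2 : ((m : ℝ)⁻¹ * m) • x = 0 := by rw [mul_smul, h1, smul_zero]
  rwa [inv_mul_cancel₀ (by positivity), one_smul] at h2

omit [Algebra ℝ A] in
theorem monom_one_pow {N : ℤ} (r : ℕ) :
    PDO.monom (dx N n A) 1 1 ^ r = PDO.monom (dx N n A) r 1 := by
  induction r with
  | zero => rfl
  | succ r ih => rw [pow_succ, ih, PDO.monom_mul_monom_one, Nat.cast_succ]

/-- The coefficient of `∂^0` in the Lax operator. -/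
theorem nsmul_lax_zero {L : PDO (dx (top m reduced) n A)} (hL : PDO.IsMonic L 1)
    (hLm : L ^ m = laxOp b m reduced) :
    m • L.val 0 = laxPower b m (top m reduced) (m - 1) := by
  have hd : OrdLE (L - PDO.monom _ 1 1).val 0 :=
    PDO.ordLE_pred (hL.1.sub (PDO.ordLE_monom 1 1)) (by
      rw [Pi.sub_apply, hL.2, PDO.monom_val_apply, if_pos rfl, sub_self])
  have h3 := (PDO.pow_sub_pow hL (PDO.isMonic_monom 1) hd m).2
  rw [hLm, monom_one_pow, PDO.sub_val, PDO.sub_val, Pi.sub_apply, Pi.sub_apply, laxOp_val,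
    PDO.monom_val_apply, PDO.monom_val_apply, if_neg (by omega), if_neg (by omega), sub_zero,
    sub_zero, zero_add] at h3
  exact h3.symm

/-- The condition on `L 0` in the reduced case is automatic, because `m` times this coefficient is
the coefficient of `∂^(m-1)` in `𝓛`, which is zero there. -/
theorem isLax_iff (hm : 1 ≤ m) (L : PDO (dx (top m reduced) n A)) :
    IsLax b m reduced L.val ↔ PDO.IsMonic L 1 ∧ L ^ m = laxOp b m reduced := by
  constructor
  · rintro ⟨h1, h2, -, h4⟩
    refine ⟨⟨h2, h1⟩, PDO.val_injective ?_⟩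
    rw [PDO.pow_val, h4, laxOp_val]
  · rintro ⟨h1, h2⟩
    refine ⟨h1.2, h1.1, fun hr => ?_, ?_⟩
    · have htop := top_of_reduced m reduced hr
      have h3 := nsmul_lax_zero b m reduced h1 h2
      rw [laxPower, dif_neg (by omega), if_neg (by omega)] at h3
      exact eq_zero_of_nsmul_eq_zero hm h3
    · rw [← PDO.pow_val, h2, laxOp_val]

theorem exists_isMonic_of_isLax (hm : 1 ≤ m) {L : PsiDO (DiffPoly (top m reduced) n A)}
    (hL : IsLax b m reduced L) : ∃ L' : PDO (dx (top m reduced) n A),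
      L'.val = L ∧ PDO.IsMonic L' 1 ∧ L' ^ m = laxOp b m reduced :=
  ⟨⟨L, 1, hL.2.1⟩, rfl, (isLax_iff b m reduced hm ⟨L, 1, hL.2.1⟩).mp hL⟩

/-- The Lax operator exists and is unique. -/
theorem existsUnique_isLax (hm : 1 ≤ m) : ∃! L, IsLax b m reduced L := by
  have hc : ((m : ℕ) : DiffPoly (top m reduced) n A) * C (algebraMap ℝ A (m : ℝ)⁻¹) = 1 := by
    rw [← map_natCast C, ← map_mul, ← map_natCast (algebraMap ℝ A), ← map_mul,
      mul_inv_cancel₀ (by positivity), map_one, map_one]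
  obtain ⟨L, hL, huniq⟩ := PDO.existsUnique_root m _ hc (isMonic_laxOp b m reduced)
  refine ⟨L.val, (isLax_iff b m reduced hm L).mpr hL, fun L' hL' => ?_⟩
  obtain ⟨L', rfl, h⟩ := exists_isMonic_of_isLax b m reduced hm hL'
  rw [huniq L' h]

end Root

/-! ### The hierarchy as a Hamiltonian system for both Adler maps -/

section Flows

variable {n : ℕ} {A : Type} [CommRing A] [Algebra ℝ A] (b : Module.Basis (Fin n) ℝ A)
  {ω : A →ₗ[ℝ] ℝ} (hω : IsTraceForm ω) (m : ℕ) (reduced : Bool)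

/-- Vector fields with one arbitrary nonzero component `u` suffice as tests, since the pairing
modulo total derivatives is non-degenerate by `eq_zero_of_integral_mul`. -/
theorem varDeriv_eq_coComponents {N : ℤ} {h : DiffPoly N n ℝ} {Y : PDO (dx N n A)}
    (hY : ∀ c, integral (evol N n ℝ c h) = trRes ω (Y * vectorOp b c)) :
    varDeriv h = coComponents b ω Y := by
  classical
  funext α
  have : Nonempty (Comp N n) := ⟨α⟩
  rw [← sub_eq_zero]
  refine eq_zero_of_integral_mul fun u => ?_
  have h1 := hY (Pi.single α u)
  rw [trRes_mul_comm, trRes_apply, applyCoeff_res_mul b ω (ordLE_vectorOp b _),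
    components_vectorOp, integral_evol] at h1
  have e : ∀ F : Comp N n → DiffPoly N n ℝ,
      ∑ᶠ β, (Pi.single α u : Comp N n → DiffPoly N n ℝ) β * F β = u * F α := fun F => by
    rw [finsum_eq_single _ α fun β hβ => by rw [Pi.single_eq_of_ne hβ, zero_mul],
      Pi.single_eq_same]
  rw [e, e] at h1
  rw [mul_sub, integral_sub, h1, sub_self]

/-- In the full case `M Z` and `Z M` are integral operators. In the reduced case `Z` may have a term
`z ∂^{-m}`; the residue condition says `m z' = 0`, so both differential parts are the function `z`,
which commutes with `M`. -/
theorem adler_eq_zero (hm : 1 ≤ m) {M Z : PDO (dx (top m reduced) n A)} (hM : PDO.IsMonic M m)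
    (hZ : OrdLE Z.val (-top m reduced - 2))
    (hres : reduced = true → (M * Z - Z * M).val (-1) = 0) :
    adler (PDO.posPart _) M Z = 0 := by
  by_cases hr : reduced = true
  · have htop := top_of_reduced m reduced hr
    have hZ' : OrdLE Z.val (-m) := hZ.mono (by omega)
    have hMZ := PDO.ordLE_mul hM.1 hZ'
    have hZM := PDO.ordLE_mul hZ' hM.1
    have h1 := PDO.comm_sublead hM.1 hZ'
    have e : (m : ℤ) + -m - 1 = -1 := by ring
    rw [e, hres hr, hM.2, Derivation.map_one_eq_zero, mul_zero, smul_zero, sub_zero, one_mul,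
      natCast_zsmul] at h1
    have hz := eq_zero_of_nsmul_eq_zero hm h1.symm
    have hpos : ∀ W : PDO (dx (top m reduced) n A), OrdLE W.val 0 → W.val 0 = Z.val (-m) →
        PDO.posPart _ W = PDO.monom _ 0 (Z.val (-m)) := by
      intro W hW hW0
      ext1 k
      rw [PDO.monom_val_apply]
      rcases lt_trichotomy k 0 with hk | rfl | hk
      · rw [PDO.posPart_val_of_neg _ hk, if_neg hk.ne]
      · rw [PDO.posPart_val_of_nonneg _ le_rfl, if_pos rfl, hW0]
      · rw [PDO.posPart_val_of_nonneg _ hk.le, if_neg hk.ne', hW k hk]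
    have l1 := PDO.mul_lead hM.1 hZ'
    have l2 := PDO.mul_lead hZ' hM.1
    rw [hM.2, one_mul, add_neg_cancel] at l1
    rw [hM.2, mul_one, neg_add_cancel] at l2
    rw [adler, hpos _ (hMZ.mono (by omega)) l1, hpos _ (hZM.mono (by omega)) l2, sub_eq_zero]
    ext1 k
    rw [PDO.monom_zero_mul_val, PDO.mul_monom_of_const _ _ hz, sub_zero, mul_comm]
  · have htop := top_of_not_reduced m reduced hr
    have hZ' : OrdLE Z.val (-m - 1) := hZ.mono (by omega)
    rw [adler, PDO.posPart_eq_zero (PDO.ordLE_mul hM.1 hZ') (by omega),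
      PDO.posPart_eq_zero (PDO.ordLE_mul hZ' hM.1) (by omega), zero_mul, mul_zero, sub_zero]

include hω in
/-- The Adler map on a covector depends only on its pairing with vector fields. -/
theorem adler_covectorOp (hm : 1 ≤ m) (a : ℝ) {h : DiffPoly (top m reduced) n ℝ}
    {Y : PDO (dx (top m reduced) n A)}
    (hY : ∀ c, integral (evol _ n ℝ c h) = trRes ω (Y * vectorOp b c))
    (hYL : Commute Y (laxOp b m reduced)) :
    adler (PDO.posPart _) (shiftOp b m reduced a) (covectorOp b ω m reduced h) =
      PDO.posPart _ (laxOp b m reduced * Y + constOp _ n A (algebraMap ℝ A a) * Y) *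
        laxOp b m reduced - laxOp b m reduced *
          PDO.posPart _ (laxOp b m reduced * Y + constOp _ n A (algebraMap ℝ A a) * Y) := by
  let M := shiftOp b m reduced a
  let K := constOp (top m reduced) n A (algebraMap ℝ A a)
  let Z := Y - covectorOp b ω m reduced h
  have hZ : OrdLE Z.val (-top m reduced - 2) := ordLE_of_coComponents b hω fun α => by
    rw [coComponents_sub, ← varDeriv_eq_coComponents b hY, coComponents_covectorOp b m reduced hω,
      sub_self]
  have hK : ∀ P, P * K = K * P := constOp_comm _
  have hYM : Y * M = M * Y := by
    change Y * (laxOp b m reduced + K) = (laxOp b m reduced + K) * Y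
    rw [mul_add, add_mul, hYL.eq, hK]
  -- `Z` compares two operators with the same pairing against vector fields. Its commutator with `M`
  -- has zero residue in the reduced case, since `Y` commutes with `M` and the covector obeys the
  -- constraint.
  have h0 : adler (PDO.posPart _) M Z = 0 := by
    refine adler_eq_zero m reduced hm (isMonic_shiftOp b m reduced hm a) hZ fun hr => ?_
    have e : M * Z - Z * M = -(laxOp b m reduced * covectorOp b ω m reduced h -
        covectorOp b ω m reduced h * laxOp b m reduced) := by
      have e1 : M * Z - Z * M = -(M * covectorOp b ω m reduced h -
          covectorOp b ω m reduced h * M) := by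
        change M * (Y - _) - (Y - _) * M = _
        rw [mul_sub, sub_mul, hYM]
        abel
      rw [e1]
      change -((laxOp b m reduced + K) * _ - _ * (laxOp b m reduced + K)) = _
      rw [mul_add, add_mul, hK]
      abel
    rw [e, PDO.neg_val, Pi.neg_apply, res_comm_covectorOp b ω m reduced hm hr, neg_zero]
  have h1 : adler (PDO.posPart _) M (covectorOp b ω m reduced h) = adler (PDO.posPart _) M Y := by
    have e : adler (PDO.posPart _) M Z = adler (PDO.posPart _) M Y -
        adler (PDO.posPart _) M (covectorOp b ω m reduced h) := by
      rw [adler, adler, adler, mul_sub, sub_mul, map_sub, map_sub]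
      noncomm_ring
    rw [e, sub_eq_zero] at h0
    exact h0.symm
  have h2 : M * Y = laxOp b m reduced * Y + K * Y := add_mul _ _ _
  change adler (PDO.posPart _) M _ = _
  rw [h1, adler, hYM, h2]
  change PDO.posPart _ _ * (laxOp b m reduced + K) - (laxOp b m reduced + K) * PDO.posPart _ _ = _
  rw [mul_add, add_mul, hK]
  abel

variable {L : PDO (dx (top m reduced) n A)}

/-- Cyclicity gives `r tr(L^{r-1} δL)` for the variation of the trace of `L^r` and `m tr(Y L^{m-1}
δL)` for `tr(Y δ𝓛)`. Thus `Y` plays the role of `L^{r-m}`, and the prefactor `m / r` balances the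
two multiplicities. -/
theorem integral_evol_hamZero (hm : 1 ≤ m) (hLm : L ^ m = laxOp b m reduced) {r : ℕ}
    (hr : 1 ≤ r) {Y : PDO (dx (top m reduced) n A)} (hY : Commute Y L)
    (hYr : Y * L ^ (m - 1) = L ^ (r - 1))
    (c : Comp (top m reduced) n → DiffPoly (top m reduced) n ℝ) :
    integral (evol _ n ℝ c (hamZero ω m L.val r)) = trRes ω (Y * vectorOp b c) := by
  have h1 := trace_mul_derivation_pow (trRes_mul_comm ω) (evolOp_mul c) hY (m - 1)
  have h2 := trace_mul_derivation_pow (trRes_mul_comm ω) (evolOp_mul c)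
    (Commute.one_left L) (r - 1)
  rw [Nat.sub_add_cancel hm, hLm, evolOp_laxOp, hYr] at h1
  rw [Nat.sub_add_cancel hr, one_mul, one_mul] at h2
  have h3 : integral (evol _ n ℝ c (hamZero ω m L.val r)) =
      ((m : ℝ) / r) • trRes ω (evolOp A c (L ^ r)) := by
    rw [hamZero, Derivation.map_smul, integral_smul, ← PDO.pow_val, res, ← applyCoeff_evol]
    rfl
  rw [h3, h2, h1, ← Nat.cast_smul_eq_nsmul ℝ r, ← Nat.cast_smul_eq_nsmul ℝ m, smul_smul,
    div_mul_cancel₀ _ (by positivity)]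

theorem flow_eq (r : ℕ) : flow b m L.val r = (PDO.posPart _ (L ^ r) * laxOp b m reduced -
    laxOp b m reduced * PDO.posPart _ (L ^ r)).val := by
  rw [flow, PDO.comm_val, PDO.posPart_val, PDO.pow_val, laxOp_val]

include hω

/-- The hierarchy is Hamiltonian for the first Adler map. -/
theorem adler_covectorOp_hamZero (hm : 1 ≤ m) (hL : PDO.IsMonic L 1)
    (hLm : L ^ m = laxOp b m reduced) {r : ℕ} (hr : 1 ≤ r) :
    (adler (PDO.posPart _) (laxOp b m reduced)
      (covectorOp b ω m reduced (hamZero ω m L.val r))).val = flow b m L.val r := by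
  -- The exponent `r - m` may be negative, so `L^{r-m}` is written as `K^m L^r` with `K` the inverse
  -- of `L`.
  obtain ⟨K, -, hLK, hKL⟩ := PDO.exists_inverse hL
  have hcomm : Commute K L := hKL.trans hLK.symm
  have hKm : K ^ m * L ^ m = 1 := by rw [← hcomm.mul_pow, hKL, one_pow]
  have hLKm : L ^ m * K ^ m = 1 := by rw [← hcomm.symm.mul_pow, hLK, one_pow]
  have hY : Commute (K ^ m * L ^ r) L := (hcomm.pow_left m).mul_left (Commute.pow_self L r)
  have h := adler_covectorOp b hω m reduced hm 0
    (integral_evol_hamZero b m reduced hm hLm hr hY (by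
      rw [mul_assoc, ← pow_add, show r + (m - 1) = m + (r - 1) by omega, pow_add, ← mul_assoc,
        hKm, one_mul]))
    (by rw [← hLm]; exact hY.pow_right m)
  rw [shiftOp_zero, map_zero, map_zero, zero_mul, add_zero] at h
  rw [h, flow_eq, ← hLm, ← mul_assoc, hLKm, one_mul]

/-- The hierarchy is Hamiltonian for the second Adler map. -/
theorem adlerInf_covectorOp_hamInfty (hm : 1 ≤ m)
    (hLm : L ^ m = laxOp b m reduced) {r : ℕ} (hr : 1 ≤ r) :
    (adlerInf (laxOp b m reduced)
      (covectorOp b ω m reduced (hamInfty ω m L.val r))).val = flow b m L.val r := by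
  have hY : Commute (-L ^ r) L := (Commute.pow_self L r).neg_left
  have hYL : Commute (-L ^ r) (laxOp b m reduced) := by
    rw [← hLm]
    exact hY.pow_right m
  -- After this rewriting the gradient of `g_r` is represented by `-L^r`, with no inverse needed.
  have hham : hamInfty ω m L.val r = -hamZero ω m L.val (m + r) := by
    rw [hamInfty, hamZero, neg_smul, Nat.cast_add, add_comm (r : ℝ)]
  have hint : ∀ c, integral (evol _ n ℝ c (hamInfty ω m L.val r)) =
      trRes ω (-L ^ r * vectorOp b c) := by
    intro c
    rw [hham, map_neg, integral_neg, integral_evol_hamZero b m reduced hm hLm (by omega)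
      (Commute.pow_self L r), neg_mul, map_neg]
    rw [← pow_add]
    congr 1
    omega
  have h0 := adler_covectorOp b hω m reduced hm 0 hint hYL
  have h1 := adler_covectorOp b hω m reduced hm 1 hint hYL
  have hone : constOp (top m reduced) n A 1 = 1 :=
    congrArg (PDO.monom _ 0) (map_one C)
  rw [shiftOp_zero, map_zero, map_zero, zero_mul, add_zero] at h0
  rw [map_one, hone, one_mul] at h1
  -- Between the shifts `0` and `1` the differential part changes by that of `-L^r`, so the
  -- difference of the two commutators is the flow.
  rw [adlerInf_eq, h0, h1, flow_eq, map_add, map_neg]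
  congr 1
  noncomm_ring

/-- Tangency of the flow is inherited from its Hamiltonian form. -/
theorem ordLE_flow (hm : 1 ≤ m) (hL : PDO.IsMonic L 1)
    (hLm : L ^ m = laxOp b m reduced) {r : ℕ} (hr : 1 ≤ r) :
    OrdLE (flow b m L.val r) (top m reduced) := by
  rw [← adler_covectorOp_hamZero b hω m reduced hm hL hLm hr]
  have h := ordLE_adler_covectorOp b ω m reduced hm 0 (hamZero ω m L.val r)
  rwa [shiftOp_zero] at h

omit hω [Algebra ℝ A] in
/-- The leading coefficient of a derivation on a power of a monic operator. -/
theorem derivation_pow_lead {N : ℤ} {L : PDO (dx N n A)} (hL : PDO.IsMonic L 1)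
    {D : PDO (dx N n A) →+ PDO (dx N n A)} (hD : ∀ x y, D (x * y) = D x * y + x * D y) {k : ℤ}
    (hk : OrdLE (D L).val k) (r : ℕ) : OrdLE (D (L ^ (r + 1))).val (k + r) ∧
      (D (L ^ (r + 1))).val (k + r) = (r + 1) • (D L).val k := by
  induction r with
  | zero => simpa using hk
  | succ r ih =>
    have h1 := PDO.ordLE_mul hk (hL.pow (r + 1)).1
    have h2 := PDO.ordLE_mul hL.1 ih.1
    have h3 := PDO.mul_lead hk (hL.pow (r + 1)).1
    have h4 := PDO.mul_lead hL.1 ih.1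
    have e1 : k + ((r + 1 : ℕ) : ℤ) * 1 = k + ((r + 1 : ℕ) : ℤ) := by ring
    have e2 : 1 + (k + (r : ℤ)) = k + ((r + 1 : ℕ) : ℤ) := by push_cast; ring
    rw [e1] at h1 h3
    rw [e2] at h2 h4
    rw [pow_succ', hD]
    refine ⟨h1.add h2, ?_⟩
    rw [PDO.add_val, Pi.add_apply, h3, h4, (hL.pow (r + 1)).2, hL.2, ih.2, mul_one, one_mul,
      succ_nsmul' _ (r + 1)]

/-- The flow of `𝓛` is the flow of the Lax operator. -/
theorem evolOp_flow (hm : 1 ≤ m) (hL : PDO.IsMonic L 1) (hLm : L ^ m = laxOp b m reduced) {r : ℕ}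
    (hr : 1 ≤ r) : evolOp A (components b (flow b m L.val r)) L =
      PDO.posPart _ (L ^ r) * L - L * PDO.posPart _ (L ^ r) := by
  let P := PDO.posPart _ (L ^ r)
  let c := components b (flow b m L.val r)
  -- The defect of the Lax equation is a derivation that kills `L^m`. The leading coefficient of `D
  -- (L^m)` is `m` times that of `D L`, so `D L` vanishes.
  let D : PDO (dx (top m reduced) n A) →+ PDO (dx (top m reduced) n A) :=
    evolOp A c - (PDO.mulL P - PDO.mulR P)
  have hDx : ∀ x, D x = evolOp A c x - (P * x - x * P) := fun x => rfl
  have hD : ∀ x y, D (x * y) = D x * y + x * D y := by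
    intro x y
    rw [hDx, hDx, hDx, evolOp_mul]
    noncomm_ring
  have h0 : D (L ^ m) = 0 := by
    have hP := ordLE_flow b hω m reduced hm hL hLm hr
    have e : vectorOp b c = P * laxOp b m reduced - laxOp b m reduced * P := by
      have e1 := flow_eq b m reduced (L := L) r
      rw [e1] at hP
      have := vectorOp_components b hP
      rw [← e1] at this
      exact this
    rw [hDx, hLm, evolOp_laxOp, e, sub_self]
  have h1 : D L = 0 := by
    refine PDO.eq_zero_of_ordLE_pred fun k hk => ?_
    have h2 := (derivation_pow_lead hL hD hk (m - 1)).2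
    rw [Nat.sub_add_cancel hm, h0] at h2
    exact eq_zero_of_nsmul_eq_zero hm h2.symm
  rw [hDx, sub_eq_zero] at h1
  exact h1

end Flows

end FrobeniusKP

namespace FrobeniusKP

open MvPolynomial PsiDO

/-! ### Assembly of the bi-Hamiltonian structure -/

section BiHamiltonian

variable {n : ℕ} {A : Type} [CommRing A] [Algebra ℝ A] (b : Module.Basis (Fin n) ℝ A)
  {ω : A →ₗ[ℝ] ℝ} (hω : IsTraceForm ω) (m : ℕ) (reduced : Bool)

/-- The Adler map, as an additive map of the covector. -/
noncomputable def adlerHom {N : ℤ} (M : PDO (dx N n A)) : PDO (dx N n A) →+ PDO (dx N n A) :=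
  AddMonoidHom.mk' (adler (PDO.posPart _) M) fun X Y => by
    rw [adler, adler, adler, mul_add, add_mul, map_add, map_add]
    noncomm_ring

include hω in
/-- A trace form induces a local bi-Hamiltonian structure of the hierarchy. -/
theorem exists_isBiHamiltonian (hm : 1 ≤ m) {L : PsiDO (DiffPoly (top m reduced) n A)}
    (hL : IsLax b m reduced L) :
    ∃ B₀ B₁ : Bracket (top m reduced) n, IsBiHamiltonian b ω m reduced L B₀ B₁ := by
  obtain ⟨L, rfl, hL1, hLm⟩ := exists_isMonic_of_isLax b m reduced hm hL
  obtain ⟨B₀, B₁, h0, h1, hP⟩ := exists_brackets b hω m reduced hm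
  have t0 : ∀ f, OrdLE (adler (PDO.posPart _) (laxOp b m reduced)
      (covectorOp b ω m reduced f)).val (top m reduced) := fun f => by
    have := ordLE_adler_covectorOp b ω m reduced hm 0 f
    rwa [shiftOp_zero] at this
  have t1 := ordLE_adlerInf_covectorOp b ω m reduced hm
  have v0 : ∀ f, (adler (PDO.posPart _) (laxOp b m reduced) (covectorOp b ω m reduced f)).val =
      adlerZero (dx _ n A) (laxPower b m _) (covector b ω m reduced f) := fun f => by
    rw [adler_val, laxOp_val, covectorOp_val]
  have v1 : ∀ f, (adlerInf (laxOp b m reduced) (covectorOp b ω m reduced f)).val =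
      adlerInfty (dx _ n A) (laxPower b m _) (covector b ω m reduced f) := fun f => by
    rw [adlerInf_val, laxOp_val, covectorOp_val]
  have hpair : ∀ (P : PDO (dx (top m reduced) n A)) g, trRes ω (P * covectorOp b ω m reduced g) =
      integral (pairing ω P.val (covector b ω m reduced g)) := fun P g => by
    rw [trRes_apply, PDO.mul_val, covectorOp_val]
    rfl
  have f0 : ∀ r, 1 ≤ r → adlerZero (dx _ n A) (laxPower b m _)
      (covector b ω m reduced (hamZero ω m L.val r)) = flow b m L.val r := fun r hr => by
    rw [← v0, adler_covectorOp_hamZero b hω m reduced hm hL1 hLm hr]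
  have f1 : ∀ r, 1 ≤ r → adlerInfty (dx _ n A) (laxPower b m _)
      (covector b ω m reduced (hamInfty ω m L.val r)) = flow b m L.val r := fun r hr => by
    rw [← v1, adlerInf_covectorOp_hamInfty b hω m reduced hm hLm hr]
  refine ⟨B₀, B₁, ?_, ?_, ?_, hP, ?_, ?_, ?_, f0, f1, ?_, ?_, ?_⟩
  · intro f k hk
    rw [← v0, ← v1]
    exact ⟨t0 f k hk, t1 f k hk⟩
  · intro f g
    rw [h0, hpair, v0]
  · intro f g
    rw [h1, hpair, v1]
  · exact isLocal_of_isDiffFamily b hω m reduced (H := adlerHom (laxOp b m reduced)) h0 t0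
      fun T hT => hT.adler _
  · refine isLocal_of_isDiffFamily b hω m reduced
      (H := adlerHom (laxOp b m reduced) - adlerHom (shiftOp b m reduced 1)) ?_ ?_
      fun T hT => (hT.adler _).sub (hT.adler _)
    · intro f g
      rw [h1, adlerInf_eq]
      rfl
    · intro f
      have := t1 f
      rwa [adlerInf_eq] at this
  · intro F hF G hG
    have hL := isValued_laxOp (A := A) b m reduced
    have hF' := isValued_covectorOp b m reduced hω hF
    have hG' := isValued_covectorOp b m reduced hω hG
    -- The new density `K` is the residue in the definition of the bracket.
    exact ⟨⟨_, (hL.adler hF').mul hG' (-1), h0 _ _⟩, ⟨_, (hL.adlerInf hF').mul hG' (-1), h1 _ _⟩⟩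
  · intro r hr k
    rw [← evolOp_val, evolOp_flow b hω m reduced hm hL1 hLm hr, PDO.comm_val, PDO.posPart_val,
      PDO.pow_val]
  · intro r hr f
    rw [h0, trRes_mul_covectorOp b hω m reduced (t0 _), v0, f0 r hr]
  · intro r hr f
    rw [h1, trRes_mul_covectorOp b hω m reduced (t1 _), v1, f1 r hr]

end BiHamiltonian

/-! ### Dependence on the trace form -/

section ChangeOfForm

variable {n : ℕ} {A : Type} [CommRing A] [Algebra ℝ A] (b : Module.Basis (Fin n) ℝ A)
  {ω ω' : A →ₗ[ℝ] ℝ} (m : ℕ) (reduced : Bool)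

-- A non-degenerate form identifies `A` with its dual; the multiplier is expanded in the basis dual
-- with respect to `ω'`.
include b in
theorem exists_mul_form (hω' : IsTraceForm ω') (ω : A →ₗ[ℝ] ℝ) :
    ∃ v, ω = ω' ∘ₗ LinearMap.mulLeft ℝ v := by
  refine ⟨∑ q, ω (b q) • dualVec b ω' q, b.ext fun p => ?_⟩
  rw [LinearMap.comp_apply, LinearMap.mulLeft_apply, mul_comm, Finset.mul_sum, map_sum,
    Finset.sum_eq_single p]
  · rw [mul_smul_comm, map_smul, dualVec_mul b hω', if_pos rfl, smul_eq_mul, mul_one]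
  · intro q _ hq
    rw [mul_smul_comm, map_smul, dualVec_mul b hω', if_neg (Ne.symm hq), smul_zero]
  · intro h
    exact absurd (Finset.mem_univ _) h

theorem valuedVarDeriv_change (hω : IsTraceForm ω) (hω' : IsTraceForm ω') {v : A}
    (hv : ω = ω' ∘ₗ LinearMap.mulLeft ℝ v) {N : ℤ} (f : DiffPoly N n ℝ) (i : Set.Iic N) :
    valuedVarDeriv b ω' f i = C v * valuedVarDeriv b ω f i := by
  refine valuedVarDeriv_eq_of_forall b hω' fun q => ?_
  rw [mul_left_comm, applyCoeff_C_mul, ← hv, applyCoeff_basis_mul_valuedVarDeriv b hω]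

omit [Algebra ℝ A] in
theorem monom_zero_C_mul {N : ℤ} (v : A) (x : DiffPoly N n A) :
    PDO.monom (dx N n A) 0 (C v * x) = constOp N n A v * PDO.monom _ 0 x := by
  ext1 k
  rw [constOp_mul_val, PDO.monom_val_apply, PDO.monom_val_apply, mul_ite, mul_zero]

theorem covectorTerm_C_mul (i : ℤ) (v : A) (x : DiffPoly (top m reduced) n A) :
    covectorTerm b m reduced i (C v * x) = constOp _ n A v * covectorTerm b m reduced i x := by
  have hC : ∀ (j : ℕ) (P : DiffPoly (top m reduced) n A), (dx _ n A)^[j] (C v * P) =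
      C v * (dx _ n A)^[j] P := by
    intro j P
    induction j with
    | zero => rfl
    | succ j ih => rw [Function.iterate_succ_apply', Function.iterate_succ_apply', ih, dx_C_mul]
  have h : constraintTerm b m reduced i (C v * x) = C v * constraintTerm b m reduced i x := by
    rw [constraintTerm_apply, constraintTerm_apply, mul_smul_comm, Finset.mul_sum]
    congr 1
    refine Finset.sum_congr rfl fun j _ => ?_
    rw [mul_assoc, hC, mul_smul_comm]
  rw [covectorTerm_apply, covectorTerm_apply, h, monom_zero_C_mul, monom_zero_C_mul, mul_add,
    ← mul_assoc, constOp_comm, mul_assoc]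
  congr 1
  split_ifs
  · rw [← mul_assoc, constOp_comm, mul_assoc]
  · rw [mul_zero]

/-- The functional and its scalar variational derivatives do not involve the form; only the
identification of `A` with its dual changes, and constants pass through the operators `∂^{-i-1}`. -/
theorem covectorOp_change (hω : IsTraceForm ω) (hω' : IsTraceForm ω') {v : A}
    (hv : ω = ω' ∘ₗ LinearMap.mulLeft ℝ v) (f : DiffPoly (top m reduced) n ℝ) :
    covectorOp b ω' m reduced f = constOp _ n A v * covectorOp b ω m reduced f := by
  obtain ⟨s, hs⟩ := exists_valuedVarDeriv_support b ω f
  have hs' : ∀ i ∉ s, valuedVarDeriv b ω' f i = 0 := fun i hi => by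
    rw [valuedVarDeriv_change b hω hω' hv, hs i hi, mul_zero]
  rw [covectorOp_eq_sum b ω m reduced hs, covectorOp_eq_sum b ω' m reduced hs', Finset.mul_sum]
  refine Finset.sum_congr rfl fun i _ => ?_
  rw [valuedVarDeriv_change b hω hω' hv, covectorTerm_C_mul]

omit [Algebra ℝ A] in
theorem adler_constOp_mul {N : ℤ} (v : A) (M X : PDO (dx N n A)) :
    adler (PDO.posPart _) M (constOp N n A v * X) =
      constOp N n A v * adler (PDO.posPart _) M X := by
  rw [adler, adler, ← mul_assoc M, constOp_comm, mul_assoc, mul_assoc, posPart_constOp_mul,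
    posPart_constOp_mul, ← mul_assoc M, constOp_comm, mul_sub, mul_assoc, mul_assoc]

theorem adlerInf_constOp_mul (v : A) (X : PDO (dx (top m reduced) n A)) :
    adlerInf (laxOp b m reduced) (constOp _ n A v * X) =
      constOp _ n A v * adlerInf (laxOp b m reduced) X := by
  rw [adlerInf_eq, adlerInf_eq, adler_constOp_mul, adler_constOp_mul, mul_sub]

/-! ### Restriction to the fields with negative index -/

/-- The substitution `V_i = 0` for `i ≥ 0`. -/
noncomputable def killNonneg (N : ℤ) (n : ℕ) (R : Type) [CommRing R] : DiffPoly N n R →ₐ[R] DiffPoly N n R :=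
  aeval fun v => if 0 ≤ (v.1.1 : ℤ) then 0 else X v

theorem killNonneg_dx (N : ℤ) {R : Type} [CommRing R] (F : DiffPoly N n R) :
    killNonneg N n R (dx N n R F) = dx N n R (killNonneg N n R F) := by
  induction F using MvPolynomial.induction_on with
  | C a => rw [derivation_C, map_zero, killNonneg, aeval_C, Derivation.map_algebraMap]
  | add F G hF hG => rw [map_add, map_add, map_add, map_add, hF, hG]
  | mul_X F v hF =>
    have h : killNonneg N n R (dx N n R (X v)) = dx N n R (killNonneg N n R (X v)) := by
      rw [dx_X, killNonneg, aeval_X, aeval_X]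
      dsimp only
      split_ifs
      · rw [map_zero]
      · rw [dx_X]
    rw [Derivation.leibniz, map_add, smul_eq_mul, smul_eq_mul, map_mul, map_mul, hF, h, map_mul,
      Derivation.leibniz, smul_eq_mul, smul_eq_mul]

theorem applyCoeff_killNonneg {N : ℤ} (φ : A →ₗ[ℝ] ℝ) (F : DiffPoly N n A) :
    applyCoeff φ (killNonneg N n A F) = killNonneg N n ℝ (applyCoeff φ F) := by
  have hmap : ∀ f, killNonneg N n A (map (algebraMap ℝ A) f) =
      map (algebraMap ℝ A) (killNonneg N n ℝ f) := by
    intro f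
    induction f using MvPolynomial.induction_on with
    | C a => rw [map_C, killNonneg, aeval_C, killNonneg, aeval_C, algebraMap_eq, algebraMap_eq, map_C]
    | add f g hf hg => rw [map_add, map_add, hf, hg, map_add, map_add]
    | mul_X f v hf =>
      rw [map_mul, map_mul, hf, map_X, map_mul, map_mul, killNonneg, killNonneg, aeval_X, aeval_X]
      split_ifs
      · rw [map_zero]
      · rw [map_X]
  induction F using valued_induction with
  | hadd F G hF hG => rw [map_add, applyCoeff_add, hF, hG, applyCoeff_add, map_add]
  | h a f =>
    rw [map_mul, hmap, applyCoeff_C_mul_map, map_smul, ← applyCoeff_C_mul_map]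
    congr 2
    exact aeval_C _ a

end ChangeOfForm

end FrobeniusKP

namespace FrobeniusKP

open MvPolynomial PsiDO

/-! ### The first flow separates trace forms -/

section FirstFlow

variable {n : ℕ} {A : Type} [CommRing A] [Algebra ℝ A] (b : Module.Basis (Fin n) ℝ A)
  (m : ℕ) (reduced : Bool)

theorem killNonneg_field {N : ℤ} (i : Set.Iic N) (j : ℕ) :
    killNonneg N n A (field b i j) = if 0 ≤ (i : ℤ) then 0 else field b i j := by
  have hC : ∀ a : A, killNonneg N n A (C a) = C a := fun a => aeval_C _ a
  rw [field, map_sum]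
  simp only [map_mul, hC]
  simp only [killNonneg, aeval_X]
  split_ifs <;> simp

/-- The first flow on the fields with negative index, when the others vanish. -/
theorem killNonneg_flow_one {L : PDO (dx (top m reduced) n A)} (hm : 1 ≤ m)
    (hL : PDO.IsMonic L 1) (hLm : L ^ m = laxOp b m reduced) (i : Set.Iic (top m reduced))
    (hi : (i : ℤ) < 0) :
    killNonneg _ n A (flow b m L.val 1 i) = field b i 1 := by
  let σ := killNonneg (top m reduced) n A
  have hσd : ∀ (l : ℕ) F, σ F = 0 → σ ((dx _ n A)^[l] F) = 0 := by
    intro l F hF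
    induction l with
    | zero => exact hF
    | succ l ih =>
      change killNonneg _ n A _ = 0 at ih
      change killNonneg _ n A _ = 0
      rw [Function.iterate_succ_apply', killNonneg_dx, ih, map_zero]
  -- `m` times `L.val 0` is `V_{m-1}` or zero, and the index `m - 1` is non-negative. After the
  -- substitution only the commutator with `∂` is left in the first flow.
  have hu : σ (L.val 0) = 0 := by
    refine eq_zero_of_nsmul_eq_zero hm ?_
    rw [← map_nsmul, nsmul_lax_zero b m reduced hL hLm, laxPower]
    split_ifs with h h'
    · exact (killNonneg_field b _ _).trans (if_pos (by simp; omega))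
    · omega
    · exact map_zero σ
  have hpos : PDO.posPart _ L = PDO.monom _ 1 1 + PDO.monom _ 0 (L.val 0) := by
    ext1 k
    rw [PDO.add_val, Pi.add_apply, PDO.monom_val_apply, PDO.monom_val_apply]
    rcases lt_or_ge k 0 with hk | hk
    · rw [PDO.posPart_val_of_neg _ hk, if_neg (by omega), if_neg (by omega), add_zero]
    · rw [PDO.posPart_val_of_nonneg _ hk]
      rcases lt_trichotomy k 1 with h | rfl | h
      · obtain rfl : k = 0 := by omega
        rw [if_neg (by omega), if_pos rfl, zero_add]
      · rw [if_pos rfl, if_neg (by omega), add_zero, hL.2]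
      · rw [if_neg (by omega), if_neg (by omega), add_zero, hL.1 k h]
  have hM := isMonic_laxOp b m reduced
  have h1 : (PDO.monom _ 1 1 * laxOp b m reduced - laxOp b m reduced * PDO.monom _ 1 1).val i =
      field b i 1 := by
    rw [PDO.sub_val, Pi.sub_apply, PDO.mul_monom_of_const _ _ (Derivation.map_one_eq_zero _),
      PDO.mul_val, PDO.monom_val, single_comp_apply _ _ _ hM.1 _
        (n := (1 + (m : ℤ) - i).toNat + 2) (by omega), Finset.sum_range_succ',
      Finset.sum_range_succ', Finset.sum_eq_zero]
    · have e : (i : ℤ) - 1 + 1 = i := by ring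
      simp only [Nat.cast_zero, zero_add, Nat.cast_one, add_zero, Function.iterate_one,
        Function.iterate_zero, id, Ring.choose_one_right, Ring.choose_zero_right, one_mul, one_smul,
        mul_one, e, add_sub_cancel_right]
      rw [laxOp_val_of_le b m reduced i.2, dx_field]
    · intro l _
      have : Ring.choose (1 : ℤ) (l + 1 + 1) = 0 := by
        have := Ring.choose_natCast (R := ℤ) 1 (l + 1 + 1)
        rw [Nat.cast_one] at this
        rw [this, Nat.choose_eq_zero_of_lt (by omega), Nat.cast_zero]
      rw [this, zero_smul]
  have h2 : σ ((PDO.monom _ 0 (L.val 0) * laxOp b m reduced).val i) = 0 := by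
    rw [PDO.monom_zero_mul_val, map_mul, hu, zero_mul]
  have h3 : σ ((laxOp b m reduced * PDO.monom _ 0 (L.val 0)).val i) = 0 := by
    rw [PDO.mul_val, comp_apply_eq_sum _ hM.1 (PDO.ordLE_monom 0 _), map_sum]
    refine Finset.sum_eq_zero fun p _ => ?_
    rw [map_zsmul, map_mul, hσd, mul_zero, smul_zero]
    rw [PDO.monom_val_apply]
    split_ifs
    exacts [hu, map_zero σ]
  have e : PDO.posPart _ (L ^ 1) * laxOp b m reduced - laxOp b m reduced * PDO.posPart _ (L ^ 1) =
      (PDO.monom _ 1 1 * laxOp b m reduced - laxOp b m reduced * PDO.monom _ 1 1) +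
      (PDO.monom _ 0 (L.val 0) * laxOp b m reduced -
        laxOp b m reduced * PDO.monom _ 0 (L.val 0)) := by
    rw [pow_one, hpos, add_mul, mul_add]
    abel
  have h4 := (killNonneg_field b i 1).trans (if_neg (not_le.mpr hi))
  rw [flow_eq, e, PDO.add_val, Pi.add_apply, h1, map_add, h4, PDO.sub_val, Pi.sub_apply, map_sub]
  change _ + (σ _ - σ _) = _
  rw [h2, h3, sub_self, add_zero]

/-- A multiple of the translation flow, on fields with different indices `i` and `j`, is
trivial on functionals only if the factor is a real number. -/
theorem coord_mul_of_integral {N : ℤ} {w : A} {i j : Set.Iic N} (hij : i ≠ j) (p q : Fin n)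
    (h : integral (applyCoeff (b.coord q) (C w * field b i 1) * X ((j, p), 0) +
      X ((i, q), 0) * applyCoeff (b.coord p) (C w * field b j 1)) = 0) (t : Fin n) :
    b.coord p (w * b t) = if t = p then b.coord q (w * b q) else 0 := by
  classical
  have hji : j ≠ i := hij.symm
  have hf : ∀ (k : Set.Iic N) (r : Fin n), applyCoeff (b.coord r) (C w * field b k 1) =
      ∑ s, b.coord r (w * b s) • (X ((k, s), 1) : DiffPoly N n ℝ) := by
    intro k r
    rw [field, Finset.mul_sum, applyCoeff_sum]
    refine Finset.sum_congr rfl fun s _ => ?_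
    rw [← mul_assoc, ← map_mul, ← applyCoeff_C_mul_map, map_X]
  let u : DiffPoly N n ℝ := ∑ s, b.coord q (w * b s) • X ((i, s), 0)
  let y : DiffPoly N n ℝ := ∑ s, b.coord p (w * b s) • X ((j, s), 1)
  have hu : dx N n ℝ u = ∑ s, b.coord q (w * b s) • (X ((i, s), 1) : DiffPoly N n ℝ) := by
    rw [map_sum]
    refine Finset.sum_congr rfl fun s _ => ?_
    rw [Derivation.map_smul, dx_X]
  -- Integrating by parts puts all derivatives on the field `j`. The variational derivative in
  -- `v_{[i]q}` then has a single term, and comparing coefficients of `v_{[j]t}'` gives the claim.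
  have h1 : integral (X ((i, q), 0) * y - u * X ((j, p), 1)) = 0 := by
    have e : X ((i, q), 0) * y - u * X ((j, p), 1) =
        (dx N n ℝ u * X ((j, p), 0) + X ((i, q), 0) * y) - dx N n ℝ (u * X ((j, p), 0)) := by
      rw [Derivation.leibniz, dx_X, smul_eq_mul, smul_eq_mul]
      ring
    rw [hf, hf, ← hu] at h
    rw [e, integral_sub, h, integral_dx, sub_zero]
  obtain ⟨g, hg⟩ := (integral_eq_zero_iff _).mp h1
  have hpu : ∀ l, pderiv ((i, q), l) u = if l = 0 then C (b.coord q (w * b q)) else 0 := by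
    intro l
    rw [map_sum, Finset.sum_eq_single q]
    · rw [Derivation.map_smul, pderiv_X, Pi.single_apply]
      by_cases hl : l = 0
      · rw [hl, if_pos rfl, if_pos rfl, smul_eq_C_mul, mul_one]
      · rw [if_neg hl, if_neg (by simp [Ne.symm hl]), smul_zero]
    · intro s _ hs
      rw [Derivation.map_smul, pderiv_X_of_ne (by simp [hs]), smul_zero]
    · intro h
      exact absurd (Finset.mem_univ _) h
  have hpy : ∀ l, pderiv ((i, q), l) y = 0 := by
    intro l
    rw [map_sum]
    refine Finset.sum_eq_zero fun s _ => ?_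
    rw [Derivation.map_smul, pderiv_X_of_ne (by simp [hji]), smul_zero]
  have hp : ∀ l, pderiv ((i, q), l) (X ((i, q), 0) * y - u * X ((j, p), 1)) =
      if l = 0 then y - C (b.coord q (w * b q)) * X ((j, p), 1) else 0 := by
    intro l
    rw [map_sub, Derivation.leibniz, Derivation.leibniz, hpy, hpu,
      pderiv_X_of_ne (show ((j, p), 1) ≠ ((i, q), l) by simp [hji]), pderiv_X, Pi.single_apply]
    by_cases hl : l = 0
    · subst hl
      simp only [if_true, smul_eq_mul]
      ring
    · rw [if_neg (by simp [Ne.symm hl]), if_neg hl, if_neg hl]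
      simp
  have h2 : y - C (b.coord q (w * b q)) * X ((j, p), 1) = 0 := by
    have h3 := varDeriv_dx g (i, q)
    rw [hg, varDeriv_eq_sum (J := 1) fun l hl => by rw [hp, if_neg (by omega)],
      Finset.sum_range_one, hp, if_pos rfl] at h3
    simpa using h3
  have h4 := congrArg (pderiv ((j, t), 1)) h2
  have hpt : pderiv ((j, t), 1) y = C (b.coord p (w * b t)) := by
    rw [map_sum, Finset.sum_eq_single t]
    · rw [Derivation.map_smul, pderiv_X_self, smul_eq_C_mul, mul_one]
    · intro s _ hs
      rw [Derivation.map_smul, pderiv_X_of_ne (by simp [hs]), smul_zero]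
    · intro h
      exact absurd (Finset.mem_univ _) h
  rw [map_sub, hpt, map_zero, Derivation.leibniz, derivation_C, smul_zero, add_zero, smul_eq_mul,
    sub_eq_zero, pderiv_X, Pi.single_apply] at h4
  by_cases htp : t = p
  · rw [if_pos htp]
    subst htp
    rw [if_pos rfl, mul_one] at h4
    exact C_injective _ _ h4
  · rw [if_neg htp]
    rw [if_neg (by simp [Ne.symm htp]), mul_zero] at h4
    exact C_injective _ _ (h4.trans (map_zero C).symm)

/-- Since `q` is independent of `p`, all diagonal entries of multiplication by `w` equal the one at
`0`. Multiplication by `w` is therefore a real scalar, which is evaluated at `1`. -/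
theorem eq_smul_of_coord [NeZero n] {w : A} (h : ∀ p q t, b.coord p (w * b t) =
    if t = p then b.coord q (w * b q) else 0) : ∃ a : ℝ, w = algebraMap ℝ A a := by
  let a := b.coord 0 (w * b 0)
  have hb : ∀ t, w * b t = a • b t := by
    intro t
    refine b.ext_elem fun p => ?_
    have := h p 0 t
    rw [Module.Basis.coord_apply] at this
    rw [this, map_smul, Finsupp.smul_apply, b.repr_self, Finsupp.single_apply]
    split_ifs <;> simp [a]
  have hw : LinearMap.mulLeft ℝ w = a • LinearMap.id := b.ext fun t => hb t
  refine ⟨a, ?_⟩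
  have := LinearMap.congr_fun hw 1
  simpa [Algebra.algebraMap_eq_smul_one] using this

/-- A multiple of the first flow is trivial on functionals only if the factor is
a real number. -/
theorem eq_algebraMap_of_flow_one [NeZero n] {L : PDO (dx (top m reduced) n A)} (hm : 1 ≤ m)
    (hL : PDO.IsMonic L 1) (hLm : L ^ m = laxOp b m reduced) {w : A}
    {P : PsiDO (DiffPoly (top m reduced) n A)} (hP : ∀ k, P k = C w * flow b m L.val 1 k)
    (h : ∀ g, integral (evol _ n ℝ (components b P) g) = 0) : ∃ a : ℝ, w = algebraMap ℝ A a := by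
  have htop := le_top m reduced
  -- The indices `-1` and `-2` belong to fields in every case, because the highest index is at least
  -- `m - 2 ≥ -1`.
  let i : Set.Iic (top m reduced) := ⟨-1, Set.mem_Iic.mpr (by omega)⟩
  let j : Set.Iic (top m reduced) := ⟨-2, Set.mem_Iic.mpr (by omega)⟩
  have hij : i ≠ j := fun h => by
    have := congrArg Subtype.val h
    simp [i, j] at this
  have hc : ∀ (k : Set.Iic (top m reduced)) (r : Fin n), (k : ℤ) < 0 →
      killNonneg _ n ℝ (components b P (k, r)) =
        applyCoeff (b.coord r) (C w * field b k 1) := by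
    intro k r hk
    rw [components, ← applyCoeff_killNonneg, hP, map_mul, killNonneg_flow_one b m reduced hm hL hLm k hk]
    congr 2
    exact aeval_C _ w
  have hX : ∀ (k : Set.Iic (top m reduced)) (r : Fin n), (k : ℤ) < 0 →
      killNonneg _ n ℝ (X ((k, r), 0)) = X ((k, r), 0) := by
    intro k r hk
    rw [killNonneg, aeval_X, if_neg (by simpa using hk)]
  refine eq_smul_of_coord b fun p q t => coord_mul_of_integral b hij p q ?_ t
  -- A product of components of two different fields detects the factor. The substitution
  -- `killNonneg` commutes with `dx`, so it preserves total derivatives.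
  have h1 := h (X ((i, q), 0) * X ((j, p), 0))
  rw [Derivation.leibniz, evol_X, evol_X] at h1
  obtain ⟨g, hg⟩ := (integral_eq_zero_iff _).mp h1
  have h2 := congrArg (killNonneg (top m reduced) n ℝ) hg
  rw [killNonneg_dx, smul_eq_mul, smul_eq_mul, map_add, map_mul, map_mul, hX i q (by simp [i]),
    hX j p (by simp [j])] at h2
  rw [integral_eq_zero_iff]
  refine ⟨_, h2.trans ?_⟩
  rw [Function.iterate_zero, id, id, hc j p (by simp [j]), hc i q (by simp [i])]
  ring

/-- Trace forms which induce the same bracket are proportional. -/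
theorem eq_smul_of_brackets_eq [NeZero n] {ω ω' : A →ₗ[ℝ] ℝ} (hω : IsTraceForm ω)
    (hω' : IsTraceForm ω') {L : PDO (dx (top m reduced) n A)} (hm : 1 ≤ m)
    (hL : PDO.IsMonic L 1) (hLm : L ^ m = laxOp b m reduced)
    {H : PDO (dx (top m reduced) n A) → PDO (dx (top m reduced) n A)}
    (hH : ∀ v X, H (constOp _ n A v * X) = constOp _ n A v * H X)
    {f : DiffPoly (top m reduced) n ℝ}
    (hf : (H (covectorOp b ω m reduced f)).val = flow b m L.val 1)
    (h : ∀ g, trRes ω (H (covectorOp b ω m reduced f) * covectorOp b ω m reduced g) =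
      trRes ω' (H (covectorOp b ω' m reduced f) * covectorOp b ω' m reduced g)) :
    ∃ a : ℝ, ω = a • ω' := by
  obtain ⟨v, hv⟩ := exists_mul_form b hω' ω
  let P := H (covectorOp b ω m reduced f)
  have hP : OrdLE P.val (top m reduced) := by
    change OrdLE (H (covectorOp b ω m reduced f)).val _
    rw [hf]
    exact ordLE_flow b hω m reduced hm hL hLm le_rfl
  have hvP : OrdLE (constOp _ n A v * P).val (top m reduced) := fun k hk => by
    rw [constOp_mul_val, hP k hk, mul_zero]
  have hsub : ∀ k, (constOp _ n A (v - 1) * P).val k = (constOp _ n A v * P).val k - P.val k := by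
    intro k
    rw [constOp_mul_val, constOp_mul_val, map_sub, map_one, sub_mul, one_mul]
  -- The same density `f` generates `P` for `ω` and `v P` for `ω'`. Equality of the brackets says
  -- that `(v - 1) P` acts trivially on functionals.
  obtain ⟨a, ha⟩ := eq_algebraMap_of_flow_one b m reduced hm hL hLm (w := v - 1)
    (P := (constOp _ n A (v - 1) * P).val) (fun k => by rw [constOp_mul_val, hf]) fun g => by
      have h1 := h g
      rw [covectorOp_change b m reduced hω hω' hv f, hH, trRes_mul_covectorOp b hω m reduced hP,
        trRes_mul_covectorOp b hω' m reduced hvP, integral_evol, integral_evol] at h1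
      obtain ⟨s, J, hs⟩ := exists_jetIn g
      rw [integral_evol, hs.finsum_mul_varDeriv]
      rw [hs.finsum_mul_varDeriv, hs.finsum_mul_varDeriv, ← sub_eq_zero, ← integral_sub,
        ← Finset.sum_sub_distrib] at h1
      rw [← neg_eq_zero, ← integral_neg, ← Finset.sum_neg_distrib, ← h1]
      congr 1
      refine Finset.sum_congr rfl fun α _ => ?_
      rw [components, hsub, applyCoeff_sub]
      change -((components b _ α - components b _ α) * _) = _
      ring
  refine ⟨a + 1, ?_⟩
  have hv' : v = algebraMap ℝ A (a + 1) := by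
    rw [map_add, map_one, ← ha, sub_add_cancel]
  rw [hv, hv']
  ext x
  rw [LinearMap.comp_apply, LinearMap.mulLeft_apply, ← Algebra.smul_def, map_smul,
    LinearMap.smul_apply]

end FirstFlow

section BracketsInjective

variable {n : ℕ} {A : Type} [CommRing A] [Algebra ℝ A] (b : Module.Basis (Fin n) ℝ A)
  (m : ℕ) (reduced : Bool)

/-- Trace forms with a common first, or second, bracket are proportional. -/
theorem IsBiHamiltonian.eq_smul [NeZero n] {ω ω' : A →ₗ[ℝ] ℝ} (hω : IsTraceForm ω)
    (hω' : IsTraceForm ω') (hm : 1 ≤ m) {L : PsiDO (DiffPoly (top m reduced) n A)}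
    (hL : IsLax b m reduced L) {B₀ B₁ B₀' B₁' : Bracket (top m reduced) n}
    (h : IsBiHamiltonian b ω m reduced L B₀ B₁) (h' : IsBiHamiltonian b ω' m reduced L B₀' B₁')
    (hB : B₀ = B₀' ∨ B₁ = B₁') : ∃ a : ℝ, ω = a • ω' := by
  obtain ⟨L, rfl, hL1, hLm⟩ := exists_isMonic_of_isLax b m reduced hm hL
  have hpair : ∀ (φ : A →ₗ[ℝ] ℝ) (P : PDO (dx (top m reduced) n A)) g,
      trRes φ (P * covectorOp b φ m reduced g) =
      integral (pairing φ P.val (covector b φ m reduced g)) := fun φ P g => by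
    rw [trRes_apply, PDO.mul_val, covectorOp_val]
    rfl
  rcases hB with rfl | rfl
  · refine eq_smul_of_brackets_eq b m reduced hω hω' hm hL1 hLm (adler_constOp_mul · _ ·)
      (adler_covectorOp_hamZero b hω m reduced hm hL1 hLm le_rfl) fun g => ?_
    rw [hpair, hpair, adler_val, adler_val, laxOp_val, covectorOp_val, covectorOp_val,
      ← h.bracket_zero, ← h'.bracket_zero]
  · refine eq_smul_of_brackets_eq b m reduced hω hω' hm hL1 hLm (adlerInf_constOp_mul b m reduced)
      (adlerInf_covectorOp_hamInfty b hω m reduced hm hLm le_rfl) fun g => ?_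
    rw [hpair, hpair, adlerInf_val, adlerInf_val, laxOp_val, covectorOp_val, covectorOp_val,
      ← h.bracket_infty, ← h'.bracket_infty]

end BracketsInjective

/-! ### The algebra `Z_n` -/

theorem basicForm_basis (n : ℕ) (k q : Fin n) :
    basicForm n k (znBasis n q) = if q = k ∨ (q : ℕ) + 1 = n then 1 else 0 := by
  rw [basicForm, LinearMap.add_apply, Module.Basis.coord_apply, Module.Basis.repr_self,
    Finsupp.single_apply]
  by_cases hk : (k : ℕ) + 1 = n
  · rw [if_pos hk, LinearMap.zero_apply, add_zero]
    refine if_congr ?_ rfl rfl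
    rw [Fin.ext_iff]
    omega
  · rw [if_neg hk, Module.Basis.coord_apply, Module.Basis.repr_self, Finsupp.single_apply]
    simp only [Fin.ext_iff]
    split_ifs <;> first | omega | simp

theorem basicForm_injective (n : ℕ) : Function.Injective (basicForm n) := by
  have key : ∀ k k' : Fin n, basicForm n k = basicForm n k' → (k : ℕ) + 1 ≠ n → k = k' := by
    intro k k' h hk
    have h1 := LinearMap.congr_fun h (znBasis n k)
    rw [basicForm_basis, basicForm_basis, if_pos (Or.inl rfl)] at h1
    by_contra hne
    rw [if_neg (by tauto)] at h1
    exact one_ne_zero h1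
  intro k k' h
  by_cases hk : (k : ℕ) + 1 = n
  · by_cases hk' : (k' : ℕ) + 1 = n
    · exact Fin.ext (by omega)
    · exact (key k' k h.symm hk').symm
  · exact key k k' h hk

/-- The form is `1` on the socle generator `Λ^(n-1)`. If the coefficients of `a` below `s` vanish,
then `a Λ^(n-1-s)` is the coefficient at `s` times this generator, so the coefficients vanish one
after another. -/
theorem isTraceForm_basicForm (n : ℕ) (k : Fin n) : IsTraceForm (basicForm n k) := by
  intro a ha
  have hn : 0 < n := lt_of_le_of_lt (Nat.zero_le _) k.2
  let x : Zn n := AdjoinRoot.root ((Polynomial.X : Polynomial ℝ) ^ n)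
  have hx : x ^ n = 0 := by
    have := AdjoinRoot.eval₂_root ((Polynomial.X : Polynomial ℝ) ^ n)
    rwa [Polynomial.eval₂_X_pow] at this
  have hb : ∀ q : Fin n, znBasis n q = x ^ (q : ℕ) := znBasis_apply n
  have hlast : basicForm n k (x ^ (n - 1)) = 1 := by
    have := basicForm_basis n k ⟨n - 1, by omega⟩
    rwa [hb, if_pos (Or.inr (by simp; omega))] at this
  have key : ∀ s : ℕ, ∀ hs : s < n, (znBasis n).repr a ⟨s, hs⟩ = 0 := by
    intro s
    induction s using Nat.strong_induction_on with
    | _ s ih =>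
      intro hs
      have h1 := ha (x ^ (n - 1 - s))
      have h2 : a * x ^ (n - 1 - s) = (znBasis n).repr a ⟨s, hs⟩ • x ^ (n - 1) := by
        conv_lhs => rw [← (znBasis n).sum_repr a]
        rw [Finset.sum_mul, Finset.sum_eq_single ⟨s, hs⟩]
        · rw [hb, smul_mul_assoc, ← pow_add]
          congr 2
          simp
          omega
        · intro q _ hq
          rcases lt_or_gt_of_ne (fun h : (q : ℕ) = s => hq (Fin.ext h)) with h | h
          · rw [show q = ⟨(q : ℕ), q.2⟩ from rfl, ih q h q.2, zero_smul, zero_mul]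
          · rw [hb, smul_mul_assoc, ← pow_add, show (q : ℕ) + (n - 1 - s) = n + (q - s - 1) by omega,
              pow_add, hx, zero_mul, smul_zero]
        · intro h
          exact absurd (Finset.mem_univ _) h
      rw [h2, map_smul, hlast, smul_eq_mul, mul_one] at h1
      exact h1
  exact (znBasis n).ext_elem fun q => by rw [key q q.2, map_zero, Finsupp.zero_apply]

/-- All the forms take the value `1` on `Λ^(n-1)`, which fixes the factor of proportionality. The
summand `a_{n-1}` in their definition provides this normalisation. -/
theorem eq_of_basicForm_eq_smul {n : ℕ} {k k' : Fin n} {a : ℝ}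
    (h : basicForm n k = a • basicForm n k') : k = k' := by
  have hn : 0 < n := lt_of_le_of_lt (Nat.zero_le _) k.2
  have h1 := LinearMap.congr_fun h (znBasis n ⟨n - 1, by omega⟩)
  have e : n - 1 + 1 = n := by omega
  rw [LinearMap.smul_apply, basicForm_basis, basicForm_basis, if_pos (Or.inr e), if_pos (Or.inr e),
    smul_eq_mul, mul_one] at h1
  rw [← h1, one_smul] at h
  exact basicForm_injective n h

end FrobeniusKP

theorem corollary4p5 (n : ℕ) (hn : 1 ≤ n) :
    (∀ k : Fin n, FrobeniusKP.IsTraceForm (FrobeniusKP.basicForm n k)) ∧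
    Function.Injective (FrobeniusKP.basicForm n) ∧
    ∀ (m : ℕ), 1 ≤ m → ∀ (reduced : Bool),
      (∃! L, FrobeniusKP.IsLax (FrobeniusKP.znBasis n) m reduced L) ∧
      ∀ L, FrobeniusKP.IsLax (FrobeniusKP.znBasis n) m reduced L →
        ∃ B₀ B₁ : Fin n → FrobeniusKP.Bracket (FrobeniusKP.top m reduced) n,
          (∀ k : Fin n, FrobeniusKP.IsBiHamiltonian (FrobeniusKP.znBasis n)
            (FrobeniusKP.basicForm n k) m reduced L (B₀ k) (B₁ k)) ∧
          Function.Injective B₀ ∧ Function.Injective B₁ := by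
  have : NeZero n := ⟨by omega⟩
  have ht := FrobeniusKP.isTraceForm_basicForm n
  refine ⟨ht, FrobeniusKP.basicForm_injective n, fun m hm reduced =>
    ⟨FrobeniusKP.existsUnique_isLax _ m reduced hm, fun L hL => ?_⟩⟩
  choose B₀ B₁ hB using fun k =>
    FrobeniusKP.exists_isBiHamiltonian (FrobeniusKP.znBasis n) (ht k) m reduced hm hL
  refine ⟨B₀, B₁, hB, fun k k' h => ?_, fun k k' h => ?_⟩
  · obtain ⟨a, ha⟩ := (hB k).eq_smul _ m reduced (ht k) (ht k') hm hL (hB k') (Or.inl h)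
    exact FrobeniusKP.eq_of_basicForm_eq_smul ha
  · obtain ⟨a, ha⟩ := (hB k).eq_smul _ m reduced (ht k) (ht k') hm hL (hB k') (Or.inr h)
    exact FrobeniusKP.eq_of_basicForm_eq_smul ha
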